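/- **Terminology on sites.** Let $\mathcal C$ be a category. A collection $\mathcal T$ of morphisms of $\mathcal C$ is *semi-localizing* if it contains the identities, is closed under composition, and every diagram $Y_1\to X\xleftarrow{f} Y_2$ with $f\in\mathcal T$ can be completed to a commutative square by an object $Z$, a morphism $Z\to Y_1$ in $\mathcal T$ and a morphism $Z\to Y_2$. The topology *associated* to $\mathcal T$ is the Grothendieck topology in which a sieve is covering iff it contains a morphism of $\mathcal T$; such topologies are called $A$-topologies. For a Grothendieck topology $J$, let $\mathcal T(J)$ be the class of morphisms $f:Y\to X$ for which the sieve on $X$ generated by $f$ is covering. $(\mathcal C,J)$ is a *$B$-site* if $J$ is an $A$-topology, all morphisms of $\mathcal C$ are epimorphisms, and a composite $f\circ g$ lies in $\mathcal T(J)$ iff $f$ and $g$ both do. A morphism $Y\to X$ is a *Galois covering* if for every $Z$ the group $\mathrm{Aut}_X(Y)$ acts simply transitively on each non-empty fibre of $\mathrm{Hom}(Z,Y)\to\mathrm{Hom}(Z,X)$. A category is *$\Lambda$-connected* if any two objects $X,Y$ fit in a diagram $X\leftarrow Z\to Y$. Write $\mathcal C(\mathcal T)$ for the category with the objects of $\mathcal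 C$ and the morphisms in $\mathcal T$. $(\mathcal C,J)$ is a *$Y$-site* if it is a $B$-site, $\mathcal C$ is essentially small, $\mathcal C(\mathcal T(J))$ is $\Lambda$-connected, and for every $f:Y\to X$ in $\mathcal T(J)$ there is $g:Z\to Y$ in $\mathcal T(J)$ such that $f\circ g$ is a Galois covering. A *grid* of a $Y$-site $(\mathcal C,J)$ is a pair $(\mathcal C_0,\iota_0)$ of a small $\Lambda$-connected poset $\mathcal C_0$, viewed as a category, and a functor $\iota_0:\mathcal C_0\to\mathcal C$ such that (a) the restriction of $\iota_0$ to the *edge objects* (the objects $E$ such that $\iota_0$ sends every morphism $Y\to E$ of $\mathcal C_0$ into $\mathcal T(J)$) is essentially surjective; (b) for every $X$ in $\mathcal C_0$ the functor $\mathcal C_0(\iota_0^{-1}\mathcal T(J))_{/X}\to\mathcal C(\mathcal T(J))_{/\iota_0(X)}$ is essentially surjective; (c) for every $X$ in $\mathcal C_0$ the functor of under-categories $\mathcal C_{0,X/}\to\mathcal C_{\iota_0(X)/}$ is an equivalence. **Setting.** Let $X$ be a regular noetherian scheme all of whose irreducible components have Krull dimension one, and let $d\ge 1$. Let $\mathcal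 C^d$ be the category whose objects are the coherent $\mathcal O_X$-modules of finite length which admit a surjection from $\mathcal O_X^{\oplus d}$, and in which a morphism $N\to N'$ is an isomorphism class of diagrams $$N'\overset{p}{\twoheadleftarrow}N''\overset{i}{\hookrightarrow}N$$ of $\mathcal O_X$-modules, composed by means of fibre products. A morphism is a *fibration* if $i$ is an isomorphism, and a *cofibration* if $p$ is an isomorphism. Let $K_X=j_*j^*\mathcal O_X$, where $j$ is the morphism to $X$ from the disjoint union of the generic points of $X$, and let $V=K_X^{\oplus d}\supset\mathcal O_X^{\oplus d}$. A *lattice* is a coherent $\mathcal O_X$-submodule $L\subset V$ with $j^*(V/L)=0$. Let $\mathrm{Pair}^d$ be the poset of pairs $(L_1,L_2)$ of lattices with $L_1\subset L_2$, where $(L_1,L_2)\le(L_1',L_2')$ iff $L_1'\subset L_1\subset L_2\subset L_2'$, and let $\mathcal C_0^d$ be the opposite of the poset category $\mathrm{Pair}^d$. Let $\mathcal C^d_{0,m}$ (resp. $\mathcal C^d_{0,r}$) be the full subcategory of $\mathcal C_0^d$ of the pairs with $L_2\subset\mathcal O_X^{\oplus d}$ (resp. $\mathcal O_X^{\oplus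 d}\subset L_1$). **Theorem.** (0) For every $(L_1,L_2)\in\mathrm{Pair}^d$ the module $L_2/L_1$ is an object of $\mathcal C^d$. Let $\iota_0^d:\mathcal C_0^d\to\mathcal C^d$ be the functor which sends $(L_1,L_2)$ to $L_2/L_1$, and the morphism $(L_1',L_2')\to(L_1,L_2)$ given by $L_1'\subset L_1\subset L_2\subset L_2'$ to the class of $L_2/L_1\twoheadleftarrow L_2/L_1'\hookrightarrow L_2'/L_1'$; let $\iota_{0,m}^d$ and $\iota_{0,r}^d$ be its restrictions to $\mathcal C_{0,m}^d$ and $\mathcal C_{0,r}^d$. (1) The classes $\mathcal T^d$, $\mathcal T^d_m$ and $\mathcal T^d_r$ of all morphisms, of fibrations and of cofibrations of $\mathcal C^d$ are semi-localizing; let $J^d$, $J^d_m$, $J^d_r$ be the associated topologies. (2) $(\mathcal C^d,J^d)$, $(\mathcal C^d,J^d_m)$ and $(\mathcal C^d,J^d_r)$ are $Y$-sites. (3) $(\mathcal C_0^d,\iota_0^d)$, $(\mathcal C_{0,m}^d,\iota_{0,m}^d)$ and $(\mathcal C_{0,r}^d,\iota_{0,r}^d)$ are grids of $(\mathcal C^d,J^d)$,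 $(\mathcal C^d,J^d_m)$ and $(\mathcal C^d,J^d_r)$, respectively. -/

import Mathlib

open CategoryTheory Limits

universe w v u v₁ u₁

/-! ### Sites -/

namespace YSite

variable {C : Type u} [Category.{v} C]

/-- A semi-localizing collection of morphisms: it contains the identities, is closed under
composition, and every diagram `Y₁ ⟶ X ⟵ Y₂` with `Y₂ ⟶ X` in `T` can be completed to a commutative
square in which `Z ⟶ Y₁` is in `T`. -/
structure IsSemiLocalizing (T : MorphismProperty C) : Prop where
  id_mem (X : C) : T (𝟙 X)
  comp_mem {X Y Z : C} (f : X ⟶ Y) (g : Y ⟶ Z) : T f → T g → T (f ≫ g)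
  square {Y₁ Y₂ X : C} (f₁ : Y₁ ⟶ X) (f₂ : Y₂ ⟶ X) : T f₂ →
    ∃ (Z : C) (g₁ : Z ⟶ Y₁) (g₂ : Z ⟶ Y₂), T g₁ ∧ g₁ ≫ f₁ = g₂ ≫ f₂

/-- The Grothendieck topology associated to a semi-localizing collection `T`: a sieve is covering
if and only if it contains a morphism of `T`. -/
def IsSemiLocalizing.topology {T : MorphismProperty C} (h : IsSemiLocalizing T) :
    GrothendieckTopology C where
  sieves X := {R | ∃ (Y : C) (f : Y ⟶ X), T f ∧ R f}
  top_mem' X := ⟨X, 𝟙 X, h.id_mem X, trivial⟩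
  pullback_stable' := by
    rintro X Y R g ⟨Z, f, hf, hR⟩
    obtain ⟨W, g₁, g₂, hg₁, e⟩ := h.square g f hf
    refine ⟨W, g₁, hg₁, ?_⟩
    change R (g₁ ≫ g)
    rw [e]
    exact R.downward_closed hR g₂
  transitive' := by
    rintro X S ⟨Y, f, hf, hS⟩ R hR
    obtain ⟨Z, g, hg, hgR⟩ := hR hS
    exact ⟨Z, g ≫ f, h.comp_mem g f hg hf, hgR⟩

/-- An `A`-topology is the topology associated to some semi-localizing collection. -/
def IsATopology (J : GrothendieckTopology C) : Prop :=
  ∃ (T : MorphismProperty C) (h : IsSemiLocalizing T), J = h.topology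

/-- `𝒯(J)`: the morphisms `f : Y ⟶ X` such that the sieve on `X` generated by `f` is covering. -/
def coveringMorphisms (J : GrothendieckTopology C) : MorphismProperty C :=
  fun _ X f => Sieve.generate (Presieve.singleton f) ∈ J X

/-- A `B`-site: the topology is an `A`-topology, every morphism of the category is an epimorphism,
and a composite belongs to `𝒯(J)` if and only if both factors do. -/
structure IsBSite (J : GrothendieckTopology C) : Prop where
  isATopology : IsATopology J
  epi {X Y : C} (f : X ⟶ Y) : Epi f
  comp_iff {Z Y X : C} (g : Z ⟶ Y) (f : Y ⟶ X) :
    coveringMorphisms J (g ≫ f) ↔ coveringMorphisms J g ∧ coveringMorphisms J f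

/-- A Galois covering: for every object `Z`, the group `Aut_X(Y)` acts simply transitively on the
fibres of `Hom(Z, Y) → Hom(Z, X)` (a pseudo-torsor). -/
def IsGaloisCovering {Y X : C} (f : Y ⟶ X) : Prop :=
  ∀ (Z : C) (a b : Z ⟶ Y), a ≫ f = b ≫ f → ∃! σ : Aut (Over.mk f), a ≫ σ.hom.left = b

/-- `T` contains enough Galois coverings. -/
def HasEnoughGaloisCoverings (T : MorphismProperty C) : Prop :=
  ∀ (Y X : C) (f : Y ⟶ X), T f → ∃ (Z : C) (g : Z ⟶ Y), T g ∧ IsGaloisCovering (g ≫ f)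

/-- Any two objects `X`, `Y` fit in a diagram `X ⟵ Z ⟶ Y` of morphisms of `T`; that is, the
subcategory `C(T)`, with the same objects as `C` and with the morphisms in `T`, is `Λ`-connected. -/
def IsLambdaConnected (T : MorphismProperty C) : Prop :=
  ∀ X Y : C, ∃ (Z : C) (f : Z ⟶ X) (g : Z ⟶ Y), T f ∧ T g

/-- A `Y`-site: a `B`-site on an essentially small category such that `C(𝒯(J))` is `Λ`-connected
and `𝒯(J)` contains enough Galois coverings. -/
structure IsYSite (J : GrothendieckTopology C) : Prop where
  isBSite : IsBSite J
  essentiallySmall : EssentiallySmall.{w} C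
  isLambdaConnected : IsLambdaConnected (coveringMorphisms J)
  enoughGalois : HasEnoughGaloisCoverings (coveringMorphisms J)

variable {C₀ : Type u₁} [Category.{v₁} C₀]

/-- `E` is an edge object of `C₀`: every morphism `Y ⟶ E` in `C₀` is sent into `𝒯(J)`. -/
def IsEdgeObject (J : GrothendieckTopology C) (ι : C₀ ⥤ C) (E : C₀) : Prop :=
  ∀ (Y : C₀) (f : Y ⟶ E), coveringMorphisms J (ι.map f)

/-- The pair `(C₀, ι)` is a grid of the site `(C, J)`. -/
structure IsGrid (J : GrothendieckTopology C) (ι : C₀ ⥤ C) : Prop where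
  /-- `C₀` is a small category, and is a poset. -/
  small : Small.{w} C₀
  thin : Quiver.IsThin C₀
  skeletal : Skeletal C₀
  isLambdaConnected : IsLambdaConnected (⊤ : MorphismProperty C₀)
  /-- The restriction of `ι` to the edge objects is essentially surjective. -/
  essSurj_edge (X : C) : ∃ E : C₀, IsEdgeObject J ι E ∧ Nonempty (ι.obj E ≅ X)
  /-- For every object `X` of `C₀`, the functor `C₀(ι⁻¹𝒯(J))_{/X} ⥤ C(𝒯(J))_{/ι(X)}` is essentially
  surjective. -/
  essSurj_over (X : C₀) {Y' : C} (f' : Y' ⟶ ι.obj X) : coveringMorphisms J f' →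
    ∃ (Y : C₀) (f : Y ⟶ X) (e : ι.obj Y ≅ Y'),
      coveringMorphisms J (ι.map f) ∧ ι.map f = e.hom ≫ f'
  /-- For every object `X` of `C₀`, the functor `C₀_{X/} ⥤ C_{ι(X)/}` is an equivalence. -/
  isEquivalence_under (X : C₀) : (Under.post (X := X) ι).IsEquivalence

end YSite

/-! ### Quillen's category of subquotients (with arrows reversed) -/

/-- The category with the same objects as the abelian category `A` in which a morphism `N ⟶ N'` is
an isomorphism class of diagrams `N' ↞ M ↪ N`. -/
structure QCat (A : Type u) where
  /-- The underlying object of `A`. -/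
  obj : A

namespace QCat

variable {A : Type u} [Category.{v} A]

/-- A diagram `N' ↞ M ↪ N`. -/
structure Diagram (N N' : A) where
  /-- The middle object. -/
  mid : A
  /-- The monomorphism. -/
  i : mid ⟶ N
  /-- The epimorphism. -/
  p : mid ⟶ N'
  mono : Mono i
  epi : Epi p

/-- Isomorphic diagrams. -/
def Diagram.Equiv {N N' : A} (D E : Diagram N N') : Prop :=
  ∃ e : D.mid ≅ E.mid, e.hom ≫ E.i = D.i ∧ e.hom ≫ E.p = D.p

instance diagramSetoid (N N' : A) : Setoid (Diagram N N') where
  r := Diagram.Equiv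
  iseqv :=
    { refl := fun D => ⟨Iso.refl _, by simp, by simp⟩
      symm := by
        rintro D E ⟨e, h₁, h₂⟩
        exact ⟨e.symm, by simp [← h₁], by simp [← h₂]⟩
      trans := by
        rintro D E F ⟨e, h₁, h₂⟩ ⟨e', h₁', h₂'⟩
        exact ⟨e ≪≫ e', by simp [h₁, h₁'], by simp [h₂, h₂']⟩ }

variable [Abelian A]

/-- The identity diagram. -/
def Diagram.id (N : A) : Diagram N N := ⟨N, 𝟙 N, 𝟙 N, inferInstance, inferInstance⟩

/-- The composite of `N' ↞ M ↪ N` and `N'' ↞ M' ↪ N'` is `N'' ↞ M ×_{N'} M' ↪ N`. -/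
noncomputable def Diagram.comp {N N' N'' : A} (D : Diagram N N') (E : Diagram N' N'') :
    Diagram N N'' :=
  haveI := D.mono
  haveI := D.epi
  haveI := E.mono
  haveI := E.epi
  ⟨pullback D.p E.i, pullback.fst D.p E.i ≫ D.i, pullback.snd D.p E.i ≫ E.p,
    inferInstance, inferInstance⟩

/-- Morphisms: isomorphism classes of diagrams. -/
def Hom (N N' : QCat A) : Type (max u v) := Quotient (diagramSetoid N.obj N'.obj)

lemma Diagram.comp_equiv {N N' N'' : A} {D D' : Diagram N N'} {E E' : Diagram N' N''}
    (h : D.Equiv D') (k : E.Equiv E') : (D.comp E).Equiv (D'.comp E') := by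
  obtain ⟨e, h₁, h₂⟩ := h
  obtain ⟨e', k₁, k₂⟩ := k
  have := pullback.map_isIso D.p E.i D'.p E'.i e.hom e'.hom (𝟙 N') (by simp [h₂]) (by simp [k₁])
  refine ⟨@asIso _ _ (pullback D.p E.i) (pullback D'.p E'.i)
    (pullback.map D.p E.i D'.p E'.i e.hom e'.hom (𝟙 N') (by simp [h₂]) (by simp [k₁])) this, ?_, ?_⟩
  · exact (pullback.lift_fst_assoc _ _ _ _).trans
      ((Category.assoc _ _ _).trans (congrArg (pullback.fst D.p E.i ≫ ·) h₁))
  · exact (pullback.lift_snd_assoc _ _ _ _).trans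
      ((Category.assoc _ _ _).trans (congrArg (pullback.snd D.p E.i ≫ ·) k₂))

lemma Diagram.id_comp {N N' : A} (D : Diagram N N') : ((Diagram.id N).comp D).Equiv D := by
  refine ⟨@asIso _ _ (pullback (𝟙 N) D.i) D.mid (pullback.snd (𝟙 N) D.i)
    (pullback_snd_iso_of_left_iso _ _), ?_, ?_⟩
  · simp [Diagram.comp, Diagram.id, ← pullback.condition]
  · simp [Diagram.comp, Diagram.id]

lemma Diagram.comp_id {N N' : A} (D : Diagram N N') : (D.comp (Diagram.id N')).Equiv D := by
  refine ⟨@asIso _ _ (pullback D.p (𝟙 N')) D.mid (pullback.fst D.p (𝟙 N'))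
    (pullback_fst_iso_of_right_iso _ _), ?_, ?_⟩
  · simp [Diagram.comp, Diagram.id]
  · simp [Diagram.comp, Diagram.id, pullback.condition]

lemma Diagram.assoc {N N' N'' N''' : A} (D : Diagram N N') (E : Diagram N' N'')
    (F : Diagram N'' N''') : ((D.comp E).comp F).Equiv (D.comp (E.comp F)) := by
  refine ⟨pullbackAssoc D.p E.i E.p F.i, ?_, ?_⟩
  · simp [Diagram.comp]
  · simp [Diagram.comp]

noncomputable instance : Category.{max u v} (QCat A) where
  Hom := Hom
  id N := Quotient.mk _ (Diagram.id N.obj)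
  comp f g := Quotient.map₂ Diagram.comp (fun _ _ h _ _ k => Diagram.comp_equiv h k) f g
  id_comp := by
    rintro N N' ⟨D⟩
    exact Quotient.sound D.id_comp
  comp_id := by
    rintro N N' ⟨D⟩
    exact Quotient.sound D.comp_id
  assoc := by
    rintro N N' N'' N''' ⟨D⟩ ⟨E⟩ ⟨F⟩
    exact Quotient.sound (D.assoc E F)

/-- The morphism represented by a diagram. -/
def homMk {N N' : A} (D : Diagram N N') : (QCat.mk N) ⟶ (QCat.mk N') := Quotient.mk _ D

/-- Fibrations: represented by a diagram `N' ↞ M ↪ N` in which `M ↪ N` is an isomorphism. -/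
def fibrations (A : Type u) [Category.{v} A] [Abelian A] : MorphismProperty (QCat A) :=
  fun N N' f => ∃ D : Diagram N.obj N'.obj, IsIso D.i ∧ f = homMk D

/-- Cofibrations: represented by a diagram `N' ↞ M ↪ N` in which `M ↠ N'` is an isomorphism. -/
def cofibrations (A : Type u) [Category.{v} A] [Abelian A] : MorphismProperty (QCat A) :=
  fun N N' f => ∃ D : Diagram N.obj N'.obj, IsIso D.p ∧ f = homMk D

end QCat

/-! ### Pairs of subobjects and their quotients -/

section Subquotient

variable {A : Type u} [Category.{v} A]

/-- The poset of pairs `(L₁, L₂)` of subobjects of `V` satisfying `P`, with `L₁ ⊆ L₂`, ordered by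
`(L₁, L₂) ≤ (L₁', L₂') ↔ L₁' ⊆ L₁ ⊆ L₂ ⊆ L₂'`. -/
@[ext]
structure SubobjectPair {V : A} (P : Subobject V → Prop) where
  /-- The smaller subobject `L₁`. -/
  fst : Subobject V
  /-- The larger subobject `L₂`. -/
  snd : Subobject V
  fst_prop : P fst
  snd_prop : P snd
  le : fst ≤ snd

instance {V : A} (P : Subobject V → Prop) : PartialOrder (SubobjectPair P) where
  le a b := b.fst ≤ a.fst ∧ a.snd ≤ b.snd
  le_refl a := ⟨le_rfl, le_rfl⟩
  le_trans a b c h k := ⟨k.1.trans h.1, h.2.trans k.2⟩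
  le_antisymm a b h k := SubobjectPair.ext (le_antisymm k.1 h.1) (le_antisymm h.2 k.2)

variable [Abelian A] {V : A}

/-- The quotient `M / L` for subobjects `L ≤ M` of `V`. -/
noncomputable def subquot {L M : Subobject V} (h : L ≤ M) : A := cokernel (Subobject.ofLE L M h)

/-- The morphism `M / L ⟶ M' / L'` induced by the inclusions. -/
noncomputable def subquotMap {L M L' M' : Subobject V} (h : L ≤ M) (h' : L' ≤ M') (hL : L ≤ L')
    (hM : M ≤ M') : subquot h ⟶ subquot h' :=
  cokernel.map _ _ (Subobject.ofLE L L' hL) (Subobject.ofLE M M' hM) (by simp)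

/-- The projection `M ⟶ M / L`. -/
noncomputable def subquotπ {L M : Subobject V} (h : L ≤ M) : (M : A) ⟶ subquot h := cokernel.π _

instance {L M : Subobject V} (h : L ≤ M) : Epi (subquotπ h) :=
  inferInstanceAs (Epi (cokernel.π _))

@[simp]
lemma subquotπ_map {L M L' M' : Subobject V} (h : L ≤ M) (h' : L' ≤ M') (hL : L ≤ L')
    (hM : M ≤ M') : subquotπ h ≫ subquotMap h h' hL hM = Subobject.ofLE M M' hM ≫ subquotπ h' := by
  exact cokernel.π_desc _ _ _

@[simp]
lemma subquotπ_map_assoc {L M L' M' : Subobject V} (h : L ≤ M) (h' : L' ≤ M') (hL : L ≤ L')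
    (hM : M ≤ M') {T : A} (f : subquot h' ⟶ T) :
    subquotπ h ≫ subquotMap h h' hL hM ≫ f = Subobject.ofLE M M' hM ≫ subquotπ h' ≫ f := by
  rw [← Category.assoc, subquotπ_map, Category.assoc]

lemma ofLE_subquotπ {L M : Subobject V} (h : L ≤ M) : Subobject.ofLE L M h ≫ subquotπ h = 0 :=
  cokernel.condition _

lemma subquot_lift {L M : Subobject V} (h : L ≤ M) {T : A} (m : T ⟶ (M : A))
    (hm : m ≫ subquotπ h = 0) : ∃ l : T ⟶ (L : A), l ≫ Subobject.ofLE L M h = m := by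
  let S := ShortComplex.mk (Subobject.ofLE L M h) (cokernel.π (Subobject.ofLE L M h))
    (cokernel.condition _)
  have hS : S.Exact := ShortComplex.exact_cokernel _
  have : Mono S.f := inferInstanceAs (Mono (Subobject.ofLE L M h))
  exact ⟨hS.lift m hm, hS.lift_f m hm⟩

lemma subquotMap_comp {L M L' M' L'' M'' : Subobject V} (h : L ≤ M) (h' : L' ≤ M') (h'' : L'' ≤ M'')
    (hL : L ≤ L') (hM : M ≤ M') (hL' : L' ≤ L'') (hM' : M' ≤ M'') :
    subquotMap h h' hL hM ≫ subquotMap h' h'' hL' hM' =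
      subquotMap h h'' (hL.trans hL') (hM.trans hM') := by
  rw [← cancel_epi (subquotπ h)]
  simp

lemma subquotMap_self {L M : Subobject V} (h : L ≤ M) :
    subquotMap h h le_rfl le_rfl = 𝟙 _ := by
  rw [← cancel_epi (subquotπ h)]
  simp

lemma subquotMap_mono {L M M' : Subobject V} (h : L ≤ M) (h' : L ≤ M') (hM : M ≤ M') :
    Mono (subquotMap h h' le_rfl hM) := by
  rw [Preadditive.mono_iff_cancel_zero]
  intro T x hx
  obtain ⟨T', π, hπ, m, hm⟩ := surjective_up_to_refinements_of_epi (subquotπ h) x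
  obtain ⟨l, hl⟩ := subquot_lift h' (m ≫ Subobject.ofLE M M' hM) (by
    rw [Category.assoc, ← subquotπ_map h h' le_rfl hM, ← Category.assoc, ← hm, Category.assoc, hx,
      comp_zero])
  have : m = l ≫ Subobject.ofLE L M h := by
    rw [← cancel_mono (Subobject.ofLE M M' hM), ← hl]
    simp
  rw [← cancel_epi π, hm, this, Category.assoc, ofLE_subquotπ, comp_zero, comp_zero]

lemma subquotMap_epi {L L' M : Subobject V} (h : L ≤ M) (h' : L' ≤ M) (hL : L ≤ L') :
    Epi (subquotMap h h' hL le_rfl) := by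
  have : Epi (subquotπ h ≫ subquotMap h h' hL le_rfl) := by
    rw [subquotπ_map, Subobject.ofLE_refl, Category.id_comp]
    infer_instance
  exact epi_of_epi (subquotπ h) _

/-- The diagram `L₂/L₁ ↞ L₂/L₁' ↪ L₂'/L₁'` for `L₁' ⊆ L₁ ⊆ L₂ ⊆ L₂'`. -/
noncomputable def subquotDiagram {P : Subobject V → Prop} {a b : SubobjectPair P} (h : a ≤ b) :
    QCat.Diagram (subquot b.le) (subquot a.le) where
  mid := subquot (h.1.trans a.le)
  i := subquotMap (h.1.trans a.le) b.le le_rfl h.2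
  p := subquotMap (h.1.trans a.le) a.le h.1 le_rfl
  mono := subquotMap_mono _ _ _
  epi := subquotMap_epi _ _ _

lemma subquotDiagram_id {P : Subobject V → Prop} (a : SubobjectPair P) :
    (subquotDiagram (le_refl a)).Equiv (QCat.Diagram.id (subquot a.le)) :=
  ⟨Iso.refl _, by simp [subquotDiagram, QCat.Diagram.id, subquotMap_self],
    by simp [subquotDiagram, QCat.Diagram.id, subquotMap_self]⟩

lemma subquotDiagram_comp {P : Subobject V → Prop} {a b c : SubobjectPair P} (h : a ≤ b)
    (k : b ≤ c) : (subquotDiagram (h.trans k)).Equiv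
      ((subquotDiagram k).comp (subquotDiagram h)) := by
  let q : subquot (k.1.trans b.le) ⟶ subquot b.le := subquotMap (k.1.trans b.le) b.le k.1 le_rfl
  let j : subquot (h.1.trans a.le) ⟶ subquot b.le := subquotMap (h.1.trans a.le) b.le le_rfl h.2
  have := subquotMap_mono (k.1.trans b.le) c.le k.2
  have := subquotMap_mono (h.1.trans a.le) b.le h.2
  have hca : c.fst ≤ a.snd := (k.1.trans h.1).trans a.le
  let s : subquot hca ⟶ subquot (k.1.trans b.le) := subquotMap hca (k.1.trans b.le) le_rfl h.2
  let t : subquot hca ⟶ subquot (h.1.trans a.le) := subquotMap hca (h.1.trans a.le) k.1 le_rfl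
  have hst : s ≫ q = t ≫ j := by
    simp only [s, t, q, j, subquotMap_comp]
  let e : subquot hca ⟶ pullback q j := pullback.lift s t hst
  have : Mono e := by
    have : Mono (e ≫ pullback.fst q j) := by
      rw [pullback.lift_fst]
      exact subquotMap_mono _ _ _
    exact mono_of_mono e (pullback.fst q j)
  have : Epi e := by
    rw [epi_iff_surjective_up_to_refinements]
    intro T y
    obtain ⟨T₁, π₁, hπ₁, x, hx⟩ :=
      surjective_up_to_refinements_of_epi (subquotπ (h.1.trans a.le)) (y ≫ pullback.snd q j)
    obtain ⟨T₂, π₂, hπ₂, z, hz⟩ := surjective_up_to_refinements_of_epi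
      (subquotπ (k.1.trans b.le)) (π₁ ≫ y ≫ pullback.fst q j)
    have hq : subquotπ (k.1.trans b.le) ≫ q = subquotπ b.le := by
      refine (subquotπ_map (k.1.trans b.le) b.le k.1 le_rfl).trans ?_
      rw [Subobject.ofLE_refl, Category.id_comp]
    have hj : subquotπ (h.1.trans a.le) ≫ j = Subobject.ofLE _ _ h.2 ≫ subquotπ b.le :=
      subquotπ_map (h.1.trans a.le) b.le le_rfl h.2
    have e₁ : z ≫ subquotπ b.le = π₂ ≫ π₁ ≫ y ≫ pullback.fst q j ≫ q := by
      rw [← hq, ← Category.assoc, ← hz]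
      simp
    have e₂ : x ≫ Subobject.ofLE _ _ h.2 ≫ subquotπ b.le = π₁ ≫ y ≫ pullback.snd q j ≫ j := by
      rw [← hj, ← Category.assoc, ← hx]
      simp
    obtain ⟨l, hl⟩ := subquot_lift b.le (z - π₂ ≫ x ≫ Subobject.ofLE _ _ h.2) (by
      rw [Preadditive.sub_comp, Category.assoc, Category.assoc, e₁, e₂, pullback.condition,
        sub_self])
    let w : T₂ ⟶ (a.snd : A) := π₂ ≫ x + l ≫ Subobject.ofLE _ _ (h.1.trans a.le)
    have hw : w ≫ Subobject.ofLE _ _ h.2 = z := by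
      simp only [w, Preadditive.add_comp, Category.assoc, Subobject.ofLE_comp_ofLE, hl]
      abel
    refine ⟨T₂, π₂ ≫ π₁, inferInstance, w ≫ subquotπ hca, ?_⟩
    apply pullback.hom_ext
    · have : subquotπ hca ≫ s = Subobject.ofLE _ _ h.2 ≫ subquotπ (k.1.trans b.le) :=
        subquotπ_map hca (k.1.trans b.le) le_rfl h.2
      simp only [e, Category.assoc, pullback.lift_fst]
      rw [this, ← Category.assoc w, hw, ← hz]
    · have : subquotπ hca ≫ t = subquotπ (h.1.trans a.le) := by
        refine (subquotπ_map hca (h.1.trans a.le) k.1 le_rfl).trans ?_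
        rw [Subobject.ofLE_refl, Category.id_comp]
      simp only [e, Category.assoc, pullback.lift_snd]
      rw [this]
      simp only [w, Preadditive.add_comp, Category.assoc, ofLE_subquotπ, comp_zero, add_zero]
      rw [← hx]
  have : IsIso e := isIso_of_mono_of_epi e
  refine ⟨@asIso _ _ (subquot hca) (pullback q j) e this, ?_, ?_⟩
  · exact (pullback.lift_fst_assoc _ _ _ _).trans
      (subquotMap_comp hca (k.1.trans b.le) c.le le_rfl h.2 le_rfl k.2)
  · exact (pullback.lift_snd_assoc _ _ _ _).trans
      (subquotMap_comp hca (h.1.trans a.le) a.le k.1 le_rfl h.1 le_rfl)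

/-- The functor `(L₁, L₂) ↦ L₂/L₁`; the morphism `(L₁', L₂') ⟶ (L₁, L₂)` of the opposite category
of the poset of pairs, where `L₁' ⊆ L₁ ⊆ L₂ ⊆ L₂'`, is sent to the morphism represented by
`L₂/L₁ ↞ L₂/L₁' ↪ L₂'/L₁'`. -/
noncomputable def subquotFunctor (P : Subobject V → Prop) : (SubobjectPair P)ᵒᵖ ⥤ QCat A where
  obj a := ⟨subquot a.unop.le⟩
  map f := QCat.homMk (subquotDiagram (leOfHom f.unop))
  map_id a := Quotient.sound (subquotDiagram_id a.unop)
  map_comp f g := Quotient.sound (subquotDiagram_comp (leOfHom g.unop) (leOfHom f.unop))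

end Subquotient

/-! ### Finite-length modules and lattices on a scheme -/

namespace FiniteLengthModules

open AlgebraicGeometry

variable (X : Scheme.{u})

instance : HasFiniteBiproducts X.Modules := Abelian.hasFiniteBiproducts

/-- The structure sheaf `𝒪_X` as a module over itself. -/
noncomputable abbrev structureModule : X.Modules := SheafOfModules.unit X.ringCatSheaf

/-- Coherent modules on a noetherian scheme: quasi-coherent modules of finite type. -/
structure IsCoherent {X : Scheme.{u}} (M : X.Modules) : Prop where
  isQuasicoherent : SheafOfModules.IsQuasicoherent (R := X.ringCatSheaf) M
  isFiniteType : SheafOfModules.IsFiniteType (R := X.ringCatSheaf) M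

/-- Modules of finite length: the subobjects satisfy both chain conditions. -/
structure HasFiniteLength {X : Scheme.{u}} (M : X.Modules) : Prop where
  isNoetherian : IsNoetherianObject M
  isArtinian : IsArtinianObject M

/-- The module `𝒪_X^{⊕ d}`. -/
noncomputable abbrev freeModule (d : ℕ) : X.Modules := ⨁ fun _ : Fin d => structureModule X

/-- The objects of `C^d`: coherent `𝒪_X`-modules of finite length which admit a surjection
from `𝒪_X^{⊕ d}`. -/
def isObject (d : ℕ) : ObjectProperty (QCat X.Modules) := fun N =>
  IsCoherent N.obj ∧ HasFiniteLength N.obj ∧ ∃ p : freeModule X d ⟶ N.obj, Epi p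

/-- The category `C^d`, with the morphisms `N ⟶ N'` of `QCat`: the isomorphism classes of diagrams
`N' ↞ M ↪ N`. -/
abbrev Cat (d : ℕ) : Type (u + 1) := (isObject X d).FullSubcategory

/-- `T^d`: all morphisms of `C^d`. -/
def allMorphisms (d : ℕ) : MorphismProperty (Cat X d) := ⊤

/-- `T^d_m`: the fibrations of `C^d`. -/
def fibrations (d : ℕ) : MorphismProperty (Cat X d) :=
  (QCat.fibrations X.Modules).inverseImage (isObject X d).ι

/-- `T^d_r`: the cofibrations of `C^d`. -/
def cofibrations (d : ℕ) : MorphismProperty (Cat X d) :=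
  (QCat.cofibrations X.Modules).inverseImage (isObject X d).ι

/-- The factor of `K_X` at a point `x`: the push-forward of the structure sheaf along
`Spec 𝒪_{X,x} ⟶ X`. For a generic point `x` of a reduced scheme `X`, `𝒪_{X,x}` is a field and
`Spec 𝒪_{X,x}` is the point `x`. -/
noncomputable def stalkModule (x : X) : X.Modules :=
  (Scheme.Modules.pushforward (X.fromSpecStalk x)).obj
    (structureModule (Spec (X.presheaf.stalk x)))

/-- The canonical map `𝒪_X ⟶ j_* 𝒪_{Spec 𝒪_{X,x}}`. -/
noncomputable def toStalkModule (x : X) : structureModule X ⟶ stalkModule X x :=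
  SheafOfModules.unitToPushforwardObjUnit (X.fromSpecStalk x).toRingCatSheafHom

/-- The `𝒪_X`-module `K_X = j_* j^* 𝒪_X`, where `j` is the morphism to `X` from the disjoint union
of the generic points of `X`: the product of the push-forwards over the generic points. -/
noncomputable def ratModule : X.Modules := ∏ᶜ fun x : genericPoints X => stalkModule X x

/-- The canonical map `𝒪_X ⟶ K_X`. -/
noncomputable def toRatModule : structureModule X ⟶ ratModule X :=
  Pi.lift fun x : genericPoints X => toStalkModule X x

/-- `V = K_X^{⊕ d}`. -/
noncomputable abbrev ratSpace (d : ℕ) : X.Modules := ⨁ fun _ : Fin d => ratModule X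

/-- The subobject `𝒪_X^{⊕ d}` of `K_X^{⊕ d}`. -/
noncomputable def stdLattice (d : ℕ) : Subobject (ratSpace X d) :=
  imageSubobject (biproduct.map (fun _ : Fin d => toRatModule X) :
    freeModule X d ⟶ ratSpace X d)

/-- A lattice in `V`: a coherent submodule `L` such that `j^* (V / L) = 0`. -/
structure IsLattice {d : ℕ} (L : Subobject (ratSpace X d)) : Prop where
  isCoherent : IsCoherent (L : X.Modules)
  isZero (x : genericPoints X) :
    IsZero ((Scheme.Modules.pullback (X.fromSpecStalk (x : X))).obj (cokernel L.arrow))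

/-- The category `C₀^d`: the opposite of the poset of pairs of lattices `L₁ ⊆ L₂`. -/
abbrev PairCat (d : ℕ) : Type (u + 1) := (SubobjectPair (IsLattice X (d := d)))ᵒᵖ

/-- The functor `(L₁, L₂) ↦ L₂/L₁` on `C₀^d`. -/
noncomputable def quotFunctor (d : ℕ) : PairCat X d ⥤ QCat X.Modules :=
  subquotFunctor (IsLattice X (d := d))

/-- `C₀,ₘ^d`: the full subcategory of the pairs with `L₂ ⊆ 𝒪_X^{⊕ d}`. -/
def isPairM (d : ℕ) : ObjectProperty (PairCat X d) := fun p => p.unop.snd ≤ stdLattice X d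

/-- `C₀,ᵣ^d`: the full subcategory of the pairs with `𝒪_X^{⊕ d} ⊆ L₁`. -/
def isPairR (d : ℕ) : ObjectProperty (PairCat X d) := fun p => stdLattice X d ≤ p.unop.fst

end FiniteLengthModules

/-!
The theorem is deduced from properties of lattices which are collected in `IsLatticeSystem`, and
which are local: since `X` is a regular curve, the local ring `R` at a point is a principal ideal
domain, the stalk of `V` is the vector space of rank `d` over the fraction field of `R` (of the
irreducible component through the point), and a lattice in `V` is the same as a family of lattices
in the stalks, almost all of which are the standard one (`isLattice_iff`,
`IsLatticeFamily.exists_isLattice`). An object `N` of `C^d` has finite support and its stalks are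
torsion modules with `d` generators (`isObject.isTorsionModule`); in particular, morphisms to `N` can
be defined separately at every point (`HasDiscreteSupport.exists_hom`).

The essential algebraic fact is that two surjections of `R ^ d` onto the same module differ by an
automorphism of `R ^ d` (`IsLocalRing.exists_linearEquiv_comp_eq`). It has three consequences. A
surjection of `N` onto a quotient `M / L` of lattices can be identified with `M / K ⟶ M / L` for a
lattice `K ⊆ L` (`IsLattice.exists_fibration`). An embedding of `M / L` in `N` can be identified with
`M / L ⟶ K / L` for a lattice `K ⊇ M` (`IsLattice.exists_cofibration`). Finally, if `L = cM` locally,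
then the isomorphism class of `M / L` determines `L` in terms of `M` and vice versa: if
`M' / L' ≅ M / L`, then `L' = cM'` (`IsScaled.fst_unique`, `IsScaled.snd_unique`).

The rest is formal. A morphism from `N` to the quotient of a pair of lattices is a fibration preceded
by a cofibration, so by the first two consequences it is, up to an isomorphism of `N`, the morphism
defined by a larger pair (`IsLatticeSystem.exists_pairMap_eq`). A morphism from the quotient of a pair
to `N` is defined by a unique smaller pair, for any abelian category (`exists_pairMap_comp_eq`,
`pair_unique`). Therefore the poset of pairs, whose suprema provide the required squares, is a grid.
All morphisms are epimorphisms (`QCat.epi`), so that a covering `Z ⟶ X` is Galois if any two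
morphisms from `W` to `Z` over `X` differ by an automorphism of `Z` over `X`. If `Z` is the quotient
of a pair `z` which is locally of the form `(cM, M)`, then such morphisms present `W` as the quotient
of a pair above `z` and `Z` as the quotient of a second pair below it; by the third consequence the
second pair is `z` (`IsLatticeSystem.exists_aut_of_comp_eq`). Pairs of this form are cofinal.
-/

/-! ### Stalks of modules on a scheme -/

namespace AlgebraicGeometry.Scheme.Modules

open TopologicalSpace Opposite

variable {X : Scheme.{u}}

/-- The stalk of an `𝒪_X`-module. -/
noncomputable def Stalk (M : X.Modules) (x : X) : Type u := M.presheaf.stalk x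

noncomputable instance (M : X.Modules) (x : X) : AddCommGroup (M.Stalk x) :=
  inferInstanceAs (AddCommGroup (M.presheaf.stalk x))

noncomputable instance (M : X.Modules) (x : X) : Module (X.presheaf.stalk x) (M.Stalk x) :=
  PresheafOfModules.instModuleCarrierStalkCommRingCatCarrierAbPresheafOpensCarrier
    (R := X.presheaf) M.1 x

/-- The germ of a section of an `𝒪_X`-module. -/
noncomputable def germ (M : X.Modules) (U : X.Opens) (x : X) (hx : x ∈ U) :
    Γ(M, U) →+ M.Stalk x :=
  (M.presheaf.germ U x hx).hom

variable {M N K : X.Modules} {U V : X.Opens} {x : X}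

lemma germ_smul (hx : x ∈ U) (r : Γ(X, U)) (s : Γ(M, U)) :
    M.germ U x hx (r • s) = X.presheaf.germ U x hx r • M.germ U x hx s :=
  PresheafOfModules.germ_smul (R := X.presheaf) M.1 x U hx r s

lemma germ_res (i : U ⟶ V) (hx : x ∈ U) (s : Γ(M, V)) :
    M.germ U x hx (M.presheaf.map i.op s) = M.germ V x (i.le hx) s :=
  M.presheaf.germ_res_apply i x hx s

lemma exists_germ (t : M.Stalk x) : ∃ (U : X.Opens) (hx : x ∈ U) (s : Γ(M, U)),
    M.germ U x hx s = t := M.presheaf.exists_germ_eq t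

/-- Germs are represented by sections over arbitrarily small neighbourhoods. -/
lemma exists_le_germ (t : M.Stalk x) (hxU : x ∈ U) : ∃ (V : X.Opens) (_ : V ≤ U) (hV : x ∈ V)
    (s : Γ(M, V)), M.germ V x hV s = t := by
  obtain ⟨W, hW, s, rfl⟩ := exists_germ t
  exact ⟨U ⊓ W, inf_le_left, ⟨hxU, hW⟩, M.presheaf.map (homOfLE inf_le_right).op s,
    germ_res _ _ _⟩

lemma germ_eq (hU : x ∈ U) (hV : x ∈ V) (s : Γ(M, U)) (t : Γ(M, V))
    (h : M.germ U x hU s = M.germ V x hV t) :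
    ∃ (W : X.Opens) (_ : x ∈ W) (i : W ⟶ U) (j : W ⟶ V),
      M.presheaf.map i.op s = M.presheaf.map j.op t := by
  exact M.presheaf.germ_eq x hU hV s t h

/-- Equality of germs spreads to a neighbourhood. -/
lemma germ_eq_nhds (hU : x ∈ U) (hV : x ∈ V) (s : Γ(M, U)) (t : Γ(M, V))
    (h : M.germ U x hU s = M.germ V x hV t) :
    ∃ (W : X.Opens) (_ : x ∈ W) (hWU : W ≤ U) (hWV : W ≤ V),
      ∀ y (hy : y ∈ W), M.germ U y (hWU hy) s = M.germ V y (hWV hy) t := by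
  obtain ⟨W, hW, i, j, e⟩ := germ_eq hU hV s t h
  exact ⟨W, hW, i.le, j.le, fun y hy ↦ by rw [← germ_res i hy, e, germ_res j hy]⟩

lemma section_ext (s t : Γ(M, U)) (h : ∀ x (hx : x ∈ U), M.germ U x hx s = M.germ U x hx t) :
    s = t :=
  TopCat.Presheaf.section_ext ⟨M.presheaf, M.isSheaf⟩ U s t h

/-- A family of germs which is locally given by sections is given by a section. -/
lemma exists_section (t : ∀ x ∈ U, M.Stalk x)
    (h : ∀ x (_ : x ∈ U), ∃ (W : X.Opens) (_ : x ∈ W) (hW : W ≤ U) (s : Γ(M, W)),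
      ∀ y (hy : y ∈ W), M.germ W y hy s = t y (hW hy)) :
    ∃ s : Γ(M, U), ∀ x (hx : x ∈ U), M.germ U x hx s = t x hx := by
  choose W hxW hW s hs using h
  obtain ⟨gl, hgl, -⟩ := TopCat.Sheaf.existsUnique_gluing' ⟨M.presheaf, M.isSheaf⟩
    (fun p : U => W p.1 p.2) U (fun p => homOfLE (hW p.1 p.2))
    (fun y hy => Opens.mem_iSup.2 ⟨⟨y, hy⟩, hxW y hy⟩) (fun p => s p.1 p.2) (by
      intro p q
      refine section_ext (M := M) _ _ fun y hy ↦ ?_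
      exact (germ_res (M := M) _ hy _).trans (((hs _ _ _ _).trans (hs _ _ _ _).symm).trans
        (germ_res (M := M) _ hy _).symm))
  refine ⟨gl, fun x hx ↦ ?_⟩
  rw [← hs x hx x (hxW x hx)]
  have := hgl ⟨x, hx⟩
  rw [← this]
  exact (germ_res (M := M) _ _ _).symm

/-- The map induced on stalks by a morphism of `𝒪_X`-modules. -/
noncomputable def stalkMap (φ : M ⟶ N) (x : X) : M.Stalk x →ₗ[X.presheaf.stalk x] N.Stalk x where
  toFun := ((TopCat.Presheaf.stalkFunctor Ab x).map φ.mapPresheaf).hom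
  map_add' := map_add _
  map_smul' r t := by
    obtain ⟨U, hU, s, rfl⟩ := exists_germ t
    obtain ⟨V, hV, r, rfl⟩ := X.presheaf.exists_germ_eq r
    have hx : x ∈ U ⊓ V := ⟨hU, hV⟩
    have e : ∀ (W : X.Opens) (hW : x ∈ W) (s : Γ(M, W)),
        ((TopCat.Presheaf.stalkFunctor Ab x).map φ.mapPresheaf).hom (M.germ W x hW s) =
        N.germ W x hW (φ.app W s) :=
      fun W hW s ↦ TopCat.Presheaf.stalkFunctor_map_germ_apply W x hW φ.mapPresheaf s
    rw [← germ_res (homOfLE inf_le_left : U ⊓ V ⟶ U) hx,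
      ← X.presheaf.germ_res_apply (homOfLE inf_le_right : U ⊓ V ⟶ V) x hx, ← germ_smul, e,
      Hom.app_smul, germ_smul, e]
    rfl

@[simp]
lemma stalkMap_germ (φ : M ⟶ N) (hx : x ∈ U) (s : Γ(M, U)) :
    stalkMap φ x (M.germ U x hx s) = N.germ U x hx (φ.app U s) :=
  TopCat.Presheaf.stalkFunctor_map_germ_apply U x hx φ.mapPresheaf s

@[simp]
lemma stalkMap_id (x : X) : stalkMap (𝟙 M) x = LinearMap.id := by
  ext t
  obtain ⟨U, hU, s, rfl⟩ := exists_germ t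
  simp

@[simp]
lemma stalkMap_comp (φ : M ⟶ N) (ψ : N ⟶ K) (x : X) :
    stalkMap (φ ≫ ψ) x = stalkMap ψ x ∘ₗ stalkMap φ x := by
  ext t
  obtain ⟨U, hU, s, rfl⟩ := exists_germ t
  simp

lemma stalkMap_comp_apply (φ : M ⟶ N) (ψ : N ⟶ K) (x : X) (t : M.Stalk x) :
    stalkMap (φ ≫ ψ) x t = stalkMap ψ x (stalkMap φ x t) := by simp

@[simp]
lemma stalkMap_zero (x : X) : stalkMap (0 : M ⟶ N) x = 0 := by
  ext t
  obtain ⟨U, hU, s, rfl⟩ := exists_germ t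
  simp

@[simp]
lemma stalkMap_add (φ ψ : M ⟶ N) (x : X) : stalkMap (φ + ψ) x = stalkMap φ x + stalkMap ψ x := by
  ext t
  obtain ⟨U, hU, s, rfl⟩ := exists_germ t
  simp

/-- Sections are determined by their germs, hence morphisms by the maps on stalks. -/
lemma hom_ext_stalk {φ ψ : M ⟶ N} (h : ∀ x, stalkMap φ x = stalkMap ψ x) : φ = ψ := by
  ext U s
  refine section_ext _ _ fun x hx ↦ ?_
  have := congr($(h x) (M.germ U x hx s))
  rwa [stalkMap_germ, stalkMap_germ] at this

end AlgebraicGeometry.Scheme.Modules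

/-! ### Subobjects and exactness in terms of stalks -/

namespace AlgebraicGeometry.Scheme.Modules

open TopologicalSpace Opposite

variable {X : Scheme.{u}} {M N K : X.Modules} {U V : X.Opens} {x : X}

/-- A morphism of `𝒪_X`-modules from a compatible family of linear maps on sections. -/
noncomputable def homOfSections (f : ∀ U : X.Opens, Γ(M, U) →ₗ[Γ(X, U)] Γ(N, U))
    (h : ∀ (U V : X.Opens) (i : U ⟶ V) (s : Γ(M, V)),
      f U (M.presheaf.map i.op s) = N.presheaf.map i.op (f V s)) : M ⟶ N :=
  ⟨PresheafOfModules.homMk (M₁ := M.1) (M₂ := N.1)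
    { app := fun U ↦ AddCommGrpCat.ofHom (f U.unop).toAddMonoidHom
      naturality := fun U V i ↦ by
        ext s
        exact h V.unop U.unop i.unop s }
    (fun U r s ↦ (f U.unop).map_smul r s)⟩

@[simp]
lemma homOfSections_app (f : ∀ U : X.Opens, Γ(M, U) →ₗ[Γ(X, U)] Γ(N, U))
    (h : ∀ (U V : X.Opens) (i : U ⟶ V) (s : Γ(M, V)),
      f U (M.presheaf.map i.op s) = N.presheaf.map i.op (f V s)) (U : X.Opens) (s : Γ(M, U)) :
    (homOfSections f h).app U s = f U s := rfl

/-- The sections all of whose germs lie in prescribed submodules of the stalks. -/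
def sectionsIn (P : ∀ x, Submodule (X.presheaf.stalk x) (M.Stalk x)) (U : X.Opens) :
    Submodule Γ(X, U) Γ(M, U) where
  carrier := {s | ∀ x (hx : x ∈ U), M.germ U x hx s ∈ P x}
  add_mem' hs ht x hx := by
    rw [map_add]
    exact add_mem (hs x hx) (ht x hx)
  zero_mem' x hx := by
    rw [map_zero]
    exact zero_mem _
  smul_mem' r s hs x hx := by
    rw [germ_smul]
    exact Submodule.smul_mem _ _ (hs x hx)

/-- The sections with germs in prescribed submodules of the stalks form a subpresheaf. -/
def subpresheafOfStalks (P : ∀ x, Submodule (X.presheaf.stalk x) (M.Stalk x)) :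
    PresheafOfModules.Submodule M.1 where
  obj U := sectionsIn P U.unop
  map {U V} i s hs x hx := by
    have e := germ_res (M := M) i.unop hx s
    exact (congrArg (· ∈ P x) e).mpr (hs x _)

/-- The subsheaf of the sections whose germs lie in prescribed submodules of the stalks. -/
noncomputable def ofStalks (P : ∀ x, Submodule (X.presheaf.stalk x) (M.Stalk x)) : X.Modules where
  val := (subpresheafOfStalks P).toPresheafOfModules
  isSheaf := by
    change TopCat.Presheaf.IsSheaf (C := Ab) (X := X.toTopCat) _
    rw [TopCat.Presheaf.isSheaf_iff_isSheaf_comp (CategoryTheory.forget Ab)]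
    refine TopCat.Presheaf.isSheaf_of_isSheafUniqueGluing_types _ ?_
    intro ι W sf hsf
    obtain ⟨s, hs, hu⟩ := TopCat.Sheaf.existsUnique_gluing ⟨M.presheaf, M.isSheaf⟩ W
      (fun i ↦ (sf i).1) (fun i j ↦ congrArg Subtype.val (hsf i j))
    refine ⟨⟨s, fun x hx ↦ ?_⟩, fun i ↦ Subtype.ext (hs i), fun t ht ↦
      Subtype.ext (hu t.1 fun i ↦ congrArg Subtype.val (ht i))⟩
    obtain ⟨i, hi⟩ := Opens.mem_iSup.1 hx
    have h₁ := (sf i).2 x hi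
    have h₂ : M.germ (W i) x hi (sf i).1 = M.germ (iSup W) x hx s :=
      (congrArg (M.germ (W i) x hi) (hs i).symm).trans (germ_res _ _ _)
    exact (congrArg (· ∈ P x) h₂).mp h₁

/-- The inclusion of the subsheaf defined by submodules of the stalks. -/
noncomputable def ofStalksι (P : ∀ x, Submodule (X.presheaf.stalk x) (M.Stalk x)) :
    ofStalks P ⟶ M :=
  ⟨(subpresheafOfStalks P).ι⟩

lemma ofStalksι_app_injective (P : ∀ x, Submodule (X.presheaf.stalk x) (M.Stalk x)) :
    Function.Injective ((ofStalksι P).app U) :=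
  fun _ _ h ↦ Subtype.ext h

lemma exists_ofStalks_section (P : ∀ x, Submodule (X.presheaf.stalk x) (M.Stalk x))
    (s : Γ(M, U)) (hs : ∀ x (hx : x ∈ U), M.germ U x hx s ∈ P x) :
    ∃ t : Γ(ofStalks P, U), (ofStalksι P).app U t = s := ⟨⟨s, hs⟩, rfl⟩

lemma germ_ofStalksι_mem (P : ∀ x, Submodule (X.presheaf.stalk x) (M.Stalk x))
    (t : Γ(ofStalks P, U)) (hx : x ∈ U) : M.germ U x hx ((ofStalksι P).app U t) ∈ P x :=
  t.2 x hx

lemma mono_of_app_injective {φ : M ⟶ N} (h : ∀ U, Function.Injective (φ.app U)) : Mono φ where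
  right_cancellation a b e := by
    ext U s
    apply h U
    exact congr($(congr(Hom.app $e U)) s)

instance (P : ∀ x, Submodule (X.presheaf.stalk x) (M.Stalk x)) : Mono (ofStalksι P) :=
  mono_of_app_injective fun _ ↦ ofStalksι_app_injective P

lemma app_injective_of_mono (φ : M ⟶ N) [Mono φ] : Function.Injective (φ.app U) := by
  have : Mono ((toPresheaf X).map φ) := inferInstance
  have h := (NatTrans.mono_iff_mono_app ((toPresheaf X).map φ)).1 this (op U)
  exact (AddCommGrpCat.mono_iff_injective _).1 h

lemma stalkMap_injective_of_mono (φ : M ⟶ N) [Mono φ] (x : X) :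
    Function.Injective (stalkMap φ x) :=
  TopCat.Presheaf.stalkFunctor_map_injective_of_app_injective
    (f := φ.mapPresheaf) (fun _ ↦ app_injective_of_mono φ) x

lemma mono_of_stalkMap_injective {φ : M ⟶ N} (h : ∀ x, Function.Injective (stalkMap φ x)) :
    Mono φ := by
  refine mono_of_app_injective fun U s t e ↦ section_ext _ _ fun x hx ↦ h x ?_
  rw [stalkMap_germ, stalkMap_germ, e]

/-- A morphism with image in prescribed submodules of the stalks factors through the subsheaf they
define. -/
lemma exists_lift_ofStalks (P : ∀ x, Submodule (X.presheaf.stalk x) (M.Stalk x)) (φ : N ⟶ M)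
    (h : ∀ x, LinearMap.range (stalkMap φ x) ≤ P x) :
    ∃ ψ : N ⟶ ofStalks P, ψ ≫ ofStalksι P = φ := by
  have hm : ∀ (U : X.Opens) (s : Γ(N, U)), φ.app U s ∈ sectionsIn P U := fun U s x hx ↦ by
    rw [← stalkMap_germ]
    exact h x ⟨_, rfl⟩
  refine ⟨homOfSections (N := ofStalks P) (fun U ↦
    { toFun := fun s ↦ ⟨φ.app U s, hm U s⟩
      map_add' := fun s t ↦ Subtype.ext (map_add _ _ _)
      map_smul' := fun r s ↦ Subtype.ext (Hom.app_smul φ r s) }) ?_, ?_⟩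
  · intro U V i s
    exact Subtype.ext (congr($(φ.mapPresheaf.naturality i.op) s))
  · ext U s
    rfl

lemma stalkMap_ofStalksι_mem (P : ∀ x, Submodule (X.presheaf.stalk x) (M.Stalk x))
    (t : (ofStalks P).Stalk x) : stalkMap (ofStalksι P) x t ∈ P x := by
  obtain ⟨U, hU, s, rfl⟩ := exists_germ t
  rw [stalkMap_germ]
  exact germ_ofStalksι_mem P s hU

/-- A family of submodules of the stalks is open if each of its elements is the germ of a section
all of whose germs are in the family. -/
def IsOpenFamily (P : ∀ x, Submodule (X.presheaf.stalk x) (M.Stalk x)) : Prop :=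
  ∀ x, ∀ t ∈ P x, ∃ (U : X.Opens) (hx : x ∈ U) (s : Γ(M, U)), M.germ U x hx s = t ∧
    ∀ y (hy : y ∈ U), M.germ U y hy s ∈ P y

lemma range_stalkMap_ofStalksι {P : ∀ x, Submodule (X.presheaf.stalk x) (M.Stalk x)}
    (hP : IsOpenFamily P) (x : X) : LinearMap.range (stalkMap (ofStalksι P) x) = P x := by
  refine le_antisymm ?_ fun t ht ↦ ?_
  · rintro _ ⟨t, rfl⟩
    exact stalkMap_ofStalksι_mem P t
  · obtain ⟨U, hU, s, rfl, hs⟩ := hP x t ht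
    obtain ⟨t, rfl⟩ := exists_ofStalks_section P s hs
    exact ⟨(ofStalks P).germ U x hU t, stalkMap_germ _ _ _⟩

lemma isOpenFamily_range (φ : N ⟶ M) : IsOpenFamily fun x ↦ LinearMap.range (stalkMap φ x) := by
  rintro x _ ⟨t, rfl⟩
  obtain ⟨U, hU, s, rfl⟩ := exists_germ t
  exact ⟨U, hU, φ.app U s, (stalkMap_germ _ _ _).symm, fun y hy ↦ ⟨_, stalkMap_germ _ hy s⟩⟩

lemma stalkMap_surjective_of_epi (φ : N ⟶ M) [Epi φ] (x : X) :
    Function.Surjective (stalkMap φ x) := by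
  obtain ⟨ψ, hψ⟩ := exists_lift_ofStalks (fun x ↦ LinearMap.range (stalkMap φ x)) φ fun _ ↦ le_rfl
  have : Epi (ψ ≫ ofStalksι fun x ↦ LinearMap.range (stalkMap φ x)) := by rwa [hψ]
  have : Epi (ofStalksι fun x ↦ LinearMap.range (stalkMap φ x)) := epi_of_epi ψ _
  have hiso : IsIso (ofStalksι fun x ↦ LinearMap.range (stalkMap φ x)) :=
    isIso_of_mono_of_epi _
  rw [← LinearMap.range_eq_top, ← range_stalkMap_ofStalksι (isOpenFamily_range φ) x,
    LinearMap.range_eq_top]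
  intro t
  refine ⟨stalkMap (inv (ofStalksι fun x ↦ LinearMap.range (stalkMap φ x))) x t, ?_⟩
  rw [← stalkMap_comp_apply]
  simp

lemma epi_of_stalkMap_surjective {φ : M ⟶ N} (h : ∀ x, Function.Surjective (stalkMap φ x)) :
    Epi φ where
  left_cancellation a b e := by
    refine hom_ext_stalk fun x ↦ LinearMap.ext fun t ↦ ?_
    obtain ⟨t, rfl⟩ := h x t
    rw [← stalkMap_comp_apply, ← stalkMap_comp_apply, e]

lemma isIso_of_stalkMap_bijective {φ : M ⟶ N} (h : ∀ x, Function.Bijective (stalkMap φ x)) :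
    IsIso φ := by
  have := mono_of_stalkMap_injective fun x ↦ (h x).1
  have := epi_of_stalkMap_surjective fun x ↦ (h x).2
  exact isIso_of_mono_of_epi φ

/-- The isomorphism of stalks induced by an isomorphism. -/
noncomputable def stalkEquiv (e : M ≅ N) (x : X) : M.Stalk x ≃ₗ[X.presheaf.stalk x] N.Stalk x :=
  LinearEquiv.ofLinearMap (stalkMap e.hom x) (stalkMap e.inv x)
    (by rw [← stalkMap_comp, e.inv_hom_id, stalkMap_id])
    (by rw [← stalkMap_comp, e.hom_inv_id, stalkMap_id])

/-- The kernels of the maps on stalks form an open family, and the subsheaf that it defines factors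
through `ker φ`. -/
lemma range_stalkMap_kernel_ι (φ : M ⟶ N) (x : X) :
    LinearMap.range (stalkMap (kernel.ι φ) x) = LinearMap.ker (stalkMap φ x) := by
  refine le_antisymm ?_ fun t ht ↦ ?_
  · rintro _ ⟨t, rfl⟩
    rw [LinearMap.mem_ker, ← stalkMap_comp_apply, kernel.condition, stalkMap_zero]
    rfl
  · have hP : IsOpenFamily fun x ↦ LinearMap.ker (stalkMap φ x) := by
      intro x t ht
      obtain ⟨U, hU, s, rfl⟩ := exists_germ t
      rw [LinearMap.mem_ker, stalkMap_germ, ← map_zero (N.germ U x hU)] at ht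
      obtain ⟨W, hW, hWU, hWU', e⟩ := germ_eq_nhds _ _ _ _ ht
      refine ⟨W, hW, M.presheaf.map (homOfLE hWU).op s, germ_res _ _ _, fun y hy ↦ ?_⟩
      rw [germ_res, LinearMap.mem_ker, stalkMap_germ, e y hy, map_zero]
    rw [← range_stalkMap_ofStalksι hP x] at ht
    obtain ⟨t, rfl⟩ := ht
    have h0 : ofStalksι (fun x ↦ LinearMap.ker (stalkMap φ x)) ≫ φ = 0 := by
      refine hom_ext_stalk fun x ↦ LinearMap.ext fun t ↦ ?_
      rw [stalkMap_comp_apply, stalkMap_zero]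
      exact stalkMap_ofStalksι_mem (fun x ↦ LinearMap.ker (stalkMap φ x)) t
    refine ⟨stalkMap (kernel.lift φ _ h0) x t, ?_⟩
    rw [← stalkMap_comp_apply, kernel.lift_ι]

/-- The stalk of the image of `φ` is the kernel of the projection to the cokernel. -/
lemma ker_stalkMap_cokernel_π (φ : M ⟶ N) (x : X) :
    LinearMap.ker (stalkMap (cokernel.π φ) x) = LinearMap.range (stalkMap φ x) := by
  rw [← range_stalkMap_kernel_ι]
  refine le_antisymm ?_ ?_
  · have : Epi (Abelian.factorThruImage φ) := inferInstance
    rintro _ ⟨t, rfl⟩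
    obtain ⟨t, rfl⟩ := stalkMap_surjective_of_epi (Abelian.factorThruImage φ) x t
    refine ⟨t, ?_⟩
    rw [← stalkMap_comp_apply]
    exact congr(stalkMap $((Abelian.image.fac φ).symm) x t)
  · rintro _ ⟨t, rfl⟩
    refine ⟨stalkMap (Abelian.factorThruImage φ) x t, ?_⟩
    rw [← stalkMap_comp_apply]
    exact congr(stalkMap $(Abelian.image.fac φ) x t)

/-- The submodule of the stalk of `M` defined by a subobject of `M`. -/
noncomputable def stalkSub (L : Subobject M) (x : X) : Submodule (X.presheaf.stalk x) (M.Stalk x) :=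
  LinearMap.range (stalkMap L.arrow x)

lemma stalkSub_mk (φ : N ⟶ M) [Mono φ] (x : X) :
    stalkSub (Subobject.mk φ) x = LinearMap.range (stalkMap φ x) := by
  refine le_antisymm ?_ ?_
  · rintro _ ⟨t, rfl⟩
    refine ⟨stalkMap (Subobject.underlyingIso φ).hom x t, ?_⟩
    rw [← stalkMap_comp_apply, Subobject.underlyingIso_hom_comp_eq_mk]
  · rintro _ ⟨t, rfl⟩
    refine ⟨stalkMap (Subobject.underlyingIso φ).inv x t, ?_⟩
    rw [← stalkMap_comp_apply, Subobject.underlyingIso_arrow]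

lemma isOpenFamily_stalkSub (L : Subobject M) : IsOpenFamily (stalkSub L) :=
  isOpenFamily_range L.arrow

/-- Subobjects are determined by their stalks. -/
lemma le_iff_stalkSub_le {L L' : Subobject M} : L ≤ L' ↔ ∀ x, stalkSub L x ≤ stalkSub L' x := by
  constructor
  · rintro h x _ ⟨t, rfl⟩
    refine ⟨stalkMap (Subobject.ofLE L L' h) x t, ?_⟩
    rw [← stalkMap_comp_apply, Subobject.ofLE_arrow]
  · intro h
    obtain ⟨ψ, hψ⟩ := exists_lift_ofStalks (stalkSub L') L.arrow h
    obtain ⟨ψ', hψ'⟩ := exists_lift_ofStalks (stalkSub L') L'.arrow fun x ↦ le_rfl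
    have : Mono (ψ' ≫ ofStalksι (stalkSub L')) := by rw [hψ']; infer_instance
    have hm : Mono ψ' := mono_of_mono ψ' (ofStalksι (stalkSub L'))
    have he : Epi ψ' := epi_of_stalkMap_surjective fun x t ↦ by
      obtain ⟨t', ht'⟩ := stalkMap_ofStalksι_mem (stalkSub L') t
      refine ⟨t', stalkMap_injective_of_mono (ofStalksι (stalkSub L')) x ?_⟩
      rw [← stalkMap_comp_apply, hψ', ht']
    have : IsIso ψ' := isIso_of_mono_of_epi ψ'
    refine Subobject.le_of_comm (ψ ≫ inv ψ') ?_
    rw [Category.assoc, (IsIso.inv_comp_eq ψ').2 hψ'.symm, hψ]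

lemma subobject_ext {L L' : Subobject M} (h : ∀ x, stalkSub L x = stalkSub L' x) : L = L' :=
  le_antisymm (le_iff_stalkSub_le.2 fun x ↦ (h x).le) (le_iff_stalkSub_le.2 fun x ↦ (h x).ge)

/-- An open family of submodules of the stalks comes from a subobject. -/
lemma exists_subobject {P : ∀ x, Submodule (X.presheaf.stalk x) (M.Stalk x)} (hP : IsOpenFamily P) :
    ∃ L : Subobject M, ∀ x, stalkSub L x = P x :=
  ⟨Subobject.mk (ofStalksι P), fun x ↦ by rw [stalkSub_mk, range_stalkMap_ofStalksι hP]⟩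

/-- A subobject is a family of submodules of the stalks. -/
instance small_subobject (M : X.Modules) : Small.{u} (Subobject M) :=
  small_of_injective (f := fun L : Subobject M ↦ stalkSub L)
    fun _ _ h ↦ subobject_ext fun x ↦ congrFun h x

end AlgebraicGeometry.Scheme.Modules

/-! ### Modules concentrated on a discrete set, specialization, and stalks of free modules -/

namespace AlgebraicGeometry.Scheme.Modules

open TopologicalSpace Opposite

variable {X : Scheme.{u}} {M N K : X.Modules} {U V : X.Opens} {x : X}

/-- The sections of `N` over any open `U` are the families of germs at the points of `U ∩ T`. -/
structure IsProductOfStalks (N : X.Modules) (T : Set X) : Prop where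
  exists_section (U : X.Opens) (t : ∀ x, N.Stalk x) :
    ∃ s : Γ(N, U), ∀ x (hx : x ∈ U), x ∈ T → N.germ U x hx s = t x
  ext (U : X.Opens) (s s' : Γ(N, U)) :
    (∀ x (hx : x ∈ U), x ∈ T → N.germ U x hx s = N.germ U x hx s') → s = s'

/-- If `N` is the product of its stalks at the points of `T`, then the linear maps between stalks
at these points glue to a morphism. -/
lemma IsProductOfStalks.exists_hom {T : Set X} (hN : N.IsProductOfStalks T)
    (f : ∀ x, M.Stalk x →ₗ[X.presheaf.stalk x] N.Stalk x) :
    ∃ φ : M ⟶ N, ∀ x ∈ T, stalkMap φ x = f x := by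
  classical
  have h (U : X.Opens) (s : Γ(M, U)) : ∃ t : Γ(N, U), ∀ x (hx : x ∈ U), x ∈ T →
      N.germ U x hx t = f x (M.germ U x hx s) := by
    obtain ⟨t, ht⟩ := hN.exists_section U fun x ↦
      if hx : x ∈ U then f x (M.germ U x hx s) else 0
    exact ⟨t, fun x hx hxT ↦ by rw [ht x hx hxT, dif_pos hx]⟩
  -- the sections `g U s` are unique, so that `g` is linear and compatible with restrictions
  choose g hg using h
  refine ⟨homOfSections (fun U ↦
    { toFun := g U
      map_add' := fun s t ↦ hN.ext _ _ _ fun x hx hxT ↦ by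
        rw [hg _ _ x hx hxT, map_add, map_add, map_add, hg _ _ x hx hxT, hg _ _ x hx hxT]
      map_smul' := fun r s ↦ hN.ext _ _ _ fun x hx hxT ↦ by
        rw [hg _ _ x hx hxT, germ_smul, LinearMap.map_smul, RingHom.id_apply, germ_smul,
          hg _ _ x hx hxT] }) ?_, ?_⟩
  · intro U V i s
    refine hN.ext _ _ _ fun x hx hxT ↦ ?_
    rw [germ_res]
    change N.germ U x hx (g U _) = N.germ V x _ (g V s)
    rw [hg _ _ x hx hxT, germ_res, hg _ _ x (i.le hx) hxT]
  · intro x hxT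
    ext t
    obtain ⟨U, hU, s, rfl⟩ := exists_germ t
    rw [stalkMap_germ, homOfSections_app]
    exact hg U s x hU hxT

/-- Every point has a neighbourhood in which it is the only one with a non-zero stalk. -/
def HasDiscreteSupport (N : X.Modules) : Prop :=
  ∀ x, ∃ U : X.Opens, x ∈ U ∧ ∀ y ∈ U, y ≠ x → Subsingleton (N.Stalk y)

lemma HasDiscreteSupport.isProductOfStalks (hN : N.HasDiscreteSupport) :
    N.IsProductOfStalks Set.univ where
  exists_section U t := by
    obtain ⟨s, hs⟩ := exists_section (U := U) (fun x _ ↦ t x) fun x hx ↦ by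
      obtain ⟨W, hW, h⟩ := hN x
      obtain ⟨W', hW', hxW', s, hs⟩ := exists_le_germ (t x) (show x ∈ U ⊓ W from ⟨hx, hW⟩)
      refine ⟨W', hxW', fun y hy ↦ (hW' hy).1, s, fun y hy ↦ ?_⟩
      obtain rfl | hyx := eq_or_ne y x
      · exact hs
      · have := h y (hW' hy).2 hyx
        exact Subsingleton.elim _ _
    exact ⟨s, fun x hx _ ↦ hs x hx⟩
  ext U s s' h := section_ext _ _ fun x hx ↦ h x hx trivial

/-- For modules with discrete support, morphisms can be constructed stalk by stalk, without any
compatibility between the stalks. -/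
lemma HasDiscreteSupport.exists_hom (hN : N.HasDiscreteSupport)
    (f : ∀ x, M.Stalk x →ₗ[X.presheaf.stalk x] N.Stalk x) :
    ∃ φ : M ⟶ N, ∀ x, stalkMap φ x = f x := by
  obtain ⟨φ, h⟩ := hN.isProductOfStalks.exists_hom f
  exact ⟨φ, fun x ↦ h x trivial⟩

section Specialization

variable {y : X}

/-- The map from the stalk at a point to the stalk at a generization. -/
noncomputable def specMap (M : X.Modules) (h : y ⤳ x) : M.Stalk x →+ M.Stalk y :=
  (M.presheaf.stalkSpecializes h).hom

@[simp]
lemma specMap_germ (h : y ⤳ x) (hx : x ∈ U) (s : Γ(M, U)) :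
    specMap M h (M.germ U x hx s) = M.germ U y (h.mem_open U.isOpen hx) s :=
  congr($(M.presheaf.germ_stalkSpecializes hx h) s)

lemma specMap_smul (h : y ⤳ x) (a : X.presheaf.stalk x) (t : M.Stalk x) :
    specMap M h (a • t) = X.presheaf.stalkSpecializes h a • specMap M h t := by
  obtain ⟨U, hU, s, rfl⟩ := exists_germ t
  obtain ⟨V, hV, r, rfl⟩ := X.presheaf.exists_germ_eq a
  have hx : x ∈ U ⊓ V := ⟨hU, hV⟩
  rw [← germ_res (homOfLE inf_le_left : U ⊓ V ⟶ U) hx,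
    ← X.presheaf.germ_res_apply (homOfLE inf_le_right : U ⊓ V ⟶ V) x hx, ← germ_smul, specMap_germ,
    germ_smul, specMap_germ, TopCat.Presheaf.germ_stalkSpecializes_apply]

lemma specMap_stalkMap (φ : M ⟶ N) (h : y ⤳ x) (t : M.Stalk x) :
    specMap N h (stalkMap φ x t) = stalkMap φ y (specMap M h t) := by
  obtain ⟨U, hU, s, rfl⟩ := exists_germ t
  simp

/-- A decomposition of the identity acts on the stalks. -/
lemma sum_stalkMap_of_decomposition {ι : Type*} [Fintype ι] {F : ι → X.Modules}
    {p : ∀ i, M ⟶ F i} {j : ∀ i, F i ⟶ M} (hpj : ∑ i, p i ≫ j i = 𝟙 M) (z : X) (t : M.Stalk z) :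
    ∑ i, stalkMap (j i) z (stalkMap (p i) z t) = t := by
  let f : (M ⟶ M) →+ (M.Stalk z →ₗ[X.presheaf.stalk z] M.Stalk z) :=
    { toFun := fun φ ↦ stalkMap φ z, map_zero' := stalkMap_zero z,
      map_add' := fun φ ψ ↦ stalkMap_add φ ψ z }
  have e := congr(f $hpj t)
  rw [map_sum] at e
  simpa [f] using e

/-- The decomposition of the identity of a finite product. -/
lemma exists_decomposition_pi {ι : Type*} [Fintype ι] (F : ι → X.Modules) [HasProduct F] :
    ∃ j : ∀ i, F i ⟶ ∏ᶜ F, ∑ i, Pi.π F i ≫ j i = 𝟙 (∏ᶜ F) ∧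
      ∀ i k, k ≠ i → j i ≫ Pi.π F k = 0 := by
  classical
  refine ⟨fun i ↦ Pi.lift fun k ↦ if h : i = k then eqToHom (congrArg F h) else 0, ?_, ?_⟩
  · refine Pi.hom_ext _ _ fun k ↦ ?_
    rw [Preadditive.sum_comp, Finset.sum_eq_single k]
    · simp
    · intro i _ hik
      simp [hik]
    · simp
  · intro i k hki
    simp [hki.symm]

/-- Bijectivity of the specialization map passes to finite direct sums. -/
lemma specMap_bijective_of_decomposition {ι : Type*} [Fintype ι] (F : ι → X.Modules)
    (p : ∀ i, M ⟶ F i) (j : ∀ i, F i ⟶ M) (hpj : ∑ i, p i ≫ j i = 𝟙 M) (h : y ⤳ x)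
    (hF : ∀ i, Function.Bijective (specMap (F i) h)) : Function.Bijective (specMap M h) := by
  have hsum := sum_stalkMap_of_decomposition hpj
  constructor
  · rw [injective_iff_map_eq_zero]
    intro t ht
    rw [← hsum x t]
    refine Finset.sum_eq_zero fun i _ ↦ ?_
    have : stalkMap (p i) x t = 0 := by
      apply (hF i).1
      rw [specMap_stalkMap, ht, map_zero, map_zero]
    rw [this, map_zero]
  · intro t
    choose v hv using fun i ↦ (hF i).2 (stalkMap (p i) y t)
    refine ⟨∑ i, stalkMap (j i) x (v i), ?_⟩
    rw [map_sum, ← hsum y t]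
    exact Finset.sum_congr rfl fun i _ ↦ by rw [specMap_stalkMap, hv]

end Specialization

end AlgebraicGeometry.Scheme.Modules

namespace FiniteLengthModules

open AlgebraicGeometry Scheme.Modules TopologicalSpace

variable (X : Scheme.{u})

/-- The unit section of the structure sheaf. -/
noncomputable def unitSection (U : X.Opens) : Γ(structureModule X, U) := (1 : Γ(X, U))

lemma smul_unitSection (U : X.Opens) (r : Γ(X, U)) : r • unitSection X U = (r : Γ(X, U)) :=
  mul_one r

lemma map_unitSection {U V : X.Opens} (i : U ⟶ V) :
    (structureModule X).presheaf.map i.op (unitSection X V) = unitSection X U :=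
  map_one (X.presheaf.map i.op).hom

/-- The germ of the unit section. -/
noncomputable def unitGerm (x : X) : (structureModule X).Stalk x :=
  (structureModule X).germ ⊤ x trivial (unitSection X ⊤)

lemma germ_unitSection {U : X.Opens} {x : X} (hx : x ∈ U) :
    (structureModule X).germ U x hx (unitSection X U) = unitGerm X x := by
  rw [← map_unitSection X (homOfLE le_top : U ⟶ ⊤), Scheme.Modules.germ_res]
  rfl

lemma specMap_unitGerm {x y : X} (h : y ⤳ x) :
    specMap (structureModule X) h (unitGerm X x) = unitGerm X y :=
  specMap_germ _ _ _

lemma smul_unitGerm_bijective (x : X) :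
    Function.Bijective fun a : X.presheaf.stalk x ↦ a • unitGerm X x := by
  constructor
  · refine (injective_iff_map_eq_zero (LinearMap.toSpanSingleton (X.presheaf.stalk x) _
      (unitGerm X x))).2 fun a ha ↦ ?_
    rw [LinearMap.toSpanSingleton_apply] at ha
    obtain ⟨U, hU, r, rfl⟩ := X.presheaf.exists_germ_eq a
    rw [← germ_unitSection X hU, ← Scheme.Modules.germ_smul, smul_unitSection,
      ← map_zero ((structureModule X).germ U x hU)] at ha
    obtain ⟨W, hW, i, j, e⟩ := Scheme.Modules.germ_eq _ _ _ _ ha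
    rw [map_zero] at e
    rw [← X.presheaf.germ_res_apply i x hW]
    exact (congrArg (X.presheaf.germ W x hW) e).trans (map_zero _)
  · intro t
    obtain ⟨U, hU, s, rfl⟩ := exists_germ t
    refine ⟨X.presheaf.germ U x hU s, ?_⟩
    change X.presheaf.germ U x hU s • unitGerm X x = _
    rw [← germ_unitSection X hU]
    exact (Scheme.Modules.germ_smul hU _ _).symm.trans
      (congrArg ((structureModule X).germ U x hU) (smul_unitSection X U s))

/-- The stalk of the structure sheaf as a module over itself. -/
noncomputable def unitStalkEquiv (x : X) :
    X.presheaf.stalk x ≃ₗ[X.presheaf.stalk x] (structureModule X).Stalk x :=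
  LinearEquiv.ofBijective (LinearMap.toSpanSingleton _ _ (unitGerm X x))
    (smul_unitGerm_bijective X x)

lemma unitStalkEquiv_apply (x : X) (a : X.presheaf.stalk x) :
    unitStalkEquiv X x a = a • unitGerm X x := rfl

lemma sum_stalkMap_biproduct {ι : Type} [Fintype ι] (F : ι → X.Modules) [HasBiproduct F]
    (x : X) (t : (⨁ F).Stalk x) :
    ∑ i, stalkMap (biproduct.ι F i) x (stalkMap (biproduct.π F i) x t) = t :=
  sum_stalkMap_of_decomposition (F := F) (p := biproduct.π F) (j := biproduct.ι F)
    (biproduct.total (f := F)) x t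

/-- The stalk of a finite direct sum is the product of the stalks. -/
noncomputable def biproductStalkEquiv {ι : Type} [Finite ι] [DecidableEq ι] (F : ι → X.Modules)
    [HasBiproduct F] (x : X) :
    (⨁ F).Stalk x ≃ₗ[X.presheaf.stalk x] ∀ i, (F i).Stalk x :=
  LinearEquiv.ofBijective (LinearMap.pi fun i ↦ stalkMap (biproduct.π F i) x) <| by
    have := Fintype.ofFinite ι
    constructor
    · rw [← LinearMap.ker_eq_bot, LinearMap.ker_eq_bot']
      intro t ht
      rw [← sum_stalkMap_biproduct X F x t]
      refine Finset.sum_eq_zero fun i _ ↦ ?_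
      have : stalkMap (biproduct.π F i) x t = 0 := congrFun ht i
      rw [this, map_zero]
    · intro v
      refine ⟨∑ i, stalkMap (biproduct.ι F i) x (v i), ?_⟩
      ext j
      rw [LinearMap.pi_apply, map_sum, Finset.sum_eq_single j]
      · rw [← stalkMap_comp_apply, biproduct.ι_π_self, stalkMap_id]
        rfl
      · intro i _ hij
        rw [← stalkMap_comp_apply, biproduct.ι_π_ne _ hij, stalkMap_zero]
        rfl
      · simp

lemma biproductStalkEquiv_apply {ι : Type} [Finite ι] [DecidableEq ι] (F : ι → X.Modules)
    [HasBiproduct F] (x : X) (t : (⨁ F).Stalk x) (i : ι) :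
    biproductStalkEquiv X F x t i = stalkMap (biproduct.π F i) x t := rfl

/-- The stalk of `𝒪_X^{⊕ d}`. -/
noncomputable def freeStalkEquiv (d : ℕ) (x : X) :
    (freeModule X d).Stalk x ≃ₗ[X.presheaf.stalk x] (Fin d → X.presheaf.stalk x) :=
  (biproductStalkEquiv X _ x).trans (LinearEquiv.piCongrRight fun _ ↦ (unitStalkEquiv X x).symm)

/-- The standard sections of `𝒪_X^{⊕ d}`. -/
noncomputable def stdSection (d : ℕ) (i : Fin d) (U : X.Opens) : Γ(freeModule X d, U) :=
  (biproduct.ι (fun _ : Fin d ↦ structureModule X) i).app U (unitSection X U)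

lemma germ_stdSection (d : ℕ) (i : Fin d) (U : X.Opens) {x : X} (hx : x ∈ U) :
    (freeModule X d).germ U x hx (stdSection X d i U) =
      (freeStalkEquiv X d x).symm (Pi.single i 1) := by
  rw [LinearEquiv.eq_symm_apply]
  ext j
  refine (LinearEquiv.symm_apply_eq (unitStalkEquiv X x)).2 ?_
  rw [unitStalkEquiv_apply]
  change stalkMap (biproduct.π (fun _ : Fin d ↦ structureModule X) j) x _ = _
  have e : (freeModule X d).germ U x hx (stdSection X d i U) =
      stalkMap (biproduct.ι (fun _ : Fin d ↦ structureModule X) i) x (unitGerm X x) := by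
    rw [← germ_unitSection X hx]
    exact (stalkMap_germ _ hx (unitSection X U)).symm
  rw [e, ← stalkMap_comp_apply]
  obtain rfl | h := eq_or_ne i j
  · rw [biproduct.ι_π_self, stalkMap_id, Pi.single_eq_same, one_smul]
    rfl
  · rw [biproduct.ι_π_ne _ h, stalkMap_zero, Pi.single_eq_of_ne h.symm, zero_smul]
    rfl

end FiniteLengthModules

/-! ### Regular curves -/

section LocalRing

variable (R : Type*) [CommRing R]

/-- In dimension one, the maximal ideal is generated by an element `a`, and a prime `P ≠ (a)`
satisfies `P = a P`, so that `P = 0` by Nakayama's lemma. -/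
lemma IsRegularLocalRing.isDomain_and_isPrincipalIdealRing [IsRegularLocalRing R]
    (h : ringKrullDim R ≤ 1) : IsDomain R ∧ IsPrincipalIdealRing R := by
  have hs := IsRegularLocalRing.spanFinrank_maximalIdeal (R := R)
  have hfg : (IsLocalRing.maximalIdeal R).FG := IsNoetherian.noetherian _
  have key : IsDomain R ∧ (IsLocalRing.maximalIdeal R).IsPrincipal := by
    have hle : (IsLocalRing.maximalIdeal R).spanFinrank ≤ 1 := by
      rw [← hs] at h
      exact_mod_cast h
    obtain h0 | h1 : (IsLocalRing.maximalIdeal R).spanFinrank = 0 ∨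
        (IsLocalRing.maximalIdeal R).spanFinrank = 1 := by omega
    -- dimension zero: `R` is a field
    · have hbot := (Submodule.spanFinrank_eq_zero_iff_eq_bot hfg).1 h0
      exact ⟨(IsLocalRing.isField_iff_maximalIdeal_eq.2 hbot).isDomain, hbot ▸ inferInstance⟩
    · obtain ⟨hp, -⟩ := (Submodule.spanFinrank_eq_one_iff _).1 h1
      refine ⟨?_, hp⟩
      obtain ⟨P, hP, hPm⟩ : ∃ P : Ideal R, P.IsPrime ∧ P ≠ IsLocalRing.maximalIdeal R := by
        by_contra! hall
        have : Subsingleton (PrimeSpectrum R) := ⟨fun p q ↦ PrimeSpectrum.ext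
          ((hall _ p.2).trans (hall _ q.2).symm)⟩
        have := Order.krullDim_nonpos_of_subsingleton (α := PrimeSpectrum R)
        change ringKrullDim R ≤ 0 at this
        rw [← hs, h1] at this
        exact absurd this (by decide)
      obtain ⟨a, ha⟩ := hp
      -- an element of `P` is divisible by `a`, and the quotient lies in `P` since `a` does not
      have haP : a ∉ P := fun haP ↦ hPm ((IsLocalRing.le_maximalIdeal hP.ne_top).antisymm
        (ha ▸ (Submodule.span_singleton_le_iff_mem _ _).2 haP))
      have hbot : P = ⊥ := by
        refine Submodule.eq_bot_of_le_smul_of_le_jacobson_bot (IsLocalRing.maximalIdeal R) P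
          (IsNoetherian.noetherian _) (fun p hp ↦ ?_) (IsLocalRing.maximalIdeal_le_jacobson _)
        obtain ⟨b, rfl⟩ := Submodule.mem_span_singleton.1
          (ha ▸ IsLocalRing.le_maximalIdeal hP.ne_top hp)
        have ham : a ∈ IsLocalRing.maximalIdeal R := ha ▸ Submodule.mem_span_singleton_self a
        rw [show b • a = a * b from mul_comm b a]
        exact Ideal.mul_mem_mul ham ((hP.mem_or_mem hp).resolve_right haP)
      exact IsDomain.of_bot_isPrime R (hbp := hbot ▸ hP)
  obtain ⟨_, hp⟩ := key
  exact ⟨inferInstance, ((tfae_of_isNoetherianRing_of_isLocalRing_of_isDomain R).out 0 4).2 hp⟩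

end LocalRing

namespace AlgebraicGeometry

open TopologicalSpace Topology

/-- A regular noetherian scheme all of whose irreducible components have dimension one. -/
class IsRegularCurve (X : Scheme.{u}) : Prop extends IsNoetherian X where
  regular (x : X) : IsRegularLocalRing (X.presheaf.stalk x)
  dim (Z : Set X) : Z ∈ irreducibleComponents X → topologicalKrullDim Z = 1

namespace IsRegularCurve

variable {X : Scheme.{u}}

lemma exists_genericPoint_specializes (x : X) : ∃ η ∈ genericPoints X, η ⤳ x := by
  refine ⟨_, (genericPoints.ofComponent
    ⟨_, irreducibleComponent_mem_irreducibleComponents x⟩).2, ?_⟩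
  have h := genericPoints.isGenericPoint_ofComponent
    ⟨_, irreducibleComponent_mem_irreducibleComponents x⟩
  exact h.specializes mem_irreducibleComponent

/-- A generic point has no proper generization. -/
lemma eq_of_specializes_genericPoint {η y : X} (hη : η ∈ genericPoints X) (h : y ⤳ η) : y = η := by
  have h' : closure {η} ⊆ closure {y} := h.closure_subset
  have := hη.2 (isIrreducible_singleton.closure : IsIrreducible (closure {y})) h'
  exact h.antisymm (specializes_iff_closure_subset.2 this) |>.eq

lemma fromSpecStalk_injective (x : X) : Function.Injective (X.fromSpecStalk x) :=
  (X.fromSpecStalk x).isEmbedding.injective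

lemma fromSpecStalk_specializes (x : X) (p : Spec (X.presheaf.stalk x)) :
    X.fromSpecStalk x p ⤳ x := by
  have : X.fromSpecStalk x p ∈ Set.range (X.fromSpecStalk x) := ⟨p, rfl⟩
  rwa [Scheme.range_fromSpecStalk] at this

lemma subsingleton_spec_stalk {η : X} (hη : η ∈ genericPoints X) :
    Subsingleton (Spec (X.presheaf.stalk η)) := ⟨fun p q ↦ fromSpecStalk_injective η <| by
  rw [eq_of_specializes_genericPoint hη (fromSpecStalk_specializes η p),
    eq_of_specializes_genericPoint hη (fromSpecStalk_specializes η q)]⟩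

/-- The local ring at a generization is a localization: its elements are fractions. -/
lemma exists_stalkSpecializes_mul_eq {x y : X} (h : y ⤳ x) (b : X.presheaf.stalk y) :
    ∃ a c : X.presheaf.stalk x, c ≠ 0 ∧
      X.presheaf.stalkSpecializes h c * b = X.presheaf.stalkSpecializes h a := by
  obtain ⟨U, hU, hxU, -⟩ := Opens.isBasis_iff_nbhd.1 X.isBasis_affineOpens
    (show x ∈ (⊤ : X.Opens) from trivial)
  have hyU : y ∈ U := h.mem_open U.2 hxU
  let := TopCat.Presheaf.algebra_section_stalk X.presheaf ⟨y, hyU⟩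
  have hly := IsAffineOpen.isLocalization_stalk hU ⟨y, hyU⟩
  have hg (f : Γ(X, U)) : X.presheaf.stalkSpecializes h (X.presheaf.germ U x hxU f) =
      X.presheaf.germ U y hyU f := X.presheaf.germ_stalkSpecializes_apply hxU h f
  obtain ⟨⟨f, s⟩, hfs⟩ := IsLocalization.surj (hU.primeIdealOf ⟨y, hyU⟩).asIdeal.primeCompl b
  have hfs' : b * X.presheaf.germ U y hyU s = X.presheaf.germ U y hyU f := hfs
  have hs : IsUnit (X.presheaf.germ U y hyU s) := IsLocalization.map_units (X.presheaf.stalk y) s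
  refine ⟨X.presheaf.germ U x hxU f, X.presheaf.germ U x hxU s, fun h0 ↦ ?_, ?_⟩
  · rw [← hg, h0, map_zero] at hs
    exact absurd rfl hs.ne_zero
  · rw [hg, hg, mul_comm, hfs']

/-- The points of `Spec 𝒪_x` are the generizations of `x`. If `𝒪_x` is a field, then `x` has only
one. -/
lemma not_isField_stalk {x : X} (hx : x ∉ genericPoints X) : ¬ IsField (X.presheaf.stalk x) := by
  intro h
  obtain ⟨η, hη, hηx⟩ := exists_genericPoint_specializes x
  obtain ⟨p, rfl⟩ : η ∈ Set.range (X.fromSpecStalk x) := by rwa [Scheme.range_fromSpecStalk]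
  have hp : p = IsLocalRing.closedPoint _ := PrimeSpectrum.ext <| by
    let := h.toField
    have : p.asIdeal.IsPrime := PrimeSpectrum.isPrime p
    exact (Ideal.eq_bot_of_prime p.asIdeal).trans
      (IsLocalRing.isField_iff_maximalIdeal_eq.1 h).symm
  rw [hp, Scheme.fromSpecStalk_closedPoint] at hη
  exact hx hη

variable [IsRegularCurve X]

/-- There are no chains of two proper specializations, as the components have dimension one. -/
lemma eq_or_eq_of_specializes {y₀ y₁ y₂ : X} (h₁ : y₀ ⤳ y₁) (h₂ : y₁ ⤳ y₂) :
    y₀ = y₁ ∨ y₁ = y₂ := by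
  let Z := irreducibleComponent y₀
  have hZ : IsClosed Z := isClosed_irreducibleComponent
  have m₀ : y₀ ∈ Z := mem_irreducibleComponent
  have m₁ : y₁ ∈ Z := h₁.mem_closed hZ m₀
  have m₂ : y₂ ∈ Z := h₂.mem_closed hZ m₁
  have hd : Order.krullDim (IrreducibleCloseds Z) ≤ 1 :=
    (dim Z (irreducibleComponent_mem_irreducibleComponents y₀)).le
  let c (z : Z) : IrreducibleCloseds Z :=
    ⟨closure {z}, isIrreducible_singleton.closure, isClosed_closure⟩
  have hc (z z' : Z) : c z ≤ c z' ↔ z'.1 ⤳ z.1 := by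
    rw [← subtype_specializes_iff, specializes_iff_closure_subset]
    rfl
  obtain h | h := Order.krullDim_le_one_iff.1 hd (c ⟨y₁, m₁⟩)
  · exact .inr (h₂.antisymm ((hc ⟨y₁, m₁⟩ ⟨y₂, m₂⟩).1 (h ((hc ⟨y₂, m₂⟩ ⟨y₁, m₁⟩).2 h₂)))).eq
  · exact .inl (h₁.antisymm ((hc ⟨y₀, m₀⟩ ⟨y₁, m₁⟩).1 (h ((hc ⟨y₁, m₁⟩ ⟨y₀, m₀⟩).2 h₁)))).eq

/-- A point which is not generic has no proper specialization, hence is closed. -/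
lemma eq_of_specializes {x y : X} (hx : x ∉ genericPoints X) (h : x ⤳ y) : x = y := by
  obtain ⟨η, hη, hηx⟩ := exists_genericPoint_specializes x
  obtain rfl | h' := eq_or_eq_of_specializes hηx h
  · exact absurd hη hx
  · exact h'

lemma isClosed_singleton {x : X} (hx : x ∉ genericPoints X) : IsClosed ({x} : Set X) := by
  rw [← closure_subset_iff_isClosed]
  exact fun y hy ↦ (eq_of_specializes hx (specializes_iff_mem_closure.2 hy)).symm

/-- A component has dimension one, so that it is not a single point. -/
lemma exists_specializes_ne {η : X} (hη : η ∈ genericPoints X) :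
    ∃ x ∉ genericPoints X, η ⤳ x := by
  by_contra! h
  have hsub : (closure {η} : Set X).Subsingleton := by
    intro y hy z hz
    have key : ∀ w ∈ closure {η}, w = η := fun w hw ↦ by
      have hw' : η ⤳ w := specializes_iff_mem_closure.2 hw
      by_cases hwg : w ∈ genericPoints X
      · exact (eq_of_specializes_genericPoint hwg hw').symm
      · exact absurd hw' (h w hwg)
    rw [key y hy, key z hz]
  have : Subsingleton (closure {η} : Set X) := Set.subsingleton_coe _ |>.2 hsub
  have : Subsingleton (IrreducibleCloseds (closure {η} : Set X)) := ⟨fun a b ↦ by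
    ext z
    have key (c : IrreducibleCloseds (closure {η} : Set X)) : z ∈ c.carrier := by
      obtain ⟨w, hw⟩ := c.isIrreducible'.nonempty
      rwa [Subsingleton.elim z w]
    exact iff_of_true (key a) (key b)⟩
  have h0 := Order.krullDim_nonpos_of_subsingleton (α := IrreducibleCloseds (closure {η} : Set X))
  have h1 : topologicalKrullDim (closure {η} : Set X) = 1 := dim _ hη
  rw [topologicalKrullDim] at h1
  rw [h1] at h0
  exact absurd h0 (by decide)

lemma finite_genericPoints : (genericPoints X).Finite :=
  genericPoints.finite NoetherianSpace.finite_irreducibleComponents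

instance : Finite (genericPoints X) := finite_genericPoints

lemma ringKrullDim_stalk_le_one (x : X) : ringKrullDim (X.presheaf.stalk x) ≤ 1 := by
  refine Order.krullDim_le_one_iff.2 fun p ↦ ?_
  by_cases hp : X.fromSpecStalk x p = x
  · right
    intro q _
    have := fromSpecStalk_injective x (hp.trans (Scheme.fromSpecStalk_closedPoint (x := x)).symm)
    rw [this]
    exact IsLocalRing.le_maximalIdeal q.2.ne_top
  · left
    intro q hq
    have h1 : X.fromSpecStalk x q ⤳ X.fromSpecStalk x p :=
      ((PrimeSpectrum.le_iff_specializes q p).1 hq).map (X.fromSpecStalk x).continuous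
    obtain h | h := eq_or_eq_of_specializes h1 (fromSpecStalk_specializes x p)
    · exact (fromSpecStalk_injective x h).symm ▸ (le_refl (α := PrimeSpectrum _) q)
    · exact absurd h hp

instance (x : X) : IsDomain (X.presheaf.stalk x) :=
  have := regular x
  (IsRegularLocalRing.isDomain_and_isPrincipalIdealRing _ (ringKrullDim_stalk_le_one x)).1

instance (x : X) : IsPrincipalIdealRing (X.presheaf.stalk x) :=
  have := regular x
  (IsRegularLocalRing.isDomain_and_isPrincipalIdealRing _ (ringKrullDim_stalk_le_one x)).2

lemma isField_stalk {η : X} (hη : η ∈ genericPoints X) : IsField (X.presheaf.stalk η) := by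
  have := subsingleton_spec_stalk hη
  rw [IsLocalRing.isField_iff_maximalIdeal_eq]
  exact congrArg PrimeSpectrum.asIdeal
    (Subsingleton.elim (α := Spec (X.presheaf.stalk η)) (IsLocalRing.closedPoint _) ⟨⊥, inferInstance⟩)

/-- Since `𝒪_x` is a domain, `x` lies on only one irreducible component. -/
lemma genericPoint_unique {η η' x : X} (hη : η ∈ genericPoints X) (hη' : η' ∈ genericPoints X)
    (h : η ⤳ x) (h' : η' ⤳ x) : η = η' := by
  let b : Spec (X.presheaf.stalk x) := ⟨⊥, inferInstance⟩
  have key (ζ : X) (hζ : ζ ∈ genericPoints X) (hx : ζ ⤳ x) : X.fromSpecStalk x b = ζ := by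
    obtain ⟨p, rfl⟩ : ζ ∈ Set.range (X.fromSpecStalk x) := by
      rwa [Scheme.range_fromSpecStalk]
    exact eq_of_specializes_genericPoint hζ
      (((PrimeSpectrum.le_iff_specializes b p).1 bot_le).map (X.fromSpecStalk x).continuous)
  rw [← key η hη h, key η' hη' h']

/-- The map `𝒪_x → 𝒪_y` is injective for a specialization `y ⤳ x`: it is the localization of a domain
at elements which are not zero. -/
lemma stalkSpecializes_injective {x y : X} (h : y ⤳ x) :
    Function.Injective (X.presheaf.stalkSpecializes h) := by
  rw [injective_iff_map_eq_zero]
  obtain ⟨U, hU, hxU, -⟩ := Opens.isBasis_iff_nbhd.1 X.isBasis_affineOpens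
    (show x ∈ (⊤ : X.Opens) from trivial)
  have hyU : y ∈ U := h.mem_open U.2 hxU
  let := TopCat.Presheaf.algebra_section_stalk X.presheaf ⟨x, hxU⟩
  let := TopCat.Presheaf.algebra_section_stalk X.presheaf ⟨y, hyU⟩
  have hlx := IsAffineOpen.isLocalization_stalk hU ⟨x, hxU⟩
  have hly := IsAffineOpen.isLocalization_stalk hU ⟨y, hyU⟩
  have hg (f : Γ(X, U)) : X.presheaf.stalkSpecializes h (X.presheaf.germ U x hxU f) =
      X.presheaf.germ U y hyU f := X.presheaf.germ_stalkSpecializes_apply hxU h f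
  intro a ha
  obtain ⟨⟨f, s⟩, hfs⟩ := IsLocalization.surj (hU.primeIdealOf ⟨x, hxU⟩).asIdeal.primeCompl a
  have hfs' : a * X.presheaf.germ U x hxU s = X.presheaf.germ U x hxU f := hfs
  have hf0 : X.presheaf.germ U y hyU f = 0 := by rw [← hg, ← hfs', map_mul, ha, zero_mul]
  -- `t f = 0` for some `t` invertible in `𝒪_y`; in the domain `𝒪_x`, where `t ≠ 0`, this forces
  -- `f = 0`
  obtain ⟨t, ht⟩ := (IsLocalization.map_eq_zero_iff
    (hU.primeIdealOf ⟨y, hyU⟩).asIdeal.primeCompl (X.presheaf.stalk y) f).1 hf0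
  have hs : IsUnit (X.presheaf.germ U x hxU s) := IsLocalization.map_units (X.presheaf.stalk x) s
  have htu : IsUnit (X.presheaf.germ U y hyU t) := IsLocalization.map_units (X.presheaf.stalk y) t
  have ht0 : X.presheaf.germ U x hxU t * X.presheaf.germ U x hxU f = 0 := by
    rw [← map_mul, ht, map_zero]
  obtain h0 | h0 := mul_eq_zero.1 ht0
  · rw [← hg, h0, map_zero] at htu
    exact absurd rfl htu.ne_zero
  · rw [h0] at hfs'
    exact (mul_eq_zero.1 hfs').resolve_right hs.ne_zero

/-- An open set containing the generic points is the complement of a finite set. -/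
lemma finite_compl_of_genericPoints_subset {U : X.Opens} (hU : genericPoints X ⊆ U) :
    (U : Set X)ᶜ.Finite := by
  -- the complement has finitely many components, each the closure of a point which is closed
  obtain ⟨S, hS, hcl, hirr, hfin⟩ :=
    NoetherianSpace.exists_finite_set_isClosed_irreducible U.2.isClosed_compl
  rw [Set.sUnion_eq_biUnion] at hfin
  change (U : Set X)ᶜ = _ at hfin
  rw [hfin]
  refine hS.biUnion fun Z hZ ↦ ?_
  obtain ⟨x, hx⟩ := QuasiSober.sober (hirr Z hZ) (hcl Z hZ)
  have hxZ : x ∈ Z := hx.mem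
  have hxU : x ∈ (U : Set X)ᶜ := by
    rw [hfin]
    exact Set.mem_biUnion hZ hxZ
  have hcx := isClosed_singleton (x := x) fun hxg ↦ hxU (hU hxg)
  rw [← hx.def, hcx.closure_eq]
  exact Set.finite_singleton x

lemma exists_opens_compl {F : Set X} (hF : F.Finite) (hg : ∀ x ∈ F, x ∉ genericPoints X) :
    ∃ U : X.Opens, (U : Set X) = Fᶜ :=
  ⟨⟨Fᶜ, by
    rw [isOpen_compl_iff, ← Set.biUnion_of_singleton F]
    exact hF.isClosed_biUnion fun x hx ↦ isClosed_singleton (hg x hx)⟩, rfl⟩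

end IsRegularCurve

end AlgebraicGeometry

/-! ### The stalks of the module of rational functions -/

namespace AlgebraicGeometry.Scheme.Modules

open TopologicalSpace Opposite

variable {X : Scheme.{u}} {M N : X.Modules} {x y : X}

lemma IsProductOfStalks.exists_germ_eq (hN : N.IsProductOfStalks {y}) (U : X.Opens) (hy : y ∈ U)
    (t : N.Stalk y) : ∃ s : Γ(N, U), N.germ U y hy s = t := by
  classical
  obtain ⟨s, hs⟩ := hN.exists_section U (Function.update 0 y t)
  exact ⟨s, by rw [hs y hy rfl, Function.update_self]⟩

/-- A module concentrated in `y` is constant on the closure of `y`. -/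
lemma IsProductOfStalks.specMap_bijective (hN : N.IsProductOfStalks {y}) (h : y ⤳ x) :
    Function.Bijective (specMap N h) := by
  constructor
  · rw [injective_iff_map_eq_zero]
    intro t ht
    obtain ⟨U, hU, s, rfl⟩ := exists_germ t
    rw [specMap_germ] at ht
    rw [hN.ext U s 0 fun z hz hzy ↦ ?_, map_zero]
    obtain rfl : z = y := hzy
    rw [ht, map_zero]
  · intro t
    obtain ⟨s, hs⟩ := hN.exists_germ_eq ⊤ trivial t
    exact ⟨N.germ ⊤ x trivial s, (specMap_germ (U := ⊤) h trivial s).trans hs⟩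

lemma IsProductOfStalks.subsingleton_stalk (hN : N.IsProductOfStalks {y}) (h : ¬ y ⤳ x) :
    Subsingleton (N.Stalk x) := by
  refine subsingleton_of_forall_eq 0 fun t ↦ ?_
  rw [specializes_iff_forall_open] at h
  push Not at h
  obtain ⟨U, hU, hxU, hyU⟩ := h
  obtain ⟨W, hWU, hxW, s, rfl⟩ := exists_le_germ (U := ⟨U, hU⟩) t hxU
  rw [hN.ext W s 0 fun z hz hzy ↦ ?_, map_zero]
  obtain rfl : z = y := hzy
  exact absurd (hWU hz) hyU

end AlgebraicGeometry.Scheme.Modules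

namespace FiniteLengthModules

open AlgebraicGeometry Scheme.Modules TopologicalSpace

variable (X : Scheme.{u})

section StalkModule

variable {X} {η : X}

/-- `Spec 𝒪_η` is a single point, which maps to `η`. -/
lemma preimage_fromSpecStalk_of_mem (hη : η ∈ genericPoints X) {U : X.Opens} (h : η ∈ U) :
    X.fromSpecStalk η ⁻¹ᵁ U = ⊤ := by
  ext p
  refine iff_of_true ?_ trivial
  change X.fromSpecStalk η p ∈ U
  rwa [IsRegularCurve.eq_of_specializes_genericPoint hη
    (IsRegularCurve.fromSpecStalk_specializes η p)]

lemma preimage_fromSpecStalk_of_notMem (hη : η ∈ genericPoints X) {U : X.Opens} (h : η ∉ U) :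
    X.fromSpecStalk η ⁻¹ᵁ U = ⊥ := by
  ext p
  refine iff_of_false (fun hp ↦ h ?_) id
  change X.fromSpecStalk η p ∈ U at hp
  rwa [IsRegularCurve.eq_of_specializes_genericPoint hη
    (IsRegularCurve.fromSpecStalk_specializes η p)] at hp

lemma pushforward_map_bijective {Y : Scheme.{u}} (f : Y ⟶ X) (M : Y.Modules) {U U' : X.Opens}
    (i : U' ⟶ U) (h : f ⁻¹ᵁ U = f ⁻¹ᵁ U') :
    Function.Bijective (((Scheme.Modules.pushforward f).obj M).presheaf.map i.op) := by
  have : IsIso ((Opens.map f.base).map i) := ⟨eqToHom h, Subsingleton.elim _ _, Subsingleton.elim _ _⟩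
  have : IsIso (M.presheaf.map ((Opens.map f.base).map i).op) := inferInstance
  exact ConcreteCategory.bijective_of_isIso (M.presheaf.map ((Opens.map f.base).map i).op)

lemma isProductOfStalks_pushforward (hη : η ∈ genericPoints X)
    (M : (Spec (X.presheaf.stalk η)).Modules) :
    ((Scheme.Modules.pushforward (X.fromSpecStalk η)).obj M).IsProductOfStalks {η} where
  exists_section U t := by
    by_cases hU : η ∈ U
    · obtain ⟨W, hWU, hW, s, hs⟩ := exists_le_germ (t η) hU
      obtain ⟨s', hs'⟩ := (pushforward_map_bijective (X.fromSpecStalk η) M (homOfLE hWU)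
        ((preimage_fromSpecStalk_of_mem hη hU).trans
          (preimage_fromSpecStalk_of_mem hη hW).symm)).2 s
      refine ⟨s', fun x hx hxη ↦ ?_⟩
      obtain rfl : x = η := hxη
      rw [← hs, ← hs', Scheme.Modules.germ_res]
    · exact ⟨0, fun x hx hxη ↦ absurd (hxη ▸ hx) hU⟩
  ext U s s' h := by
    by_cases hU : η ∈ U
    · obtain ⟨W, hW, i, j, e⟩ := Scheme.Modules.germ_eq _ _ _ _ (h η hU rfl)
      rw [Subsingleton.elim j i] at e
      exact (pushforward_map_bijective (X.fromSpecStalk η) M i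
        ((preimage_fromSpecStalk_of_mem hη hU).trans
          (preimage_fromSpecStalk_of_mem hη hW).symm)).1 e
    · have e := preimage_fromSpecStalk_of_notMem hη hU
      have : Subsingleton Γ(M, X.fromSpecStalk η ⁻¹ᵁ U) := by
        rw [e]
        refine ⟨fun a b ↦ section_ext a b fun x hx ↦ hx.elim⟩
      exact Subsingleton.elim (α := Γ(M, X.fromSpecStalk η ⁻¹ᵁ U)) s s'

lemma isProductOfStalks_stalkModule (hη : η ∈ genericPoints X) :
    (stalkModule X η).IsProductOfStalks {η} :=
  isProductOfStalks_pushforward hη _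

/-- The stalk at `η` of the push-forward of `𝒪` from `Spec 𝒪_η` is `𝒪_η`. -/
lemma stalkMap_toStalkModule_bijective (hη : η ∈ genericPoints X) :
    Function.Bijective (stalkMap (toStalkModule X η) η) := by
  -- over `U ∋ η`, the map sends a function to its germ at `η`, as a function on `Spec 𝒪_η`
  have happ (U : X.Opens) (hU : η ∈ U) (r : Γ(X, U)) : (toStalkModule X η).app U r =
      ((Spec (X.presheaf.stalk η)).presheaf.map (homOfLE le_top).op
        ((Scheme.ΓSpecIso (X.presheaf.stalk η)).inv (X.presheaf.germ U η hU r)) :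
          Γ(Spec (X.presheaf.stalk η), X.fromSpecStalk η ⁻¹ᵁ U)) :=
    congr($(Scheme.fromSpecStalk_app hU) r)
  have hres (U : X.Opens) (hU : η ∈ U) : Function.Bijective
      ((Spec (X.presheaf.stalk η)).presheaf.map
        (homOfLE le_top : X.fromSpecStalk η ⁻¹ᵁ U ⟶ ⊤).op) := by
    have : IsIso (homOfLE le_top : X.fromSpecStalk η ⁻¹ᵁ U ⟶ ⊤) :=
      ⟨eqToHom (preimage_fromSpecStalk_of_mem hη hU).symm, Subsingleton.elim _ _,
        Subsingleton.elim _ _⟩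
    exact ConcreteCategory.bijective_of_isIso _
  have hΓ := ConcreteCategory.bijective_of_isIso (Scheme.ΓSpecIso (X.presheaf.stalk η)).inv
  constructor
  · rw [injective_iff_map_eq_zero]
    intro t ht
    obtain ⟨U, hU, r, rfl⟩ := exists_germ t
    rw [stalkMap_germ] at ht
    have h0 : (toStalkModule X η).app U r = 0 :=
      (isProductOfStalks_stalkModule hη).ext U _ _ fun x hx hxη ↦ by
        obtain rfl : x = η := hxη
        rw [ht, map_zero]
    have h1 := (happ U hU r).symm.trans h0
    have h2 := hΓ.1 (((hres U hU).1 (h1.trans (map_zero _).symm)).trans (map_zero _).symm)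
    refine (congrArg ((structureModule X).germ U η hU) (smul_unitSection X U r).symm).trans ?_
    refine (Scheme.Modules.germ_smul hU _ _).trans ?_
    rw [h2, zero_smul]
  · intro t
    obtain ⟨s, hs'⟩ := (isProductOfStalks_stalkModule hη).exists_germ_eq ⊤ trivial t
    obtain ⟨b, hb⟩ := hΓ.2 (s : Γ(Spec (X.presheaf.stalk η), ⊤))
    obtain ⟨U, hU, r, rfl⟩ := X.presheaf.exists_germ_eq b
    refine ⟨(structureModule X).germ U η hU r, ?_⟩
    refine (stalkMap_germ _ _ _).trans (Eq.trans ?_ hs')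
    rw [← Scheme.Modules.germ_res (homOfLE le_top : U ⟶ ⊤) hU]
    refine congrArg ((stalkModule X η).germ U η hU) ((happ U hU r).trans ?_)
    rw [hb]
    rfl

end StalkModule

variable {X} in
lemma freeStalkEquiv_specMap {d : ℕ} {x y : X} (h : y ⤳ x) (t : (freeModule X d).Stalk x)
    (i : Fin d) : freeStalkEquiv X d y (specMap _ h t) i =
      X.presheaf.stalkSpecializes h (freeStalkEquiv X d x t i) := by
  refine (LinearEquiv.symm_apply_eq (unitStalkEquiv X y)).2 ?_
  rw [unitStalkEquiv_apply, ← specMap_unitGerm X h, ← specMap_smul, ← unitStalkEquiv_apply]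
  have : unitStalkEquiv X x (freeStalkEquiv X d x t i) = biproductStalkEquiv X _ x t i :=
    LinearEquiv.apply_symm_apply _ _
  rw [this, biproductStalkEquiv_apply, specMap_stalkMap]
  rfl

section RatSpace

variable [IsRegularCurve X]

open IsRegularCurve

variable {X} in
lemma specMap_stalkModule_bijective {η η' x : X} (hη : η ∈ genericPoints X)
    (hη' : η' ∈ genericPoints X) (h : η ⤳ x) :
    Function.Bijective (specMap (stalkModule X η') h) := by
  by_cases e : η' = η
  · subst e
    exact (isProductOfStalks_stalkModule hη').specMap_bijective h
  · have h1 : ¬ η' ⤳ x := fun h' ↦ e (genericPoint_unique hη' hη h' h)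
    have h2 : ¬ η' ⤳ η := fun h' ↦ e (eq_of_specializes_genericPoint hη h')
    have := (isProductOfStalks_stalkModule hη').subsingleton_stalk h1
    have := (isProductOfStalks_stalkModule hη').subsingleton_stalk h2
    exact ⟨Function.injective_of_subsingleton _, fun t ↦ ⟨0, Subsingleton.elim _ _⟩⟩

variable {X} in
lemma specMap_ratModule_bijective {η x : X} (hη : η ∈ genericPoints X) (h : η ⤳ x) :
    Function.Bijective (specMap (ratModule X) h) := by
  have := Fintype.ofFinite (genericPoints X)
  obtain ⟨j, hj, -⟩ := exists_decomposition_pi fun x : genericPoints X ↦ stalkModule X x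
  exact specMap_bijective_of_decomposition _ _ j hj h
    fun i ↦ specMap_stalkModule_bijective hη i.2 h

variable {X} in
/-- `V` is constant on each component: its stalk at `x` is the stalk at the generic point. -/
lemma specMap_ratSpace_bijective {d : ℕ} {η x : X} (hη : η ∈ genericPoints X) (h : η ⤳ x) :
    Function.Bijective (specMap (ratSpace X d) h) :=
  specMap_bijective_of_decomposition (fun _ : Fin d ↦ ratModule X)
    (biproduct.π fun _ : Fin d ↦ ratModule X) (biproduct.ι fun _ : Fin d ↦ ratModule X)
    (biproduct.total (f := fun _ : Fin d ↦ ratModule X)) h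
    fun _ ↦ specMap_ratModule_bijective hη h

variable {X} in
lemma stalkMap_toRatModule_bijective {η : X} (hη : η ∈ genericPoints X) :
    Function.Bijective (stalkMap (toRatModule X) η) := by
  have := Fintype.ofFinite (genericPoints X)
  obtain ⟨j, hj, -⟩ := exists_decomposition_pi fun x : genericPoints X ↦ stalkModule X x
  let p (i : genericPoints X) : ratModule X ⟶ stalkModule X i :=
    Pi.π (fun x : genericPoints X ↦ stalkModule X x) i
  -- the factors of `K_X` at the other generic points have stalk zero at `η`
  have hinj : Function.Injective (stalkMap (p ⟨η, hη⟩) η) := by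
    rw [injective_iff_map_eq_zero]
    intro t ht
    refine (sum_stalkMap_of_decomposition hj η t).symm.trans (Finset.sum_eq_zero fun i _ ↦ ?_)
    have hi : stalkMap (p i) η t = 0 := by
      by_cases e : i = ⟨η, hη⟩
      · rw [e, ht]
      · have : Subsingleton ((stalkModule X i).Stalk η) :=
          (isProductOfStalks_stalkModule i.2).subsingleton_stalk fun h' ↦
            e (Subtype.ext (eq_of_specializes_genericPoint hη h'))
        exact Subsingleton.elim _ _
    exact (congrArg _ hi).trans (map_zero _)
  have hcomp : toRatModule X ≫ p ⟨η, hη⟩ = toStalkModule X η := Pi.lift_π _ _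
  have hb := stalkMap_toStalkModule_bijective hη
  rw [← hcomp, stalkMap_comp, LinearMap.coe_comp] at hb
  refine ⟨hb.1.of_comp, fun t ↦ ?_⟩
  obtain ⟨s, hs⟩ := hb.2 (stalkMap (p ⟨η, hη⟩) η t)
  exact ⟨s, hinj hs⟩

/-- The inclusion `𝒪_X^{⊕ d} ⟶ K_X^{⊕ d}`. -/
noncomputable def stdMap (d : ℕ) : freeModule X d ⟶ ratSpace X d :=
  biproduct.map fun _ : Fin d ↦ toRatModule X

variable {X} in
lemma stalkMap_stdMap_bijective {d : ℕ} {η : X} (hη : η ∈ genericPoints X) :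
    Function.Bijective (stalkMap (stdMap X d) η) := by
  have hb := stalkMap_toRatModule_bijective hη
  have key (t : (freeModule X d).Stalk η) (i : Fin d) :
      biproductStalkEquiv X _ η (stalkMap (stdMap X d) η t) i =
        stalkMap (toRatModule X) η (biproductStalkEquiv X _ η t i) := by
    rw [biproductStalkEquiv_apply, biproductStalkEquiv_apply, ← stalkMap_comp_apply,
      ← stalkMap_comp_apply, stdMap, biproduct.map_π]
  constructor
  · intro s t h
    apply (biproductStalkEquiv X _ η).injective
    ext i
    apply hb.1
    rw [← key, h, key]
  · intro t
    choose v hv using fun i ↦ hb.2 (biproductStalkEquiv X _ η t i)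
    refine ⟨(biproductStalkEquiv X _ η).symm v, (biproductStalkEquiv X _ η).injective ?_⟩
    ext i
    rw [key, LinearEquiv.apply_symm_apply, hv]

variable {X} in
lemma specMap_freeModule_injective {d : ℕ} {x y : X} (h : y ⤳ x) :
    Function.Injective (specMap (freeModule X d) h) := by
  intro s t e
  apply (freeStalkEquiv X d x).injective
  ext i
  apply stalkSpecializes_injective h
  rw [← freeStalkEquiv_specMap, e, freeStalkEquiv_specMap]

lemma stalkMap_stdMap_injective (d : ℕ) (x : X) :
    Function.Injective (stalkMap (stdMap X d) x) := by
  obtain ⟨η, hη, h⟩ := exists_genericPoint_specializes x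
  intro s t e
  apply specMap_freeModule_injective h
  apply (stalkMap_stdMap_bijective hη).1
  rw [← specMap_stalkMap, e, specMap_stalkMap]

instance (d : ℕ) : Mono (stdMap X d) :=
  mono_of_stalkMap_injective (stalkMap_stdMap_injective X d)

lemma stalkSub_stdLattice (d : ℕ) (x : X) :
    stalkSub (stdLattice X d) x = LinearMap.range (stalkMap (stdMap X d) x) := by
  rw [← stalkSub_mk]
  congr 1
  exact imageSubobject_mono (stdMap X d)

lemma stalkSub_stdLattice_genericPoint {d : ℕ} {η : X} (hη : η ∈ genericPoints X) :
    stalkSub (stdLattice X d) η = ⊤ := by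
  rw [stalkSub_stdLattice, LinearMap.range_eq_top]
  exact (stalkMap_stdMap_bijective hη).2

/-- The stalk of `𝒪_X^{⊕ d} ⊆ K_X^{⊕ d}` is free. -/
noncomputable def stdStalkEquiv (d : ℕ) (x : X) :
    (Fin d → X.presheaf.stalk x) ≃ₗ[X.presheaf.stalk x] stalkSub (stdLattice X d) x :=
  (freeStalkEquiv X d x).symm ≪≫ₗ
    (LinearEquiv.ofInjective _ (stalkMap_stdMap_injective X d x)) ≪≫ₗ
    LinearEquiv.ofEq _ _ (stalkSub_stdLattice X d x).symm

end RatSpace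

end FiniteLengthModules

/-! ### Lattices over a principal ideal domain -/

section VectorSpace

variable {k A B : Type*} [Field k] [AddCommGroup A] [Module k A] [AddCommGroup B] [Module k B]
  [FiniteDimensional k A] [FiniteDimensional k B]

/-- A linear map `g` between spaces of the same dimension can be made injective by adding a map
with values in a given subspace `K` that generates the target together with the image of `g`: the
kernel of `g` has the dimension of a complement of the image of `g`, which may be taken in `K`. -/
lemma LinearMap.exists_add_injective (hAB : Module.finrank k A = Module.finrank k B)
    (g : A →ₗ[k] B) (K : Submodule k B) (hK : LinearMap.range g ⊔ K = ⊤) :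
    ∃ θ : A →ₗ[k] B, (∀ a, θ a ∈ K) ∧ Function.Injective (g + θ) := by
  -- `C ≤ K` is a complement of the image of `g`
  obtain ⟨C', hC'⟩ := Submodule.exists_isCompl ((LinearMap.range g ⊓ K).comap K.subtype)
  let C := C'.map K.subtype
  have hCK : C ≤ K := Submodule.map_subtype_le _ _
  have hdisj : Disjoint (LinearMap.range g) C := by
    rw [Submodule.disjoint_def]
    rintro _ hx ⟨y, hy, rfl⟩
    have := Submodule.disjoint_def.1 hC'.disjoint y ⟨hx, y.2⟩ hy
    rw [this, map_zero]
  have hsup : LinearMap.range g ⊔ C = ⊤ := by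
    rw [eq_top_iff, ← hK, sup_le_iff]
    refine ⟨le_sup_left, fun x hx ↦ ?_⟩
    obtain ⟨y, hy, z, hz, e⟩ := Submodule.mem_sup.1
      ((hC'.sup_eq_top ▸ Submodule.mem_top : (⟨x, hx⟩ : K) ∈ _))
    have e' : x = y.1 + z.1 := congrArg Subtype.val e.symm
    rw [e']
    exact Submodule.add_mem_sup hy.1 ⟨z, hz, rfl⟩
  have hdim : Module.finrank k (LinearMap.ker g) = Module.finrank k C := by
    have h1 := LinearMap.finrank_range_add_finrank_ker g
    have h2 := Submodule.finrank_add_eq_of_isCompl ⟨hdisj, codisjoint_iff.2 hsup⟩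
    omega
  obtain ⟨e⟩ : Nonempty (LinearMap.ker g ≃ₗ[k] C) := ⟨LinearEquiv.ofFinrankEq _ _ hdim⟩
  -- `θ` projects to the kernel of `g` and maps it isomorphically onto `C`
  obtain ⟨p, hp⟩ := (LinearMap.ker g).subtype.exists_leftInverse_of_injective
    (Submodule.ker_subtype _)
  refine ⟨C.subtype ∘ₗ e.toLinearMap ∘ₗ p, fun a ↦ hCK (e (p a)).2, ?_⟩
  rw [injective_iff_map_eq_zero]
  intro a ha
  have ha' : g a + (e (p a)).1 = 0 := ha
  have h1 : g a = 0 := Submodule.disjoint_def.1 hdisj _ ⟨a, rfl⟩ <| by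
    rw [eq_neg_of_add_eq_zero_left ha']
    exact C.neg_mem (e (p a)).2
  rw [h1, zero_add] at ha'
  have h2 : p a = ⟨a, h1⟩ := LinearMap.congr_fun hp ⟨a, h1⟩
  rw [h2] at ha'
  exact congrArg Subtype.val (e.map_eq_zero_iff.1 (Subtype.ext ha'))

end VectorSpace

section LocalRing

variable {R : Type*} [CommRing R] [IsLocalRing R] {n : ℕ} {Q : Type*} [AddCommGroup Q] [Module R Q]

/-- Two surjections from a free module of finite rank over a local ring onto the same module differ
by an automorphism. A lift of one along the other is corrected modulo the maximal ideal. -/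
lemma IsLocalRing.exists_linearEquiv_comp_eq (ρ ρ' : (Fin n → R) →ₗ[R] Q)
    (hρ' : Function.Surjective ρ') (hρ : Function.Surjective ρ) :
    ∃ g : (Fin n → R) ≃ₗ[R] (Fin n → R), ∀ v, ρ' (g v) = ρ v := by
  let k := IsLocalRing.ResidueField R
  let red : (Fin n → R) →ₛₗ[IsLocalRing.residue R] (Fin n → k) :=
    { toFun := fun v i ↦ IsLocalRing.residue R (v i)
      map_add' := fun v w ↦ funext fun i ↦ map_add _ _ _
      map_smul' := fun a v ↦ funext fun i ↦ map_mul _ _ _ }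
  have hred : Function.Surjective red := fun w ↦ by
    choose v hv using fun i ↦ IsLocalRing.residue_surjective (w i)
    exact ⟨v, funext hv⟩
  have : RingHomSurjective (IsLocalRing.residue R) := ⟨IsLocalRing.residue_surjective⟩
  -- a lift, which need not be invertible
  obtain ⟨g₀, hg₀⟩ := Module.projective_lifting_property ρ' ρ hρ'
  let g₀k : (Fin n → k) →ₗ[k] (Fin n → k) :=
    Matrix.toLin' ((LinearMap.toMatrix' g₀).map (IsLocalRing.residue R))
  have hg₀k (v : Fin n → R) : g₀k (red v) = red (g₀ v) := by
    rw [← LinearMap.toMatrix'_mulVec g₀ v]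
    ext i
    exact (RingHom.map_mulVec (IsLocalRing.residue R) _ v i).symm
  -- modulo the maximal ideal, the lift and the kernel of the second map generate
  obtain ⟨θ, hθK, hθ⟩ := LinearMap.exists_add_injective rfl g₀k ((LinearMap.ker ρ').map red) <| by
    rw [eq_top_iff]
    intro w _
    obtain ⟨w', rfl⟩ := hred w
    obtain ⟨v, hv⟩ := hρ (ρ' w')
    have hw : w' = g₀ v + (w' - g₀ v) := by abel
    rw [hw, map_add, ← hg₀k]
    refine Submodule.add_mem_sup ⟨_, rfl⟩ ⟨_, ?_, rfl⟩
    have := LinearMap.congr_fun hg₀ v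
    rw [LinearMap.comp_apply] at this
    rw [SetLike.mem_coe, LinearMap.mem_ker, map_sub, this, hv, sub_self]
  -- lift the correction `θ` to a map with values in the kernel
  choose t ht hte using fun j ↦ hθK (Pi.single j 1)
  let Θ : (Fin n → R) →ₗ[R] (Fin n → R) := (Pi.basisFun R (Fin n)).constr R t
  have hΘ (j : Fin n) : Θ (Pi.single j 1) = t j := by
    rw [← Pi.basisFun_apply, Module.Basis.constr_basis]
  have hΘρ : ρ' ∘ₗ Θ = 0 := (Pi.basisFun R (Fin n)).ext fun j ↦ by
    rw [Pi.basisFun_apply, LinearMap.comp_apply, hΘ]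
    exact ht j
  have hmat : (LinearMap.toMatrix' (g₀ + Θ)).map (IsLocalRing.residue R) =
      LinearMap.toMatrix' (g₀k + θ) := by
    ext i j
    have e1 : red (Pi.single j 1) = Pi.single j 1 := by
      ext i
      exact (Pi.apply_single (fun _ ↦ IsLocalRing.residue R) (fun _ ↦ map_zero _) j 1 i).trans
        (by rw [map_one])
    have e2 : red ((g₀ + Θ) (Pi.single j 1)) = (g₀k + θ) (Pi.single j 1) := by
      rw [LinearMap.add_apply, LinearMap.add_apply, map_add, ← hg₀k, hΘ, hte, e1]
    rw [Matrix.map_apply, LinearMap.toMatrix'_apply, LinearMap.toMatrix'_apply]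
    exact congrFun e2 i
  -- the corrected lift is invertible since it is so modulo the maximal ideal
  have hdet : IsUnit (LinearMap.toMatrix' (g₀ + Θ)).det := by
    apply isUnit_of_map_unit (IsLocalRing.residue R)
    rw [RingHom.map_det, RingHom.mapMatrix_apply, hmat, LinearMap.det_toMatrix']
    exact LinearMap.isUnit_det (g₀k + θ) (by
      rw [Module.End.isUnit_iff]
      exact ⟨hθ, LinearMap.injective_iff_surjective.1 hθ⟩)
  refine ⟨LinearEquiv.ofIsUnitDet (v := Pi.basisFun R (Fin n)) (v' := Pi.basisFun R (Fin n))
    (f := g₀ + Θ) (by rwa [LinearMap.toMatrix_eq_toMatrix']), fun v ↦ ?_⟩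
  change ρ' (g₀ v + Θ v) = ρ v
  rw [map_add, ← LinearMap.comp_apply, ← LinearMap.comp_apply, hg₀, hΘρ]
  simp

/-- If `M` and `M'` are free of the same rank, the kernel of any surjection of `M'` onto `M / cM`
is `cM'`. -/
lemma IsLocalRing.ker_eq_smul_top {M M' : Type*} [AddCommGroup M] [Module R M] [AddCommGroup M']
    [Module R M'] (e : (Fin n → R) ≃ₗ[R] M) (e' : (Fin n → R) ≃ₗ[R] M') (ρ : M →ₗ[R] Q)
    (ρ' : M' →ₗ[R] Q) (hρ : Function.Surjective ρ) (hρ' : Function.Surjective ρ') {c : R}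
    (h : ∀ m, ρ m = 0 ↔ ∃ m', m = c • m') (m : M') : ρ' m = 0 ↔ ∃ m', m = c • m' := by
  obtain ⟨g, hg⟩ := exists_linearEquiv_comp_eq (ρ ∘ₗ e.toLinearMap) (ρ' ∘ₗ e'.toLinearMap)
    (hρ'.comp e'.surjective) (hρ.comp e.surjective)
  let f : M ≃ₗ[R] M' := e.symm ≪≫ₗ g ≪≫ₗ e'
  have hf (m : M) : ρ' (f m) = ρ m := by simpa [f] using hg (e.symm m)
  obtain ⟨m, rfl⟩ := f.surjective m
  rw [hf, h]
  constructor
  · rintro ⟨m', rfl⟩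
    exact ⟨f m', map_smul _ _ _⟩
  · rintro ⟨m', e⟩
    exact ⟨f.symm m', f.injective (by rw [e, map_smul, LinearEquiv.apply_symm_apply])⟩

end LocalRing

section FullLattice

variable {R V : Type*} [CommRing R] [IsDomain R] [AddCommGroup V] [Module R V]

variable (R V) in
/-- A vector space over the fraction field of `R`: the non-zero scalars of `R` act bijectively. -/
class IsUniquelyDivisible : Prop where
  smul_bijective (c : R) : c ≠ 0 → Function.Bijective fun v : V ↦ c • v

/-- A lattice in a vector space over the fraction field of `R`: it is finitely generated, and spans
the vector space. -/
structure IsFullLattice (L : Submodule R V) : Prop where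
  fg : L.FG
  exists_smul_mem (v : V) : ∃ c : R, c ≠ 0 ∧ c • v ∈ L

namespace IsFullLattice

variable {R V : Type*} [CommRing R] [AddCommGroup V] [Module R V] {L L' : Submodule R V}

/-- Multiplication by `c`. -/
noncomputable def smulEquiv [IsUniquelyDivisible R V] (c : R) (hc : c ≠ 0) : V ≃ₗ[R] V :=
  LinearEquiv.ofBijective (LinearMap.lsmul R V c) (IsUniquelyDivisible.smul_bijective c hc)

lemma smulEquiv_apply [IsUniquelyDivisible R V] (c : R) (hc : c ≠ 0) (v : V) :
    smulEquiv c hc v = c • v := rfl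

lemma sup (hL : IsFullLattice L) (hL' : IsFullLattice L') : IsFullLattice (L ⊔ L') where
  fg := hL.fg.sup hL'.fg
  exists_smul_mem v := by
    obtain ⟨c, hc, h⟩ := hL.exists_smul_mem v
    exact ⟨c, hc, Submodule.mem_sup_left h⟩

/-- The preimage of a lattice under the multiplication by a non-zero scalar. -/
lemma comap [IsUniquelyDivisible R V] (hL : IsFullLattice L) (c : R)
    (hc : c ≠ 0) :
    IsFullLattice (L.comap (smulEquiv (V := V) c hc).toLinearMap) where
  fg := by
    rw [Submodule.comap_equiv_eq_map_symm]
    exact hL.fg.map _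
  exists_smul_mem v := by
    obtain ⟨a, ha, h⟩ := hL.exists_smul_mem v
    refine ⟨a, ha, ?_⟩
    change c • a • v ∈ L
    exact L.smul_mem _ h

variable [IsDomain R]

lemma exists_smul_le_of_fg (hL : L.FG) (hL' : ∀ v : V, ∃ c : R, c ≠ 0 ∧ c • v ∈ L') :
    ∃ c : R, c ≠ 0 ∧ ∀ v ∈ L, c • v ∈ L' := by
  obtain ⟨s, rfl⟩ := hL
  choose c hc hcL using hL'
  refine ⟨∏ v ∈ s, c v, Finset.prod_ne_zero_iff.2 fun v _ ↦ hc v, fun v hv ↦ ?_⟩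
  induction hv using Submodule.span_induction with
  | mem v hv =>
    classical
    rw [← Finset.prod_erase_mul s c hv, mul_smul]
    exact L'.smul_mem _ (hcL v)
  | zero => simp
  | add v w _ _ hv hw => rw [smul_add]; exact L'.add_mem hv hw
  | smul a v _ hv => rw [smul_comm]; exact L'.smul_mem _ hv

lemma exists_smul_le (hL : IsFullLattice L) (hL' : IsFullLattice L') :
    ∃ c : R, c ≠ 0 ∧ ∀ v ∈ L, c • v ∈ L' :=
  exists_smul_le_of_fg hL.fg hL'.exists_smul_mem

section

variable [IsUniquelyDivisible R V]

instance (L : Submodule R V) : Module.IsTorsionFree R L where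
  isSMulRegular r hr _ _ h := Subtype.ext
    ((IsUniquelyDivisible.smul_bijective r hr.ne_zero).1 (congrArg Subtype.val h))

lemma finrank_le (hL : IsFullLattice L) (hL' : IsFullLattice L') :
    Module.finrank R L ≤ Module.finrank R L' := by
  have : Module.Finite R L' := Module.Finite.of_fg hL'.fg
  obtain ⟨c, hc, h⟩ := hL.exists_smul_le hL'
  refine LinearMap.finrank_le_finrank_of_injective
    (f := ((LinearMap.lsmul R V c).comp L.subtype).codRestrict L' fun v ↦ h v v.2) fun v w e ↦ ?_
  exact Subtype.ext ((IsUniquelyDivisible.smul_bijective c hc).1 (congrArg Subtype.val e))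

end

/-- The image of a lattice under the multiplication by a non-zero scalar. -/
lemma map [IsUniquelyDivisible R V] (hL : IsFullLattice L) (c : R) (hc : c ≠ 0) :
    IsFullLattice (L.map (smulEquiv (V := V) c hc).toLinearMap) where
  fg := hL.fg.map _
  exists_smul_mem v := by
    obtain ⟨a, ha, h⟩ := hL.exists_smul_mem v
    exact ⟨c * a, mul_ne_zero hc ha, a • v, h, by simp [smulEquiv_apply, smul_smul, mul_comm]⟩

variable [IsPrincipalIdealRing R]

lemma of_le (hL' : IsFullLattice L') (hle : L ≤ L')
    (h : ∀ v : V, ∃ c : R, c ≠ 0 ∧ c • v ∈ L) : IsFullLattice L where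
  fg := hL'.fg.of_le hle
  exists_smul_mem := h

lemma inf (hL : IsFullLattice L) (hL' : IsFullLattice L') : IsFullLattice (L ⊓ L') :=
  hL.of_le inf_le_left fun v ↦ by
    obtain ⟨c, hc, h⟩ := hL.exists_smul_mem v
    obtain ⟨c', hc', h'⟩ := hL'.exists_smul_mem v
    refine ⟨c' * c, mul_ne_zero hc' hc, ?_, ?_⟩
    · rw [mul_smul]
      exact L.smul_mem _ h
    · rw [mul_comm, mul_smul]
      exact L'.smul_mem _ h'

variable [IsUniquelyDivisible R V]

lemma free (hL : IsFullLattice L) : Module.Free R L :=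
  have : Module.Finite R L := Module.Finite.of_fg hL.fg
  Module.free_of_finite_type_torsion_free'

/-- All lattices are free of the same rank. -/
lemma nonempty_linearEquiv {n : ℕ} (hL : IsFullLattice L) (e : (Fin n → R) ≃ₗ[R] L)
    (hL' : IsFullLattice L') : Nonempty ((Fin n → R) ≃ₗ[R] L') := by
  have := hL'.free
  have : Module.Finite R L' := Module.Finite.of_fg hL'.fg
  refine ⟨LinearEquiv.ofFinrankEq _ _ ?_⟩
  rw [e.finrank_eq]
  exact (hL.finrank_le hL').antisymm (hL'.finrank_le hL)

variable [IsLocalRing R] {n : ℕ} {Q N : Type*} [AddCommGroup Q] [Module R Q] [AddCommGroup N]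
  [Module R N]

/-- A surjection of a lattice onto a quotient of `N` lifts to a surjection onto `N`, if `N` has as
many generators as the lattice has. -/
lemma exists_lift (hL : IsFullLattice L) (e : (Fin n → R) ≃ₗ[R] L) (hL' : IsFullLattice L')
    (σ : L' →ₗ[R] Q) (hσ : Function.Surjective σ) (π : (Fin n → R) →ₗ[R] N)
    (hπ : Function.Surjective π) (q : N →ₗ[R] Q) (hq : Function.Surjective q) :
    ∃ s : L' →ₗ[R] N, Function.Surjective s ∧ ∀ v, q (s v) = σ v := by
  obtain ⟨e'⟩ := hL.nonempty_linearEquiv e hL'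
  obtain ⟨g, hg⟩ := IsLocalRing.exists_linearEquiv_comp_eq (σ ∘ₗ e'.toLinearMap) (q ∘ₗ π)
    (hq.comp hπ) (hσ.comp e'.surjective)
  refine ⟨π ∘ₗ (e'.symm ≪≫ₗ g).toLinearMap, hπ.comp (e'.symm ≪≫ₗ g).surjective, fun v ↦ ?_⟩
  simpa using hg (e'.symm v)

/-- A torsion module `N` that contains a quotient of a lattice is a quotient of a larger lattice,
if `N` has as many generators as the lattice has: the preimage `M` of the quotient in the free
module `F` that covers `N` is isomorphic to the lattice over the quotient, and the isomorphism
extends to `F` after inverting the scalars. -/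
lemma exists_extension (hL : IsFullLattice L) (e : (Fin n → R) ≃ₗ[R] L) (hL' : IsFullLattice L')
    (σ : L' →ₗ[R] Q) (hσ : Function.Surjective σ) (π : (Fin n → R) →ₗ[R] N)
    (hπ : Function.Surjective π) (i : Q →ₗ[R] N) (hi : Function.Injective i)
    {c : R} (hc : c ≠ 0) (hN : ∀ t : N, c • t = 0) :
    ∃ (L'' : Submodule R V) (h : L' ≤ L'') (τ : L'' →ₗ[R] N), L''.FG ∧ Function.Surjective τ ∧
      (∀ v, τ v = 0 → (v : V) ∈ L') ∧ ∀ v, τ (Submodule.inclusion h v) = i (σ v) := by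
  -- `M` is isomorphic to a sublattice of `L`, hence is free of rank `n`
  let emb : (Fin n → R) →ₗ[R] V := L.subtype ∘ₗ e.toLinearMap
  have hemb : Function.Injective emb := Subtype.val_injective.comp e.injective
  let M : Submodule R (Fin n → R) := (LinearMap.range i).comap π
  have hcM (v : Fin n → R) : c • v ∈ M := ⟨0, by rw [map_zero, map_smul, hN]⟩
  have hM : IsFullLattice (M.map emb) := by
    refine hL.of_le ?_ fun v ↦ ?_
    · rintro _ ⟨x, -, rfl⟩
      exact (e x).2
    · obtain ⟨a, ha, h⟩ := hL.exists_smul_mem v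
      refine ⟨c * a, mul_ne_zero hc ha, c • e.symm ⟨a • v, h⟩, hcM _, ?_⟩
      rw [map_smul, mul_smul]
      simp [emb]
  let eM : M ≃ₗ[R] M.map emb := M.equivMapOfInjective emb hemb
  let iQ : Q ≃ₗ[R] LinearMap.range i := LinearEquiv.ofInjective i hi
  let σM : M →ₗ[R] Q := iQ.symm.toLinearMap ∘ₗ (π ∘ₗ M.subtype).codRestrict _ fun m ↦ m.2
  have hσM (m : M) : i (σM m) = π m := congrArg Subtype.val (iQ.apply_symm_apply ⟨π m, m.2⟩)
  have hσM' : Function.Surjective σM := fun t ↦ by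
    obtain ⟨v, hv⟩ := hπ (i t)
    exact ⟨⟨v, t, hv.symm⟩, hi ((hσM _).trans hv)⟩
  obtain ⟨e₁⟩ := hL.nonempty_linearEquiv e hM
  obtain ⟨e₂⟩ := hL.nonempty_linearEquiv e hL'
  obtain ⟨g₀, hg₀⟩ := IsLocalRing.exists_linearEquiv_comp_eq
    (σM ∘ₗ (e₁ ≪≫ₗ eM.symm).toLinearMap) (σ ∘ₗ e₂.toLinearMap)
    (hσ.comp e₂.surjective) (hσM'.comp (e₁ ≪≫ₗ eM.symm).surjective)
  -- an isomorphism over `Q`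
  let g : M ≃ₗ[R] L' := eM ≪≫ₗ e₁.symm ≪≫ₗ g₀ ≪≫ₗ e₂
  have hg (m : M) : σ (g m) = σM m := by simpa [g] using hg₀ (e₁.symm (eM m))
  -- the extension of `g` to the free module: `G v = c⁻¹ g (c v)`
  let G : (Fin n → R) →ₗ[R] V := (smulEquiv c hc).symm.toLinearMap ∘ₗ L'.subtype ∘ₗ
    g.toLinearMap ∘ₗ (LinearMap.lsmul R (Fin n → R) c).codRestrict M hcM
  have hGc (v : Fin n → R) : c • G v = g ⟨c • v, hcM v⟩ :=
    (smulEquiv (V := V) c hc).apply_symm_apply _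
  have hcinj := (IsUniquelyDivisible.smul_bijective (V := V) c hc).1
  have hG : Function.Injective G := fun v w h ↦ by
    have h1 := congrArg Subtype.val (g.injective (Subtype.ext ((hGc v).symm.trans
      ((congrArg (c • ·) h).trans (hGc w)))))
    exact smul_right_injective _ hc h1
  have hGg (m : M) : G m = g m := hcinj <| by
    refine (hGc m).trans ?_
    have : (⟨c • (m : Fin n → R), hcM m⟩ : M) = c • m := rfl
    rw [this, map_smul]
    rfl
  have hle : L' ≤ LinearMap.range G := fun v hv ↦ by
    obtain ⟨m, hm⟩ := g.surjective ⟨v, hv⟩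
    exact ⟨m, (hGg m).trans (congrArg Subtype.val hm)⟩
  refine ⟨LinearMap.range G, hle, π ∘ₗ (LinearEquiv.ofInjective G hG).symm.toLinearMap,
    ?_, hπ.comp (LinearEquiv.ofInjective G hG).symm.surjective, fun v hv ↦ ?_,
    fun v ↦ ?_⟩
  · rw [LinearMap.range_eq_map]
    exact Module.Finite.fg_top.map G
  · obtain ⟨x, rfl⟩ := (LinearEquiv.ofInjective G hG).surjective v
    rw [LinearMap.comp_apply, LinearEquiv.coe_coe, LinearEquiv.symm_apply_apply] at hv
    have := hGg ⟨x, 0, (map_zero i).trans hv.symm⟩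
    rw [LinearEquiv.ofInjective_apply, this]
    exact (g _).2
  · obtain ⟨m, rfl⟩ := g.surjective v
    have : Submodule.inclusion hle (g m) = LinearEquiv.ofInjective G hG m :=
      Subtype.ext (hGg m).symm
    rw [this, LinearMap.comp_apply, LinearEquiv.coe_coe, LinearEquiv.symm_apply_apply, hg, hσM]

end IsFullLattice

end FullLattice

/-! ### The stalks of the standard lattice -/

namespace FiniteLengthModules

open AlgebraicGeometry Scheme.Modules TopologicalSpace IsRegularCurve

variable (X : Scheme.{u}) [IsRegularCurve X]

/-- The stalk of `V` at `x` is its stalk at a generic point, where non-zero elements of `𝒪_x` are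
invertible. -/
instance (d : ℕ) (x : X) : IsUniquelyDivisible (X.presheaf.stalk x) ((ratSpace X d).Stalk x) where
  smul_bijective c hc := by
    obtain ⟨η, hη, h⟩ := exists_genericPoint_specializes x
    have hc' : X.presheaf.stalkSpecializes h c ≠ 0 := fun e ↦
      hc (stalkSpecializes_injective h (e.trans (map_zero _).symm))
    obtain ⟨b, hb⟩ := (isField_stalk hη).mul_inv_cancel hc'
    have hbij := specMap_ratSpace_bijective (d := d) hη h
    constructor
    · intro v w e
      apply hbij.1
      have e' := congrArg (fun t ↦ b • specMap (ratSpace X d) h t) e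
      simpa only [specMap_smul, smul_smul, mul_comm b, hb, one_smul] using e'
    · intro v
      obtain ⟨w, hw⟩ := hbij.2 (b • specMap (ratSpace X d) h v)
      refine ⟨w, hbij.1 ?_⟩
      change specMap (ratSpace X d) h (c • w) = _
      rw [specMap_smul, hw, smul_smul, hb, one_smul]

variable {X} in
lemma isFullLattice_stdLattice {d : ℕ} (x : X) : IsFullLattice (stalkSub (stdLattice X d) x) where
  fg := by
    have : Module.Finite (X.presheaf.stalk x) (stalkSub (stdLattice X d) x) :=
      Module.Finite.equiv (stdStalkEquiv X d x)
    exact Module.Finite.iff_fg.1 this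
  exists_smul_mem v := by
    obtain ⟨η, hη, h⟩ := exists_genericPoint_specializes x
    obtain ⟨t, ht⟩ := (stalkMap_stdMap_bijective hη).2 (specMap (ratSpace X d) h v)
    choose a c hc hca using fun i ↦
      exists_stalkSpecializes_mul_eq h (freeStalkEquiv X d η t i)
    -- the coordinates over the common denominator `∏ i, c i`
    let a' (i : Fin d) : X.presheaf.stalk x := a i * ∏ j ∈ Finset.univ.erase i, c j
    refine ⟨∏ i, c i, Finset.prod_ne_zero_iff.2 fun i _ ↦ hc i, ?_⟩
    rw [stalkSub_stdLattice]
    refine ⟨(freeStalkEquiv X d x).symm a', (specMap_ratSpace_bijective hη h).1 ?_⟩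
    rw [specMap_stalkMap, specMap_smul, ← ht, ← LinearMap.map_smul]
    congr 1
    apply (freeStalkEquiv X d η).injective
    ext i
    rw [freeStalkEquiv_specMap, LinearEquiv.apply_symm_apply, LinearEquiv.map_smul, Pi.smul_apply, smul_eq_mul,
      ← Finset.mul_prod_erase _ c (Finset.mem_univ i), map_mul, map_mul, ← hca]
    ring

variable {X} in
/-- The local ring at a generic point is a field, so that there is only one lattice. -/
lemma eq_top_of_isFullLattice {d : ℕ} {η : X} (hη : η ∈ genericPoints X)
    {L : Submodule (X.presheaf.stalk η) ((ratSpace X d).Stalk η)} (hL : IsFullLattice L) :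
    L = ⊤ := by
  rw [eq_top_iff]
  intro v _
  obtain ⟨c, hc, h⟩ := hL.exists_smul_mem v
  obtain ⟨b, hb⟩ := (isField_stalk hη).mul_inv_cancel hc
  rw [← one_smul (X.presheaf.stalk η) v, ← hb, mul_comm, mul_smul]
  exact L.smul_mem _ h

end FiniteLengthModules

/-! ### Local bases -/

namespace AlgebraicGeometry.Scheme.Modules

open TopologicalSpace Opposite

section Restrict

variable {X Y : Scheme.{u}} (f : X ⟶ Y) [IsOpenImmersion f] (M : Y.Modules)

/-- The stalk of the restriction of a module along an open immersion. -/
noncomputable def restrictStalkEquiv (x : X) : (M.restrict f).Stalk x ≃+ M.Stalk (f x) :=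
  ((restrictStalkNatIso f x).app M).addCommGroupIsoToAddEquiv

variable {M}

lemma restrictStalkEquiv_germ {U : X.Opens} {x : X} (hx : x ∈ U) (s : Γ(M, f ''ᵁ U)) :
    restrictStalkEquiv f M x ((M.restrict f).germ U x hx s) =
      M.germ (f ''ᵁ U) (f x) ⟨x, hx, rfl⟩ s :=
  congr($(germ_restrictStalkNatIso_hom_app f x M hx) s)

lemma restrictStalkEquiv_smul (x : X) (a : Y.presheaf.stalk (f x)) (t : (M.restrict f).Stalk x) :
    restrictStalkEquiv f M x (f.stalkMap x a • t) = a • restrictStalkEquiv f M x t := by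
  obtain ⟨V, hV, r, rfl⟩ := Y.presheaf.exists_germ_eq a
  obtain ⟨W, hWV, hW, s, rfl⟩ := exists_le_germ t (U := f ⁻¹ᵁ V) hV
  have hle : f ''ᵁ W ≤ V := (f.image_mono hWV).trans (f.image_preimage_le V)
  have e : f.stalkMap x (Y.presheaf.germ V (f x) hV r) =
      X.presheaf.germ W x hW ((f.appIso W).hom (Y.presheaf.map (homOfLE hle).op r)) := by
    have h1 := Scheme.Hom.germ_stalkMap_apply f V x hV r
    refine h1.trans ?_
    rw [← X.presheaf.germ_res_apply (homOfLE hWV) x hW]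
    congr 1
    have h2 := f.map_appLE (f.preimage_image_eq W).ge (homOfLE hle).op
    rw [Scheme.Hom.appIso_hom']
    refine Eq.trans ?_ (congr($h2 r)).symm
    rw [Scheme.Hom.appLE]
    rfl
  rw [e, ← germ_smul]
  refine (restrictStalkEquiv_germ f hW _).trans ?_
  let s' : Γ(M, f ''ᵁ W) := s
  have hfx : f x ∈ f ''ᵁ W := ⟨x, hW, rfl⟩
  have h1 : (f.appIso W).inv ((f.appIso W).hom (Y.presheaf.map (homOfLE hle).op r)) =
      Y.presheaf.map (homOfLE hle).op r := congr($((f.appIso W).hom_inv_id) _)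
  have h2 : M.germ (f ''ᵁ W) (f x) hfx (Y.presheaf.map (homOfLE hle).op r • s') =
      Y.presheaf.germ V (f x) hV r • M.germ (f ''ᵁ W) (f x) hfx s' := by
    rw [germ_smul, Y.presheaf.germ_res_apply]
  refine Eq.trans ?_ (h2.trans ?_)
  · exact congrArg (fun r : Γ(Y, f ''ᵁ W) ↦ M.germ (f ''ᵁ W) (f x) hfx (r • s')) h1
  · exact congrArg (Y.presheaf.germ V (f x) hV r • ·) (restrictStalkEquiv_germ f hW s).symm

end Restrict

variable {X : Scheme.{u}} {M N : X.Modules}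

/-- The sections `s` freely generate the stalks of `M` over `U`. -/
def IsLocalBasis {U : X.Opens} {n : ℕ} (s : Fin n → Γ(M, U)) : Prop :=
  ∀ (x : X) (hx : x ∈ U), Function.Bijective
    (Fintype.linearCombination (X.presheaf.stalk x) fun i ↦ M.germ U x hx (s i))

variable (M) in
/-- In a neighbourhood of every point, finitely many sections generate all the stalks. -/
def IsLocallyFG : Prop := ∀ x : X, ∃ (U : X.Opens) (_ : x ∈ U) (n : ℕ) (s : Fin n → Γ(M, U)),
  ∀ (y : X) (hy : y ∈ U), Function.Surjective
    (Fintype.linearCombination (X.presheaf.stalk y) fun i ↦ M.germ U y hy (s i))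

open FiniteLengthModules

/-- The morphism `𝒪_X ⟶ M` given by a section. -/
noncomputable def homOfSection (s : Γ(M, ⊤)) : structureModule X ⟶ M :=
  homOfSections (fun U ↦ (LinearMap.toSpanSingleton Γ(X, U) Γ(M, U)
    (M.presheaf.map (homOfLE le_top : U ⟶ ⊤).op s) : Γ(X, U) →ₗ[Γ(X, U)] Γ(M, U))) (by
      intro U V i r
      refine Eq.trans ?_ (map_smul M i r _).symm
      rw [← ConcreteCategory.comp_apply, ← M.presheaf.map_comp, ← op_comp]
      rfl)

lemma stalkMap_homOfSection (s : Γ(M, ⊤)) (x : X) :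
    stalkMap (homOfSection s) x (unitGerm X x) = M.germ ⊤ x trivial s := by
  refine (stalkMap_germ _ _ _).trans ?_
  refine congrArg (M.germ ⊤ x trivial) ?_
  change (1 : Γ(X, ⊤)) • M.presheaf.map (homOfLE le_top : (⊤ : X.Opens) ⟶ ⊤).op s = s
  rw [one_smul]
  exact congr($(M.presheaf.map_id _) s)

/-- The morphism `𝒪_X^{⊕ n} ⟶ M` given by `n` sections. -/
noncomputable def freeHom {n : ℕ} (s : Fin n → Γ(M, ⊤)) : freeModule X n ⟶ M :=
  biproduct.desc fun i ↦ homOfSection (s i)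

lemma stalkMap_freeHom {n : ℕ} (s : Fin n → Γ(M, ⊤)) (x : X) :
    stalkMap (freeHom s) x ∘ₗ (freeStalkEquiv X n x).symm.toLinearMap =
      Fintype.linearCombination (X.presheaf.stalk x) fun i ↦ M.germ ⊤ x trivial (s i) := by
  refine (Pi.basisFun _ _).ext fun i ↦ ?_
  rw [Pi.basisFun_apply, Fintype.linearCombination_apply_single, one_smul, LinearMap.comp_apply,
    LinearEquiv.coe_coe, ← germ_stdSection X n i ⊤ trivial]
  refine Eq.trans ?_ (stalkMap_homOfSection (s i) x)
  have e : biproduct.ι (fun _ : Fin n ↦ structureModule X) i ≫ freeHom s = homOfSection (s i) :=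
    biproduct.ι_desc _ _
  rw [← e, stalkMap_comp_apply]
  congr 1
  rw [← germ_unitSection X (U := ⊤) trivial]
  exact (stalkMap_germ _ _ (unitSection X ⊤)).symm

lemma isIso_freeHom {n : ℕ} (s : Fin n → Γ(M, ⊤)) (hs : IsLocalBasis s) : IsIso (freeHom s) := by
  refine isIso_of_stalkMap_bijective fun x ↦ ?_
  have h := hs x trivial
  rw [← stalkMap_freeHom] at h
  exact (Function.Bijective.of_comp_iff _ (freeStalkEquiv X n x).symm.bijective).1 h

variable (X) in
/-- The free `𝒪_X`-module on a set. -/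
noncomputable def freeOn (I : Type u) : X.Modules := ∐ fun _ : I ↦ structureModule X

variable (X) in
/-- The module `𝒪_X^{⊕ n}` as a coproduct. -/
noncomputable def freeModuleIso (n : ℕ) : freeModule X n ≅ freeOn X (ULift.{u} (Fin n)) :=
  biproduct.isoCoproduct _ ≪≫
    Sigma.whiskerEquiv (f := fun _ : Fin n ↦ structureModule X)
      (g := fun _ : ULift.{u} (Fin n) ↦ structureModule X) Equiv.ulift.symm fun _ ↦ Iso.refl _

section Sections

variable {U : X.Opens} {n : ℕ}

/-- The restriction of a section over `U` to the open subscheme `U`. -/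
noncomputable def restrictSection (s : Γ(M, U)) : Γ(M.restrict U.ι, ⊤) :=
  M.presheaf.map (homOfLE (by simp) : U.ι ''ᵁ ⊤ ⟶ U).op s

lemma restrictStalkEquiv_restrictSection (s : Γ(M, U)) (y : U.toScheme) :
    restrictStalkEquiv U.ι M y ((M.restrict U.ι).germ ⊤ y trivial (restrictSection s)) =
      M.germ U (U.ι y) y.2 s :=
  (restrictStalkEquiv_germ U.ι (U := ⊤) trivial _).trans (germ_res _ _ _)

lemma linearCombination_restrict (M : X.Modules) (y : U.toScheme)
    (s : Fin n → (M.restrict U.ι).Stalk y) (a : Fin n → X.presheaf.stalk (U.ι y)) :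
    restrictStalkEquiv U.ι M y (Fintype.linearCombination _ s fun i ↦ U.ι.stalkMap y (a i)) =
      Fintype.linearCombination _ (fun i ↦ restrictStalkEquiv U.ι M y (s i)) a := by
  rw [Fintype.linearCombination_apply, Fintype.linearCombination_apply, map_sum]
  exact Finset.sum_congr rfl fun i _ ↦ restrictStalkEquiv_smul _ _ _ _

lemma stalkMap_ι_bijective (y : U.toScheme) :
    Function.Bijective fun a : Fin n → X.presheaf.stalk (U.ι y) ↦
      fun i ↦ U.ι.stalkMap y (a i) :=
  (Equiv.piCongrRight fun _ ↦ Equiv.ofBijective _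
    (ConcreteCategory.bijective_of_isIso (U.ι.stalkMap y))).bijective

lemma IsLocalBasis.restrict {s : Fin n → Γ(M, U)} (hs : IsLocalBasis s) :
    IsLocalBasis fun i ↦ restrictSection (s i) := by
  intro y _
  have h := hs (U.ι y) y.2
  have e : ⇑(Fintype.linearCombination (X.presheaf.stalk (U.ι y)) fun i ↦ M.germ U (U.ι y) y.2 (s i)) =
      restrictStalkEquiv U.ι M y ∘ (Fintype.linearCombination (U.toScheme.presheaf.stalk y) fun i ↦
        (M.restrict U.ι).germ ⊤ y trivial (restrictSection (s i))) ∘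
        fun a : Fin n → X.presheaf.stalk (U.ι y) ↦ fun i ↦ U.ι.stalkMap y (a i) := by
    funext a
    refine Eq.trans ?_ (linearCombination_restrict M y _ a).symm
    simp only [restrictStalkEquiv_restrictSection]
  rw [e] at h
  exact (Function.Bijective.of_comp_iff _ (stalkMap_ι_bijective y)).1
    ((Function.Bijective.of_comp_iff' (restrictStalkEquiv U.ι M y).bijective _).1 h)

/-- A local basis trivializes the restriction to `U`. -/
lemma IsLocalBasis.nonempty_iso {s : Fin n → Γ(M, U)} (hs : IsLocalBasis s) :
    Nonempty (freeOn U (ULift.{u} (Fin n)) ≅ M.restrict U.ι) := by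
  exact ⟨(freeModuleIso U n).symm ≪≫
    @asIso _ _ _ _ (freeHom fun i ↦ restrictSection (s i)) (isIso_freeHom _ hs.restrict)⟩

end Sections

end AlgebraicGeometry.Scheme.Modules

/-! ### Finite presentation and finite type -/

namespace AlgebraicGeometry.Scheme.Modules

open TopologicalSpace Opposite FiniteLengthModules

variable {X : Scheme.{u}} {M N : X.Modules}

section Presentation

/-- A cokernel of a morphism between free modules of finite rank has a finite presentation. -/
lemma exists_presentation {I J : Type u} [Finite I] [Finite J] (f : freeOn X J ⟶ freeOn X I)
    (g : freeOn X I ⟶ M) (hw : f ≫ g = 0) (h : IsColimit (CokernelCofork.ofπ g hw)) :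
    ∃ P : SheafOfModules.Presentation (R := X.ringCatSheaf) M, P.IsFinite := by
  let P : SheafOfModules.Presentation (R := X.ringCatSheaf) M :=
    SheafOfModules.presentationOfIsCokernelFree (R := X.ringCatSheaf) (ι := J) (σ := I) f g hw h
  refine ⟨P, ⟨?_⟩, ⟨?_⟩⟩
  · exact ‹Finite I›
  · exact ‹Finite J›

/-- The `𝒪_U`-modules as modules over the site of the opens over `U`. -/
noncomputable def toOver (U : X.Opens) : SheafOfModules.{u} U.toScheme.ringCatSheaf ⥤
    SheafOfModules.{u} (X.ringCatSheaf.over U) := (overEquiv U).inverse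

instance (U : X.Opens) : PreservesColimitsOfSize.{u, u} (toOver U) :=
  (overEquiv U).symm.toAdjunction.leftAdjoint_preservesColimits

/-- The modules over the site of the opens over `U` as `𝒪_U`-modules. -/
noncomputable def ofOver (U : X.Opens) : SheafOfModules.{u} (X.ringCatSheaf.over U) ⥤
    SheafOfModules.{u} U.toScheme.ringCatSheaf := (overEquiv U).functor

instance (U : X.Opens) : PreservesColimitsOfSize.{u, u} (ofOver U) :=
  (overEquiv U).toAdjunction.leftAdjoint_preservesColimits

/-- `ofOver` sends the structure sheaf to the structure sheaf. -/
noncomputable def ofOverUnitIso (U : X.Opens) : SheafOfModules.unit U.toScheme.ringCatSheaf ≅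
    (ofOver U).obj (SheafOfModules.unit (X.ringCatSheaf.over U)) :=
  ((overFunctorEquiv U).app (structureModule X) ≪≫ restrictUnitIso U.ι).symm

/-- `toOver` sends the structure sheaf to the structure sheaf. -/
noncomputable def toOverUnitIso (U : X.Opens) : SheafOfModules.unit (X.ringCatSheaf.over U) ≅
    (toOver U).obj (SheafOfModules.unit U.toScheme.ringCatSheaf) :=
  (overEquiv U).unitIso.app _ ≪≫ (toOver U).mapIso (ofOverUnitIso U).symm

/-- The module over the site over `U` that corresponds to the restriction to the scheme `U`. -/
noncomputable def toOverIso (U : X.Opens) (M : X.Modules) :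
    (toOver U).obj (M.restrict U.ι) ≅ SheafOfModules.over (R := X.ringCatSheaf) M U :=
  (overEquiv U).inverse.mapIso ((overFunctorEquiv U).app M).symm ≪≫
    ((overEquiv U).unitIso.app _).symm

lemma exists_presentation_over {U : X.Opens}
    (P : SheafOfModules.Presentation (R := U.toScheme.ringCatSheaf) (M.restrict U.ι))
    (hP : P.IsFinite) :
    ∃ P : (SheafOfModules.over (R := X.ringCatSheaf) M U).Presentation, P.IsFinite := by
  have h₁ : Finite P.generators.I := hP.isFiniteType_generators.finite
  have h₂ : Finite P.relations.I := hP.isFiniteType_relations.finite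
  refine ⟨SheafOfModules.Presentation.ofIsIso (toOverIso U M).hom
      (P.map (toOver U) (toOverUnitIso U)), ⟨h₁⟩, ⟨h₂⟩⟩

/-- Finite presentations of the restrictions to the members of an open cover define a finite
presentation of the module. -/
lemma isFinitePresentation_of_restrict (U : X → X.Opens) (hU : ∀ x, x ∈ U x)
    (P : ∀ x, SheafOfModules.Presentation (R := (U x).toScheme.ringCatSheaf) (M.restrict (U x).ι))
    (hP : ∀ x, (P x).IsFinite) :
    SheafOfModules.IsFinitePresentation (R := X.ringCatSheaf) M := by
  choose P' hP' using fun x ↦ exists_presentation_over (P x) (hP x)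
  have hcov : IsOpenCover U := by
    rw [IsOpenCover, eq_top_iff]
    exact fun x _ ↦ Opens.mem_iSup.2 ⟨x, hU x⟩
  let σ : SheafOfModules.QuasicoherentData.{u} (R := X.ringCatSheaf) M :=
    { I := X
      X := U
      coversTop := (Opens.coversTop_iff _ U).2 hcov
      presentation := P' }
  have hσ : σ.IsFinitePresentation :=
    SheafOfModules.QuasicoherentData.IsFinitePresentation.mk.{u, u, u, u} hP'
  exact SheafOfModules.IsFinitePresentation.mk.{u, u, u} ⟨σ, hσ⟩

/-- The cokernel of a morphism between locally free modules of finite rank. -/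
lemma isFinitePresentation_cokernel (f : M ⟶ N)
    (h : ∀ x : X, ∃ (U : X.Opens) (_ : x ∈ U) (m n : ℕ) (s : Fin m → Γ(M, U))
      (t : Fin n → Γ(N, U)), IsLocalBasis s ∧ IsLocalBasis t) :
    SheafOfModules.IsFinitePresentation (R := X.ringCatSheaf) (cokernel f) := by
  choose U hU m n s t hs ht using h
  have hP (x : X) : ∃ P : SheafOfModules.Presentation (R := (U x).toScheme.ringCatSheaf)
      ((cokernel f).restrict (U x).ι), P.IsFinite := by
    obtain ⟨e₁⟩ := (hs x).nonempty_iso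
    obtain ⟨e₂⟩ := (ht x).nonempty_iso
    -- the restriction to the open subscheme is exact
    let F := restrictFunctor (U x).ι
    have : F.PreservesZeroMorphisms := inferInstance
    have hS := (ShortComplex.exact_cokernel f).map_of_epi_of_preservesCokernel F inferInstance
      inferInstance
    have hw : (e₁.hom ≫ F.map f ≫ e₂.inv) ≫ e₂.hom ≫ F.map (cokernel.π f) = 0 := by
      simp only [Category.assoc, Iso.inv_hom_id_assoc, ← Functor.map_comp,
        cokernel.condition, Functor.map_zero, comp_zero]
    have hS' : (ShortComplex.mk _ _ hw).Exact := by
      refine ShortComplex.exact_of_iso ?_ hS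
      refine ShortComplex.isoMk e₁.symm e₂.symm (Iso.refl _) ?_ ?_
      · exact Iso.inv_hom_id_assoc e₁ (F.map f ≫ e₂.inv)
      · exact (Iso.inv_hom_id_assoc e₂ (F.map (cokernel.π f))).trans (Category.comp_id _).symm
    have : Epi (ShortComplex.mk _ _ hw).g := by
      change Epi (e₂.hom ≫ F.map (cokernel.π f))
      infer_instance
    exact exists_presentation _ _ hw hS'.gIsCokernel
  choose P hP' using hP
  exact isFinitePresentation_of_restrict U hU P hP'

/-- The generators of a module of finite type are morphisms from free modules over the sites of opens
contained in open sets; transferred to the open subschemes, they are sections. -/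
lemma isLocallyFG_of_isFiniteType
    (hM : SheafOfModules.IsFiniteType (R := X.ringCatSheaf) M) : M.IsLocallyFG := by
  intro x
  obtain ⟨σ, hσ⟩ := hM.exists_localGeneratorsData
  have hcov := (Opens.coversTop_iff _ σ.X).1 σ.coversTop
  obtain ⟨i, hi⟩ := Opens.mem_iSup.1 (hcov.iSup_eq_top ▸ Opens.mem_top x)
  let U : X.Opens := σ.X i
  let G := (σ.generators i).map (ofOver U) (ofOverUnitIso U)
  have : _root_.Finite G.I := (hσ.isFiniteType i).finite
  obtain ⟨n, ⟨e⟩⟩ := _root_.Finite.exists_equiv_fin G.I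
  obtain ⟨p, hp⟩ : ∃ p : freeModule U.toScheme n ⟶ M.restrict U.ι, Epi p := by
    let e' : freeOn U.toScheme (ULift.{u} (Fin n)) ≅ freeOn U.toScheme G.I :=
      Sigma.whiskerEquiv (f := fun _ : ULift.{u} (Fin n) ↦ structureModule U.toScheme)
        (g := fun _ : G.I ↦ structureModule U.toScheme) (Equiv.ulift.trans e.symm)
        fun _ ↦ Iso.refl _
    let T : U.toScheme.Modules := (ofOver U).obj (SheafOfModules.over (R := X.ringCatSheaf) M U)
    let π : freeOn U.toScheme G.I ⟶ T := G.π
    have : Epi π := G.epi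
    let p' : T ≅ M.restrict U.ι :=
      (overFunctorEquiv U).app M
    have h₀ : Epi p'.hom := IsIso.epi_of_iso _
    have h₁ : Epi (π ≫ p'.hom) := epi_comp _ _
    have h₂ : Epi (e'.hom ≫ π ≫ p'.hom) := epi_comp _ _
    exact ⟨(freeModuleIso U.toScheme n).hom ≫ e'.hom ≫ π ≫ p'.hom, epi_comp _ _⟩
  refine ⟨U.ι ''ᵁ ⊤, ⟨⟨x, hi⟩, trivial, rfl⟩, n, fun j ↦ p.app ⊤ (stdSection U.toScheme n j ⊤), ?_⟩
  rintro _ ⟨y, -, rfl⟩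
  intro t
  obtain ⟨v, hv⟩ := stalkMap_surjective_of_epi p y ((restrictStalkEquiv U.ι M y).symm t)
  obtain ⟨a, ha⟩ := (stalkMap_ι_bijective y).2 (freeStalkEquiv U.toScheme n y v)
  have h₁ (j : Fin n) : M.germ (U.ι ''ᵁ ⊤) (U.ι y) ⟨y, trivial, rfl⟩
      (p.app ⊤ (stdSection U.toScheme n j ⊤)) =
        restrictStalkEquiv U.ι M y (stalkMap p y ((freeStalkEquiv U.toScheme n y).symm
          (Pi.single j 1))) := by
    refine (restrictStalkEquiv_germ U.ι (U := ⊤) trivial _).symm.trans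
      (congrArg (restrictStalkEquiv U.ι M y) ?_)
    refine (stalkMap_germ p (U := ⊤) trivial _).symm.trans (congrArg (stalkMap p y) ?_)
    exact germ_stdSection U.toScheme n j ⊤ (x := y) trivial
  have h₂ := linearCombination_restrict M y (fun j ↦ stalkMap p y
    ((freeStalkEquiv U.toScheme n y).symm (Pi.single j 1))) a
  have h₃ : v = ∑ j, freeStalkEquiv U.toScheme n y v j •
      (freeStalkEquiv U.toScheme n y).symm (Pi.single j 1) := by
    apply (freeStalkEquiv U.toScheme n y).injective
    rw [map_sum]
    simp only [LinearEquiv.map_smul, LinearEquiv.apply_symm_apply]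
    exact pi_eq_sum_univ' _
  have h₄ : stalkMap p y v = Fintype.linearCombination _ (fun j ↦ stalkMap p y
      ((freeStalkEquiv U.toScheme n y).symm (Pi.single j 1))) (freeStalkEquiv U.toScheme n y v) := by
    conv_lhs => rw [h₃]
    rw [map_sum, Fintype.linearCombination_apply]
    exact Finset.sum_congr rfl fun j _ ↦ LinearMap.map_smul _ _ _
  refine ⟨a, Eq.trans (congrArg (fun g : Fin n → M.Stalk (U.ι y) ↦
    Fintype.linearCombination (X.presheaf.stalk (U.ι y)) g a) (funext h₁))
    (h₂.symm.trans ?_)⟩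
  refine (congrArg (restrictStalkEquiv U.ι M y) (Eq.trans (congrArg _ ha) (h₄.symm.trans hv))).trans ?_
  exact (restrictStalkEquiv U.ι M y).apply_symm_apply t

end Presentation
end AlgebraicGeometry.Scheme.Modules

/-! ### Open families on a regular curve -/

namespace AlgebraicGeometry.IsRegularCurve

open TopologicalSpace

variable {X : Scheme.{u}} [IsRegularCurve X]

/-- Every point has a neighbourhood which meets only one irreducible component. -/
lemma exists_opens_unique_genericPoint (x : X) : ∃ (U : X.Opens) (η : X), x ∈ U ∧
    η ∈ genericPoints X ∧ η ⤳ x ∧ ∀ ζ ∈ genericPoints X, ζ ∈ U → ζ = η := by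
  obtain ⟨η, hη, hx⟩ := exists_genericPoint_specializes x
  -- the complement of the other components
  let Z : Set X := ⋃ ζ ∈ genericPoints X \ {η}, closure {ζ}
  have hZ : IsClosed Z :=
    (finite_genericPoints.subset Set.sdiff_subset).isClosed_biUnion fun _ _ ↦ isClosed_closure
  refine ⟨⟨Zᶜ, hZ.isOpen_compl⟩, η, fun h ↦ ?_, hη, hx, fun ζ hζ h ↦ ?_⟩
  · obtain ⟨ζ, ⟨hζ, hne⟩, hxζ⟩ := Set.mem_iUnion₂.1 h
    exact hne (genericPoint_unique hζ hη (specializes_iff_mem_closure.2 hxζ) hx)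
  · by_contra hne
    exact h (Set.mem_iUnion₂.2 ⟨ζ, ⟨hζ, hne⟩, subset_closure rfl⟩)

/-- An open subset which contains the generic points of `U` contains almost all points of `U`. -/
lemma finite_diff {U W : X.Opens} (h : ∀ η ∈ genericPoints X, η ∈ U → η ∈ W) :
    ((U : Set X) \ W).Finite := by
  -- the open set `W ∪ Zᶜ` contains all generic points, and misses `U \ W`
  let Z : Set X := ⋃ ζ ∈ genericPoints X ∩ U, closure {ζ}
  have hZ : IsClosed Z :=
    (finite_genericPoints.subset Set.inter_subset_left).isClosed_biUnion fun _ _ ↦ isClosed_closure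
  have hG : genericPoints X ⊆ ((W ⊔ ⟨Zᶜ, hZ.isOpen_compl⟩ : X.Opens) : Set X) := by
    intro η hη
    by_cases hU : η ∈ U
    · exact Or.inl (h η hη hU)
    · refine Or.inr fun hZ ↦ ?_
      obtain ⟨ζ, ⟨hζ, hζU⟩, hηζ⟩ := Set.mem_iUnion₂.1 hZ
      exact hU (eq_of_specializes_genericPoint hη (specializes_iff_mem_closure.2 hηζ) ▸ hζU)
  refine (finite_compl_of_genericPoints_subset hG).subset ?_
  rintro y ⟨hyU, hyW⟩ (hy | hy)
  · exact hyW hy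
  · obtain ⟨η, hη, hηy⟩ := exists_genericPoint_specializes y
    exact hy (Set.mem_iUnion₂.2 ⟨η, ⟨hη, hηy.mem_open U.2 hyU⟩,
      specializes_iff_mem_closure.1 hηy⟩)

/-- Every point has a neighbourhood which avoids the other points of a finite set of closed
points. -/
lemma exists_opens_avoiding {F : Set X} (hF : F.Finite) (hg : ∀ x ∈ F, x ∉ genericPoints X)
    (x : X) : ∃ O : X.Opens, x ∈ O ∧ ∀ y ∈ O, y ≠ x → y ∉ F := by
  obtain ⟨O, hO⟩ := exists_opens_compl (hF.subset (Set.sdiff_subset (t := {x})))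
    fun y hy ↦ hg y hy.1
  have hO' (y : X) : y ∈ O ↔ y ∉ F \ {x} := by rw [← SetLike.mem_coe, hO, Set.mem_compl_iff]
  exact ⟨O, (hO' x).2 fun h ↦ h.2 rfl, fun y hy hyx hyF ↦ (hO' y).1 hy ⟨hyF, hyx⟩⟩

end AlgebraicGeometry.IsRegularCurve

namespace AlgebraicGeometry.Scheme.Modules

open TopologicalSpace

variable {X : Scheme.{u}} {M N : X.Modules}

/-- An open family contains the germs of finitely many sections at the points of an open set. -/
lemma IsOpenFamily.exists_opens {P : ∀ x, Submodule (X.presheaf.stalk x) (M.Stalk x)}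
    (hP : IsOpenFamily P) {U : X.Opens} {n : ℕ} (s : Fin n → Γ(M, U)) :
    ∃ W : X.Opens, ∀ y, y ∈ W ↔ ∃ hy : y ∈ U, ∀ i, M.germ U y hy (s i) ∈ P y := by
  refine ⟨⟨{y | ∃ hy : y ∈ U, ∀ i, M.germ U y hy (s i) ∈ P y}, isOpen_iff_mem_nhds.2 ?_⟩,
    fun y ↦ Iff.rfl⟩
  rintro y ⟨hy, h⟩
  have key (i : Fin n) : ∀ᶠ z in nhds y, ∃ hz : z ∈ U, M.germ U z hz (s i) ∈ P z := by
    obtain ⟨V, hV, t, ht, htP⟩ := hP y _ (h i)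
    obtain ⟨W, hW, hWV, hWU, e⟩ := germ_eq_nhds hV hy t (s i) ht
    refine Filter.mem_of_superset (W.2.mem_nhds hW) fun z hz ↦ ⟨hWU hz, ?_⟩
    rw [← e z hz]
    exact htP z (hWV hz)
  filter_upwards [Filter.eventually_all.2 key, U.2.mem_nhds hy] with z hz hzU
  exact ⟨hzU, fun i ↦ (hz i).2⟩

/-- The image of a locally finitely generated module is contained in an open family at almost all
points, if it is contained at the generic points. -/
lemma IsOpenFamily.finite_not_le [IsRegularCurve X] (φ : N ⟶ M) (hN : N.IsLocallyFG)
    {P : ∀ x, Submodule (X.presheaf.stalk x) (M.Stalk x)} (hP : IsOpenFamily P)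
    (h : ∀ η ∈ genericPoints X, LinearMap.range (stalkMap φ η) ≤ P η) :
    {x | ¬ LinearMap.range (stalkMap φ x) ≤ P x}.Finite := by
  choose U hU n s hs using hN
  choose W hW using fun x ↦ hP.exists_opens fun i ↦ φ.app (U x) (s x i)
  -- an open set containing the generic points, over which the image is contained in `P`
  let G : X.Opens := ⨆ x : X, W x
  have hG : genericPoints X ⊆ G := by
    intro η hη
    refine Opens.mem_iSup.2 ⟨η, (hW η η).2 ⟨hU η, fun i ↦ h η hη ⟨_, stalkMap_germ _ _ _⟩⟩⟩
  refine (IsRegularCurve.finite_compl_of_genericPoints_subset hG).subset fun x hx hxG ↦ hx ?_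
  obtain ⟨y, hy⟩ := Opens.mem_iSup.1 hxG
  obtain ⟨hxU, hx⟩ := (hW y x).1 hy
  rintro _ ⟨t, rfl⟩
  obtain ⟨a, rfl⟩ := hs y x hxU t
  rw [Fintype.linearCombination_apply, map_sum]
  refine Submodule.sum_mem _ fun i _ ↦ ?_
  rw [LinearMap.map_smul, stalkMap_germ]
  exact Submodule.smul_mem _ _ (hx i)

end AlgebraicGeometry.Scheme.Modules

namespace FiniteLengthModules

open AlgebraicGeometry Scheme.Modules TopologicalSpace IsRegularCurve

variable {X : Scheme.{u}}

section Pullback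

variable [IsRegularCurve X] {η : X} {M : X.Modules}

/-- The pull-back of `M` to a generic point is zero if and only if the stalk of `M` is zero: a
linear form on the stalk defines a morphism to the push-forward of the structure sheaf. -/
lemma isZero_pullback_iff (hη : η ∈ genericPoints X) :
    IsZero ((Scheme.Modules.pullback (X.fromSpecStalk η)).obj M) ↔ Subsingleton (M.Stalk η) := by
  classical
  let adj := Scheme.Modules.pullbackPushforwardAdjunction (X.fromSpecStalk η)
  constructor
  · intro h
    refine subsingleton_of_forall_eq 0 fun t ↦ ?_
    by_contra ht
    obtain ⟨f, hf⟩ : ∃ f : M.Stalk η →ₗ[X.presheaf.stalk η] X.presheaf.stalk η, f t ≠ 0 := by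
      let _ := (isField_stalk hη).toField
      exact Module.Projective.exists_dual_ne_zero (X.presheaf.stalk η) ht
    let e : X.presheaf.stalk η →ₗ[X.presheaf.stalk η] (stalkModule X η).Stalk η :=
      stalkMap (toStalkModule X η) η ∘ₗ (unitStalkEquiv X η).toLinearMap
    have he : Function.Injective e :=
      (stalkMap_toStalkModule_bijective hη).1.comp (unitStalkEquiv X η).injective
    -- the morphism given by `f` is zero by adjunction
    obtain ⟨φ, hφ⟩ := (isProductOfStalks_stalkModule hη).exists_hom
      (Function.update (0 : ∀ x, M.Stalk x →ₗ[X.presheaf.stalk x] (stalkModule X η).Stalk x) η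
        (e ∘ₗ f))
    have h0 : φ = 0 := (adj.homEquiv M _).symm.injective (h.eq_of_src _ _)
    have := hφ η rfl
    rw [Function.update_self, h0, stalkMap_zero] at this
    exact hf (he (congr($this t).symm.trans (map_zero e).symm))
  · intro h
    rw [IsZero.iff_id_eq_zero]
    apply (adj.homEquiv _ _).injective
    generalize (adj.homEquiv _ _) (𝟙 _) = φ
    generalize (adj.homEquiv _ _) 0 = ψ
    have key (φ : M ⟶ (Scheme.Modules.pushforward (X.fromSpecStalk η)).obj
      ((Scheme.Modules.pullback (X.fromSpecStalk η)).obj M)) : φ = 0 := by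
      ext U s
      refine (isProductOfStalks_pushforward hη _).ext U _ _ fun x hx hxη ↦ ?_
      obtain rfl : x = η := hxη
      rw [← stalkMap_germ, Subsingleton.elim (M.germ U x hx s) 0, map_zero]
      exact (map_zero _).symm
    rw [key φ, key ψ]

end Pullback

end FiniteLengthModules

/-! ### Lattices in terms of their stalks -/

namespace AlgebraicGeometry.Scheme.Modules

open TopologicalSpace

variable {X : Scheme.{u}} {M N : X.Modules}

lemma exists_le_germ_fin {n : ℕ} {x : X} {U : X.Opens} (hx : x ∈ U) (t : Fin n → M.Stalk x) :
    ∃ (V : X.Opens) (_ : V ≤ U) (hV : x ∈ V) (s : Fin n → Γ(M, V)),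
      ∀ i, M.germ V x hV (s i) = t i := by
  choose W hWU hW s hs using fun i ↦ exists_le_germ (t i) hx
  let V : X.Opens := ⟨U ∩ ⋂ i, W i, U.2.inter (isOpen_iInter_of_finite fun i ↦ (W i).2)⟩
  have hVW (i : Fin n) : V ≤ W i := fun y hy ↦ Set.mem_iInter.1 hy.2 i
  exact ⟨V, fun y hy ↦ hy.1, ⟨hx, Set.mem_iInter.2 hW⟩,
    fun i ↦ M.presheaf.map (homOfLE (hVW i)).op (s i), fun i ↦ (germ_res _ _ _).trans (hs i)⟩

/-- A linear relation between germs spreads to a neighbourhood. -/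
lemma exists_opens_mem_range {n m : ℕ} {U : X.Opens} (s : Fin n → Γ(M, U)) (t : Fin m → Γ(M, U)) :
    ∃ W : X.Opens, ∀ y, y ∈ W ↔ ∃ hy : y ∈ U, ∀ j, M.germ U y hy (t j) ∈
      LinearMap.range (Fintype.linearCombination (X.presheaf.stalk y)
        fun i ↦ M.germ U y hy (s i)) := by
  refine ⟨⟨{y | ∃ hy : y ∈ U, ∀ j, M.germ U y hy (t j) ∈
      LinearMap.range (Fintype.linearCombination (X.presheaf.stalk y)
        fun i ↦ M.germ U y hy (s i))}, isOpen_iff_mem_nhds.2 ?_⟩, fun y ↦ Iff.rfl⟩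
  rintro y ⟨hy, h⟩
  have key (j : Fin m) : ∀ᶠ z in nhds y, ∃ hz : z ∈ U, M.germ U z hz (t j) ∈
      LinearMap.range (Fintype.linearCombination (X.presheaf.stalk z)
        fun i ↦ M.germ U z hz (s i)) := by
    obtain ⟨a, ha⟩ := h j
    choose V hV r hr using fun i ↦ X.presheaf.exists_germ_eq (a i)
    let W : X.Opens := ⟨U ∩ ⋂ i, V i, U.2.inter (isOpen_iInter_of_finite fun i ↦ (V i).2)⟩
    have hWV (i : Fin n) : W ≤ V i := fun y hy ↦ Set.mem_iInter.1 hy.2 i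
    have hWU : W ≤ U := fun y hy ↦ hy.1
    have hyW : y ∈ W := ⟨hy, Set.mem_iInter.2 hV⟩
    let q : Γ(M, W) := ∑ i, X.presheaf.map (homOfLE (hWV i)).op (r i) •
      M.presheaf.map (homOfLE hWU).op (s i)
    have hq (z : X) (hz : z ∈ W) : M.germ W z hz q = Fintype.linearCombination
        (X.presheaf.stalk z) (fun i ↦ M.germ U z (hWU hz) (s i))
        fun i ↦ X.presheaf.germ (V i) z (hWV i hz) (r i) := by
      rw [map_sum, Fintype.linearCombination_apply]
      refine Finset.sum_congr rfl fun i _ ↦ ?_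
      rw [germ_smul, germ_res, TopCat.Presheaf.germ_res_apply]
    obtain ⟨O, hyO, hOW, hOU, e⟩ := germ_eq_nhds hyW hy q (t j) (by
      rw [hq, ← ha]
      congr 1
      exact funext hr)
    refine Filter.mem_of_superset (O.2.mem_nhds hyO) fun z hz ↦ ⟨hOU hz, ?_⟩
    rw [← e z hz, hq]
    exact ⟨_, rfl⟩
  filter_upwards [Filter.eventually_all.2 key, U.2.mem_nhds hy] with z hz hzU
  exact ⟨hzU, fun i ↦ (hz i).2⟩

lemma stalkMap_linearCombination (φ : M ⟶ N) {n : ℕ} {U : X.Opens} {x : X} (hx : x ∈ U)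
    (s : Fin n → Γ(M, U)) (a : Fin n → X.presheaf.stalk x) :
    stalkMap φ x (Fintype.linearCombination _ (fun i ↦ M.germ U x hx (s i)) a) =
      Fintype.linearCombination _ (fun i ↦ N.germ U x hx (φ.app U (s i))) a := by
  rw [Fintype.linearCombination_apply, Fintype.linearCombination_apply, map_sum]
  exact Finset.sum_congr rfl fun i _ ↦ by rw [LinearMap.map_smul, stalkMap_germ]

lemma specMap_linearCombination {n : ℕ} {U : X.Opens} {x y : X} (h : y ⤳ x) (hx : x ∈ U)
    (s : Fin n → Γ(M, U)) (a : Fin n → X.presheaf.stalk x) :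
    specMap M h (Fintype.linearCombination _ (fun i ↦ M.germ U x hx (s i)) a) =
      Fintype.linearCombination _ (fun i ↦ M.germ U y (h.mem_open U.2 hx) (s i))
        fun i ↦ X.presheaf.stalkSpecializes h (a i) := by
  rw [Fintype.linearCombination_apply, Fintype.linearCombination_apply, map_sum]
  exact Finset.sum_congr rfl fun i _ ↦ by rw [specMap_smul, specMap_germ]

/-- The stalk of a subobject is the stalk of the corresponding module. -/
noncomputable def stalkSubEquiv (L : Subobject M) (x : X) :
    (L : X.Modules).Stalk x ≃ₗ[X.presheaf.stalk x] stalkSub L x :=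
  LinearEquiv.ofInjective (stalkMap L.arrow x) (stalkMap_injective_of_mono L.arrow x)

end AlgebraicGeometry.Scheme.Modules

namespace FiniteLengthModules

open AlgebraicGeometry Scheme.Modules TopologicalSpace IsRegularCurve

variable {X : Scheme.{u}}

lemma isCoherent_of_isFinitePresentation {M N : X.Modules} (e : M ≅ N)
    (hM : SheafOfModules.IsFinitePresentation.{u} (R := X.ringCatSheaf) M) : IsCoherent N := by
  have hN : SheafOfModules.IsFinitePresentation.{u} (R := X.ringCatSheaf) N :=
    ObjectProperty.prop_of_iso (SheafOfModules.isFinitePresentation X.ringCatSheaf) e hM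
  have key (K : SheafOfModules.{u} X.ringCatSheaf) (hK : K.IsFinitePresentation) :
      K.IsQuasicoherent ∧ K.IsFiniteType := ⟨inferInstance, inferInstance⟩
  exact ⟨(key N hN).1, (key N hN).2⟩

variable (X) in
lemma isLocalBasis_stdSection (d : ℕ) (U : X.Opens) :
    IsLocalBasis fun i ↦ stdSection X d i U := by
  intro x hx
  have : Fintype.linearCombination (X.presheaf.stalk x)
      (fun i ↦ (freeModule X d).germ U x hx (stdSection X d i U)) =
        (freeStalkEquiv X d x).symm.toLinearMap := by
    refine (Pi.basisFun _ _).ext fun i ↦ ?_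
    rw [Pi.basisFun_apply, Fintype.linearCombination_apply_single, one_smul, germ_stdSection]
    rfl
  rw [this]
  exact (freeStalkEquiv X d x).symm.bijective

lemma isLocallyFG_freeModule (d : ℕ) : (freeModule X d).IsLocallyFG := fun _ ↦
  ⟨⊤, trivial, d, _, fun y hy ↦ (isLocalBasis_stdSection X d ⊤ y hy).2⟩

variable [IsRegularCurve X] {d : ℕ}

/-- The stalks of a lattice: full lattices, almost all of which are the standard one. -/
structure IsLatticeFamily
    (P : ∀ x : X, Submodule (X.presheaf.stalk x) ((ratSpace X d).Stalk x)) : Prop where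
  isFullLattice (x : X) : IsFullLattice (P x)
  finite : {x | P x ≠ stalkSub (stdLattice X d) x}.Finite

lemma IsLatticeFamily.eq_top {P : ∀ x : X, Submodule (X.presheaf.stalk x) ((ratSpace X d).Stalk x)}
    (hP : IsLatticeFamily P) {η : X} (hη : η ∈ genericPoints X) : P η = ⊤ :=
  eq_top_of_isFullLattice hη (hP.isFullLattice η)

/-- An element of the stalk at a generic point, expressed by germs of sections, becomes an element
of the stalk at `x` after multiplication with a denominator. -/
lemma exists_smul_eq_linearCombination {n : ℕ} {x η : X} (hη : η ∈ genericPoints X) (h : η ⤳ x)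
    (v : (ratSpace X d).Stalk x) (s : Fin n → (ratSpace X d).Stalk x)
    (hv : specMap _ h v ∈ LinearMap.range (Fintype.linearCombination (X.presheaf.stalk η)
      fun i ↦ specMap _ h (s i))) : ∃ c : X.presheaf.stalk x, c ≠ 0 ∧
    c • v ∈ LinearMap.range (Fintype.linearCombination (X.presheaf.stalk x) s) := by
  obtain ⟨t, ht⟩ := hv
  choose a c hc hca using fun i ↦ exists_stalkSpecializes_mul_eq h (t i)
  let a' (i : Fin n) : X.presheaf.stalk x := a i * ∏ j ∈ Finset.univ.erase i, c j
  refine ⟨∏ i, c i, Finset.prod_ne_zero_iff.2 fun i _ ↦ hc i, a',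
    (specMap_ratSpace_bijective hη h).1 ?_⟩
  rw [specMap_smul, ← ht, Fintype.linearCombination_apply, Fintype.linearCombination_apply,
    map_sum, Finset.smul_sum]
  refine Finset.sum_congr rfl fun i _ ↦ ?_
  rw [specMap_smul, smul_smul]
  congr 1
  rw [← Finset.mul_prod_erase _ c (Finset.mem_univ i), map_mul, map_mul, mul_right_comm, ← hca]

/-- The stalks of `L` are finitely generated since `L` is coherent, and they are full since `L` is all
of `V` at the generic points. Where `L` and the standard lattice differ, one of the two is not
contained in the other, which happens at finitely many points. -/
lemma IsLattice.isLatticeFamily {L : Subobject (ratSpace X d)} (hL : IsLattice X L) :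
    IsLatticeFamily (stalkSub L) := by
  have hfg : (L : X.Modules).IsLocallyFG := isLocallyFG_of_isFiniteType hL.isCoherent.isFiniteType
  have htop (η : X) (hη : η ∈ genericPoints X) : stalkSub L η = ⊤ := by
    have := (isZero_pullback_iff hη).1 (hL.isZero ⟨η, hη⟩)
    rw [stalkSub, ← ker_stalkMap_cokernel_π, eq_top_iff]
    exact fun t _ ↦ Subsingleton.elim _ _
  refine ⟨fun x ↦ ⟨?_, fun v ↦ ?_⟩, ?_⟩
  · obtain ⟨U, hU, n, s, hs⟩ := hfg x
    have : Module.Finite (X.presheaf.stalk x) ((L : X.Modules).Stalk x) :=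
      Module.Finite.of_surjective _ (hs x hU)
    have : Module.Finite (X.presheaf.stalk x) (stalkSub L x) :=
      Module.Finite.equiv (stalkSubEquiv L x)
    exact Module.Finite.iff_fg.1 this
  · obtain ⟨η, hη, h⟩ := exists_genericPoint_specializes x
    obtain ⟨U, hU, n, s, hs⟩ := hfg x
    have hUη : η ∈ U := h.mem_open U.2 hU
    obtain ⟨l, hl⟩ : specMap _ h v ∈ stalkSub L η := htop η hη ▸ Submodule.mem_top
    obtain ⟨a, ha⟩ := hs η hUη l
    obtain ⟨c, hc, b, hb⟩ := exists_smul_eq_linearCombination hη h v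
      (fun i ↦ stalkMap L.arrow x ((L : X.Modules).germ U x hU (s i))) ⟨a, by
        rw [← hl, ← ha, Fintype.linearCombination_apply, Fintype.linearCombination_apply, map_sum]
        refine Finset.sum_congr rfl fun i _ ↦ ?_
        rw [LinearMap.map_smul, specMap_stalkMap, specMap_germ]⟩
    refine ⟨c, hc, ?_⟩
    rw [← hb, Fintype.linearCombination_apply]
    exact Submodule.sum_mem _ fun i _ ↦ Submodule.smul_mem _ _ ⟨_, rfl⟩
  · have h₁ := (isOpenFamily_stalkSub (stdLattice X d)).finite_not_le L.arrow hfg fun η hη ↦ by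
      rw [stalkSub_stdLattice_genericPoint X hη]
      exact le_top
    have h₂ := (isOpenFamily_stalkSub L).finite_not_le (stdMap X d) (isLocallyFG_freeModule d)
      fun η hη ↦ by
        rw [htop η hη]
        exact le_top
    refine (h₁.union h₂).subset fun x hx ↦ ?_
    by_contra h
    rw [Set.mem_union, not_or, Set.mem_ofPred, not_not, Set.mem_ofPred, not_not,
      ← stalkSub_stdLattice] at h
    exact hx (le_antisymm h.1 h.2)

lemma IsLatticeFamily.notMem_genericPoints
    {P : ∀ x : X, Submodule (X.presheaf.stalk x) ((ratSpace X d).Stalk x)}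
    (hP : IsLatticeFamily P) {x : X} (hx : P x ≠ stalkSub (stdLattice X d) x) :
    x ∉ genericPoints X := fun h ↦
  hx ((hP.eq_top h).trans (stalkSub_stdLattice_genericPoint X h).symm)

/-- A section of `V` belongs to the standard lattice at almost all points. Thus a germ in `P x` is the
germ of a section over a neighbourhood that belongs to the standard lattice away from `x`. -/
lemma IsLatticeFamily.isOpenFamily
    {P : ∀ x : X, Submodule (X.presheaf.stalk x) ((ratSpace X d).Stalk x)}
    (hP : IsLatticeFamily P) : IsOpenFamily P := by
  intro x t ht
  obtain ⟨U, hU, s, rfl⟩ := exists_germ t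
  obtain ⟨W, hW⟩ := (isOpenFamily_stalkSub (stdLattice X d)).exists_opens fun _ : Fin 1 ↦ s
  have hfin := finite_diff (U := U) (W := W) fun η hη hηU ↦ (hW η).2 ⟨hηU, fun _ ↦ by
    rw [stalkSub_stdLattice_genericPoint X hη]
    trivial⟩
  obtain ⟨O, hxO, hO⟩ := exists_opens_avoiding (hfin.union hP.finite) (by
    rintro y (⟨hyU, hyW⟩ | hy)
    · refine fun hη ↦ hyW ((hW y).2 ⟨hyU, fun _ ↦ ?_⟩)
      rw [stalkSub_stdLattice_genericPoint X hη]
      trivial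
    · exact hP.notMem_genericPoints hy) x
  refine ⟨U ⊓ O, ⟨hU, hxO⟩, (ratSpace X d).presheaf.map (homOfLE inf_le_left).op s,
    germ_res _ _ _, fun y hy ↦ ?_⟩
  rw [germ_res]
  obtain rfl | hyx := eq_or_ne y x
  · exact ht
  · have h := hO y hy.2 hyx
    rw [Set.mem_union, not_or, Set.mem_ofPred, not_not, Set.mem_sdiff, not_and, not_not] at h
    rw [h.2]
    exact ((hW y).1 (h.1 hy.1)).2 0

/-- A basis of a stalk extends to a neighbourhood, since the standard basis can be expressed by it
at the generic point, hence in a neighbourhood of the generic point. -/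
lemma IsLatticeFamily.exists_isLocalBasis {L : Subobject (ratSpace X d)}
    (hL : IsLatticeFamily (stalkSub L)) (x : X) : ∃ (U : X.Opens) (_ : x ∈ U)
      (s : Fin d → Γ((L : X.Modules), U)), IsLocalBasis s := by
  have e (y : X) : Nonempty ((Fin d → X.presheaf.stalk y) ≃ₗ[X.presheaf.stalk y]
      (L : X.Modules).Stalk y) := by
    obtain ⟨e⟩ := (isFullLattice_stdLattice y).nonempty_linearEquiv (stdStalkEquiv X d y)
      (hL.isFullLattice y)
    exact ⟨e ≪≫ₗ (stalkSubEquiv L y).symm⟩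
  obtain ⟨U₀, η, hxU₀, hη, hηx, huniq⟩ := exists_opens_unique_genericPoint x
  obtain ⟨ex⟩ := e x
  obtain ⟨U, hUU₀, hxU, s, hs⟩ := exists_le_germ_fin hxU₀ fun i ↦ ex (Pi.single i 1)
  have hsx : Fintype.linearCombination (X.presheaf.stalk x)
      (fun i ↦ (L : X.Modules).germ U x hxU (s i)) = ex.toLinearMap := by
    refine (Pi.basisFun _ _).ext fun i ↦ ?_
    rw [Pi.basisFun_apply, Fintype.linearCombination_apply_single, one_smul, hs]
    rfl
  -- `W` is the set of points at which the standard basis is a combination of `s`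
  let s' (i : Fin d) : Γ(ratSpace X d, U) := L.arrow.app U (s i)
  let t (j : Fin d) : Γ(ratSpace X d, U) := (stdMap X d).app U (stdSection X d j U)
  obtain ⟨W, hW⟩ := exists_opens_mem_range s' t
  -- at the generic point `v` is a combination of `s`: some multiple `c v` is one at `x`, and `c` is
  -- invertible
  have hgen (ζ : X) (hζ : ζ ∈ genericPoints X) (hζU : ζ ∈ U) : ζ ∈ W := by
    refine (hW ζ).2 ⟨hζU, fun j ↦ ?_⟩
    obtain rfl := huniq ζ hζ (hUU₀ hζU)
    obtain ⟨v, hv⟩ := (specMap_ratSpace_bijective hζ hηx).2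
      ((ratSpace X d).germ U ζ hζU (t j))
    obtain ⟨c, hc, l, hl⟩ := (hL.isFullLattice x).exists_smul_mem v
    obtain ⟨a, rfl⟩ := ex.surjective l
    have hl' := congrArg (specMap _ hηx) hl
    rw [← LinearEquiv.coe_coe, ← hsx, stalkMap_linearCombination, specMap_linearCombination,
      specMap_smul, hv] at hl'
    obtain ⟨b, hb⟩ := (isField_stalk hζ).mul_inv_cancel
      ((map_ne_zero_iff _ (stalkSpecializes_injective hηx)).2 hc)
    refine ⟨b • fun i ↦ X.presheaf.stalkSpecializes hηx (a i), ?_⟩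
    rw [LinearMap.map_smul, hl', smul_smul, mul_comm, hb, one_smul]
  obtain ⟨O, hxO, hO⟩ := exists_opens_avoiding ((finite_diff hgen).union hL.finite) (by
    rintro y (⟨hyU, hyW⟩ | hy)
    · exact fun hζ ↦ hyW (hgen y hζ hyU)
    · exact hL.notMem_genericPoints hy) x
  refine ⟨U ⊓ O, ⟨hxU, hxO⟩, fun i ↦
    (L : X.Modules).presheaf.map (homOfLE inf_le_left).op (s i), fun y hy ↦ ?_⟩
  simp only [germ_res]
  obtain rfl | hyx := eq_or_ne y x
  · rw [hsx]
    exact ex.bijective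
  · have h := hO y hy.2 hyx
    rw [Set.mem_union, not_or, Set.mem_ofPred, not_not, Set.mem_sdiff, not_and, not_not] at h
    obtain ⟨ey⟩ := e y
    have hsurj : Function.Surjective (Fintype.linearCombination (X.presheaf.stalk y)
        fun i ↦ (L : X.Modules).germ U y hy.1 (s i)) := by
      intro l
      have hl : stalkMap L.arrow y l ∈ stalkSub (stdLattice X d) y := h.2 ▸ ⟨l, rfl⟩
      rw [stalkSub_stdLattice] at hl
      obtain ⟨v, hv⟩ := hl
      obtain ⟨b, rfl⟩ := (isLocalBasis_stdSection X d U y hy.1).2 v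
      rw [stalkMap_linearCombination, Fintype.linearCombination_apply] at hv
      have hmem : stalkMap L.arrow y l ∈ LinearMap.range (Fintype.linearCombination
          (X.presheaf.stalk y) fun i ↦ (ratSpace X d).germ U y hy.1 (s' i)) := by
        rw [← hv]
        exact Submodule.sum_mem _ fun j _ ↦
          Submodule.smul_mem _ _ (((hW y).1 (h.1 hy.1)).2 j)
      obtain ⟨a, ha⟩ := hmem
      refine ⟨a, stalkMap_injective_of_mono L.arrow y ?_⟩
      rw [stalkMap_linearCombination, ha]
    -- a surjective endomorphism of a finite module is injective
    have hinj := OrzechProperty.injective_of_surjective_endomorphism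
      (ey.symm.toLinearMap ∘ₗ Fintype.linearCombination (X.presheaf.stalk y)
        fun i ↦ (L : X.Modules).germ U y hy.1 (s i)) (ey.symm.surjective.comp hsurj)
    exact ⟨Function.Injective.of_comp hinj, hsurj⟩

/-- A family of full lattices, almost all of which are the standard one, defines a lattice. -/
lemma IsLatticeFamily.isLattice {L : Subobject (ratSpace X d)}
    (hL : IsLatticeFamily (stalkSub L)) : IsLattice X L := by
  refine ⟨?_, fun ⟨η, hη⟩ ↦ (isZero_pullback_iff hη).2 ?_⟩
  · refine isCoherent_of_isFinitePresentation cokernelZeroIsoTarget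
      (isFinitePresentation_cokernel (0 : freeModule X 0 ⟶ (L : X.Modules)) fun x ↦ ?_)
    obtain ⟨U, hU, s, hs⟩ := hL.exists_isLocalBasis x
    exact ⟨U, hU, 0, d, _, s, isLocalBasis_stdSection X 0 U, hs⟩
  · refine subsingleton_of_forall_eq 0 fun t ↦ ?_
    obtain ⟨v, rfl⟩ := stalkMap_surjective_of_epi (cokernel.π L.arrow) η t
    rw [← LinearMap.mem_ker, ker_stalkMap_cokernel_π]
    change v ∈ stalkSub L η
    rw [hL.eq_top hη]
    trivial

lemma isLattice_iff {L : Subobject (ratSpace X d)} :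
    IsLattice X L ↔ IsLatticeFamily (stalkSub L) :=
  ⟨IsLattice.isLatticeFamily, IsLatticeFamily.isLattice⟩

/-- Lattices can be prescribed by their stalks. -/
lemma IsLatticeFamily.exists_isLattice
    {P : ∀ x : X, Submodule (X.presheaf.stalk x) ((ratSpace X d).Stalk x)}
    (hP : IsLatticeFamily P) :
    ∃ L : Subobject (ratSpace X d), IsLattice X L ∧ ∀ x, stalkSub L x = P x := by
  obtain ⟨L, hL⟩ := exists_subobject hP.isOpenFamily
  refine ⟨L, isLattice_iff.2 ?_, hL⟩
  rwa [show stalkSub L = P from funext hL]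

end FiniteLengthModules

/-! ### Modules of finite length in terms of their stalks -/

/-- A module generated by `n` elements and killed by `c` is a quotient of `(R / c)ⁿ`, and `R / c` is
artinian, since it is noetherian and its prime ideals are maximal. -/
lemma IsPrincipalIdealRing.isArtinian_of_smul_eq_zero {R N : Type*} [CommRing R] [IsDomain R]
    [IsPrincipalIdealRing R] [AddCommGroup N] [Module R N] {n : ℕ} (π : (Fin n → R) →ₗ[R] N)
    (hπ : Function.Surjective π) {c : R} (hc : c ≠ 0) (h : ∀ t : N, c • t = 0) :
    IsArtinian R N := by
  have : Ring.KrullDimLE 0 (R ⧸ Ideal.span {c}) := Ring.KrullDimLE.mk₀ fun I hI ↦ by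
    have hp : (I.comap (Ideal.Quotient.mk (Ideal.span {c}))).IsPrime := inferInstance
    have hne : I.comap (Ideal.Quotient.mk (Ideal.span {c})) ≠ ⊥ := fun e ↦ hc <| by
      rw [← Ideal.mem_bot, ← e, Ideal.mem_comap,
        Ideal.Quotient.eq_zero_iff_mem.2 (Ideal.mem_span_singleton_self c)]
      exact I.zero_mem
    have hm := IsPrime.to_maximal_ideal hne
    rw [← Ideal.map_comap_of_surjective _ Ideal.Quotient.mk_surjective I]
    refine (Ideal.map_eq_top_or_isMaximal_of_surjective _ Ideal.Quotient.mk_surjective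
      hm).resolve_left fun e ↦ hI.ne_top ?_
    rwa [Ideal.map_comap_of_surjective _ Ideal.Quotient.mk_surjective] at e
  have : IsArtinianRing (R ⧸ Ideal.span {c}) :=
    isArtinianRing_iff_isNoetherianRing_krullDimLE_zero.2 ⟨inferInstance, inferInstance⟩
  have : IsArtinian R (R ⧸ Ideal.span {c}) :=
    isArtinian_of_surjective_algebraMap (R := R ⧸ Ideal.span {c}) Ideal.Quotient.mk_surjective
  let f : R →ₗ[R] (R ⧸ Ideal.span {c}) := (Ideal.span {c}).mkQ
  let g (i : Fin n) : (R ⧸ Ideal.span {c}) →ₗ[R] N :=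
    (Ideal.span {c}).liftQ (LinearMap.toSpanSingleton R N (π (Pi.single i 1))) (by
      rw [Ideal.span_le, Set.singleton_subset_iff]
      exact h _)
  refine isArtinian_of_surjective (Fin n → (R ⧸ Ideal.span {c}))
    (LinearMap.lsum R _ R g) fun t ↦ ?_
  obtain ⟨v, rfl⟩ := hπ t
  refine ⟨fun i ↦ f (v i), ?_⟩
  have : LinearMap.lsum R (fun _ : Fin n ↦ R ⧸ Ideal.span {c}) R g ∘ₗ f.compLeft (Fin n) = π := by
    refine (Pi.basisFun _ _).ext fun i ↦ ?_
    have hfi : f.compLeft (Fin n) (Pi.single i 1) = Pi.single i (f 1) := by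
      ext j
      obtain rfl | hij := eq_or_ne i j
      · simp
      · simp [Pi.single_eq_of_ne hij.symm]
    rw [Pi.basisFun_apply, LinearMap.comp_apply, hfi, LinearMap.lsum_piSingle]
    exact ((Ideal.span {c}).liftQ_apply _ _).trans (one_smul R _)
  exact congr($this v)

namespace AlgebraicGeometry.Scheme.Modules

open TopologicalSpace

variable {X : Scheme.{u}} {M N : X.Modules}

lemma isOpenFamily_bot : IsOpenFamily fun x ↦ (⊥ : Submodule (X.presheaf.stalk x) (M.Stalk x)) := by
  rintro x t rfl
  exact ⟨⊤, trivial, 0, map_zero _, fun y hy ↦ map_zero _⟩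

/-- A module with finitely many non-zero stalks of finite length has finite length. -/
lemma hasFiniteLength_of_finite {F : Set X} (hF : F.Finite)
    (h : ∀ x ∉ F, Subsingleton (M.Stalk x))
    (hN : ∀ x, _root_.IsNoetherian (X.presheaf.stalk x) (M.Stalk x))
    (hA : ∀ x, IsArtinian (X.presheaf.stalk x) (M.Stalk x)) :
    FiniteLengthModules.HasFiniteLength M := by
  have := hF.to_subtype
  let f : Subobject M ↪o ∀ x : F, Submodule (X.presheaf.stalk x) (M.Stalk x) :=
    OrderEmbedding.ofMapLEIff (fun L x ↦ stalkSub L x) fun L L' ↦ by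
      rw [le_iff_stalkSub_le]
      refine ⟨fun e x ↦ ?_, fun e x ↦ e x⟩
      by_cases hx : x ∈ F
      · exact e ⟨x, hx⟩
      · have := h x hx
        exact le_of_eq (Subsingleton.elim _ _)
  constructor
  · have h' : WellFoundedLT (∀ x : F, (Submodule (X.presheaf.stalk x) (M.Stalk x))ᵒᵈ) :=
      Pi.wellFoundedLT
    have : WellFoundedGT (∀ x : F, Submodule (X.presheaf.stalk x) (M.Stalk x)) := ⟨h'.wf⟩
    exact ⟨f.wellFoundedGT⟩
  · have : WellFoundedLT (∀ x : F, Submodule (X.presheaf.stalk x) (M.Stalk x)) := inferInstance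
    exact ⟨f.wellFoundedLT⟩

end AlgebraicGeometry.Scheme.Modules

namespace FiniteLengthModules

open AlgebraicGeometry Scheme.Modules TopologicalSpace IsRegularCurve

variable {X : Scheme.{u}}

/-- The stalks of a module that is generated by `d` sections. -/
lemma exists_surjective_stalk {d : ℕ} {N : X.Modules} (p : freeModule X d ⟶ N) [Epi p] (x : X) :
    ∃ π : (Fin d → X.presheaf.stalk x) →ₗ[X.presheaf.stalk x] N.Stalk x,
      Function.Surjective π :=
  ⟨stalkMap p x ∘ₗ (freeStalkEquiv X d x).symm.toLinearMap,
    (stalkMap_surjective_of_epi p x).comp (freeStalkEquiv X d x).symm.surjective⟩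

variable [IsRegularCurve X] {d : ℕ} {N : X.Modules}

/-- At a closed point `x`, the submodules of `N` with stalk `𝔪ⁿ N_x` at `x` form a descending chain,
so that `𝔪ⁿ N_x = 0` for some `n` by Nakayama's lemma. -/
lemma exists_smul_eq_zero_of_notMem_genericPoints (hA : IsArtinianObject N)
    (p : freeModule X d ⟶ N) [Epi p] {x : X} (hx : x ∉ genericPoints X) :
    ∃ c : X.presheaf.stalk x, c ≠ 0 ∧ ∀ t : N.Stalk x, c • t = 0 := by
  classical
  obtain ⟨π, hπ⟩ := exists_surjective_stalk p x
  have : Module.Finite (X.presheaf.stalk x) (N.Stalk x) := Module.Finite.of_surjective π hπ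
  let m := IsLocalRing.maximalIdeal (X.presheaf.stalk x)
  -- an open family since `x` is closed
  let P (n : ℕ) : ∀ y, Submodule (X.presheaf.stalk y) (N.Stalk y) :=
    Function.update (fun y ↦ ⊤) x (m ^ n • ⊤)
  have hP (n : ℕ) : IsOpenFamily (P n) := by
    intro y t ht
    by_cases hyx : y = x
    · subst hyx
      obtain ⟨U, hU, s, rfl⟩ := exists_germ t
      refine ⟨U, hU, s, rfl, fun z hz ↦ ?_⟩
      by_cases hzy : z = y
      · subst hzy
        exact ht
      · simp [P, Function.update_of_ne hzy]
    · obtain ⟨O, hyO, hO⟩ := exists_opens_avoiding (Set.finite_singleton x) (by simpa using hx) y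
      obtain ⟨U, hUO, hU, s, rfl⟩ := exists_le_germ t hyO
      refine ⟨U, hU, s, rfl, fun z hz ↦ ?_⟩
      have hzx : z ≠ x := by
        by_cases hzy : z = y
        · exact hzy ▸ hyx
        · exact hO z (hUO hz) hzy
      simp [P, Function.update_of_ne hzx]
  choose L hL using fun n ↦ exists_subobject (hP n)
  have hmono : Antitone L := by
    refine antitone_nat_of_succ_le fun n ↦ le_iff_stalkSub_le.2 fun y ↦ ?_
    rw [hL, hL]
    by_cases hyx : y = x
    · subst hyx
      simp only [P, Function.update_self]
      exact Submodule.smul_mono_left (Ideal.pow_le_pow_right n.le_succ)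
    · simp [P, Function.update_of_ne hyx]
  obtain ⟨n, hn⟩ := WellFoundedGT.monotone_chain_condition (α := (Subobject N)ᵒᵈ)
    ⟨fun n ↦ OrderDual.toDual (L n), hmono.dual_right⟩
  have heq : m ^ n • (⊤ : Submodule (X.presheaf.stalk x) (N.Stalk x)) = m ^ (n + 1) • ⊤ := by
    have e : L n = L (n + 1) := hn (n + 1) n.le_succ
    have := congrArg (fun K ↦ stalkSub K x) e
    simpa only [hL, P, Function.update_self] using this
  have hbot : m ^ n • (⊤ : Submodule (X.presheaf.stalk x) (N.Stalk x)) = ⊥ := by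
    refine Submodule.eq_bot_of_le_smul_of_le_jacobson_bot m _
      (Module.Finite.iff_fg.1 inferInstance) ?_ (IsLocalRing.maximalIdeal_le_jacobson _)
    rw [← mul_smul, ← pow_succ', ← heq]
  obtain ⟨a, ha, ha0⟩ := (Submodule.ne_bot_iff m).1 fun h ↦
    not_isField_stalk hx (IsLocalRing.isField_iff_maximalIdeal_eq.2 h)
  refine ⟨a ^ n, pow_ne_zero n ha0, fun t ↦ ?_⟩
  rw [← Submodule.mem_bot (X.presheaf.stalk x), ← hbot]
  exact Submodule.smul_mem_smul (Ideal.pow_mem_pow ha n) trivial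

/-- The component contains a closed point `x`. The generators of `N_x` are annihilated by a non-zero
element of `𝒪_x`, which is invertible at the generic point. -/
lemma subsingleton_stalk_of_mem_genericPoints (hA : IsArtinianObject N)
    (p : freeModule X d ⟶ N) [Epi p] {η : X} (hη : η ∈ genericPoints X) :
    Subsingleton (N.Stalk η) := by
  obtain ⟨x, hx, h⟩ := exists_specializes_ne hη
  obtain ⟨c, hc, hcN⟩ := exists_smul_eq_zero_of_notMem_genericPoints hA p hx
  refine subsingleton_of_forall_eq 0 fun t ↦ ?_
  obtain ⟨v, rfl⟩ := stalkMap_surjective_of_epi p η t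
  obtain ⟨a, rfl⟩ := (isLocalBasis_stdSection X d ⊤ η (Opens.mem_top η)).2 v
  rw [stalkMap_linearCombination, Fintype.linearCombination_apply]
  refine Finset.sum_eq_zero fun i _ ↦ ?_
  have h0 : X.presheaf.stalkSpecializes h c •
      N.germ ⊤ η (Opens.mem_top η) (p.app ⊤ (stdSection X d i ⊤)) = 0 := by
    have e := congrArg (specMap N h) (hcN (N.germ ⊤ x (Opens.mem_top x) (p.app ⊤ (stdSection X d i ⊤))))
    rwa [specMap_smul, specMap_germ, map_zero] at e
  obtain ⟨b, hb⟩ := (isField_stalk hη).mul_inv_cancel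
    ((map_ne_zero_iff _ (stalkSpecializes_injective h)).2 hc)
  rw [← one_smul (X.presheaf.stalk η) (N.germ ⊤ η _ _), ← hb, mul_comm, mul_smul, h0,
    smul_zero, smul_zero]

/-- The local structure of the objects of `C^d`: the stalks are torsion modules with `d` generators,
almost all of which are zero. -/
structure IsTorsionModule (d : ℕ) (N : X.Modules) : Prop where
  exists_surjective (x : X) : ∃ π : (Fin d → X.presheaf.stalk x) →ₗ[X.presheaf.stalk x] N.Stalk x,
    Function.Surjective π
  exists_smul_eq_zero (x : X) : ∃ c : X.presheaf.stalk x, c ≠ 0 ∧ ∀ t : N.Stalk x, c • t = 0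
  finite : {x | ¬ Subsingleton (N.Stalk x)}.Finite

lemma isObject.isTorsionModule (h : isObject X d ⟨N⟩) : IsTorsionModule d N := by
  obtain ⟨-, ⟨-, hA⟩, p, hp⟩ := h
  refine ⟨exists_surjective_stalk p, fun x ↦ ?_, ?_⟩
  · by_cases hx : x ∈ genericPoints X
    · have := subsingleton_stalk_of_mem_genericPoints hA p hx
      exact ⟨1, one_ne_zero, fun t ↦ Subsingleton.elim _ _⟩
    · exact exists_smul_eq_zero_of_notMem_genericPoints hA p hx
  · refine (isOpenFamily_bot.finite_not_le p (isLocallyFG_freeModule d) fun η hη ↦ ?_).subset ?_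
    · have := subsingleton_stalk_of_mem_genericPoints hA p hη
      exact le_of_eq (Subsingleton.elim _ _)
    · refine fun x hx hle ↦ hx (subsingleton_of_forall_eq 0 fun t ↦ ?_)
      obtain ⟨v, rfl⟩ := stalkMap_surjective_of_epi p x t
      exact hle ⟨v, rfl⟩

lemma IsTorsionModule.subsingleton_stalk (h : IsTorsionModule d N) {η : X}
    (hη : η ∈ genericPoints X) : Subsingleton (N.Stalk η) := by
  obtain ⟨c, hc, hN⟩ := h.exists_smul_eq_zero η
  obtain ⟨b, hb⟩ := (isField_stalk hη).mul_inv_cancel hc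
  refine subsingleton_of_forall_eq 0 fun t ↦ ?_
  rw [← one_smul (X.presheaf.stalk η) t, ← hb, mul_comm, mul_smul, hN, smul_zero]

lemma IsTorsionModule.hasDiscreteSupport (h : IsTorsionModule d N) : N.HasDiscreteSupport := by
  intro x
  obtain ⟨O, hxO, hO⟩ := exists_opens_avoiding h.finite
    (fun y hy hη ↦ hy (h.subsingleton_stalk hη)) x
  exact ⟨O, hxO, fun y hy hyx ↦ not_not.1 (hO y hy hyx)⟩

lemma IsTorsionModule.hasFiniteLength (h : IsTorsionModule d N) : HasFiniteLength N := by
  refine hasFiniteLength_of_finite h.finite (fun x hx ↦ not_not.1 hx) (fun x ↦ ?_) fun x ↦ ?_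
  · obtain ⟨π, hπ⟩ := h.exists_surjective x
    exact isNoetherian_of_surjective π (LinearMap.range_eq_top.2 hπ)
  · obtain ⟨π, hπ⟩ := h.exists_surjective x
    obtain ⟨c, hc, hcN⟩ := h.exists_smul_eq_zero x
    exact IsPrincipalIdealRing.isArtinian_of_smul_eq_zero π hπ hc hcN

lemma IsTorsionModule.exists_epi (h : IsTorsionModule d N) :
    ∃ p : freeModule X d ⟶ N, Epi p := by
  choose π hπ using h.exists_surjective
  obtain ⟨p, hp⟩ := h.hasDiscreteSupport.exists_hom (M := freeModule X d) fun x ↦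
    π x ∘ₗ (freeStalkEquiv X d x).toLinearMap
  refine ⟨p, epi_of_stalkMap_surjective fun x ↦ ?_⟩
  rw [hp]
  exact (hπ x).comp (freeStalkEquiv X d x).surjective

end FiniteLengthModules

/-! ### Lattices and modules of finite length -/

/-- An epimorphism from a subobject `M` of `V` is the projection to a quotient `M / K`. -/
lemma exists_subquot_iso_of_epi {A : Type u} [Category.{v} A] [Abelian A] {V N : A}
    {M : Subobject V} (φ : (M : A) ⟶ N) [Epi φ] :
    ∃ (K : Subobject V) (hK : K ≤ M) (e : subquot hK ≅ N), subquotπ hK ≫ e.hom = φ := by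
  let K : Subobject V := Subobject.mk (kernel.ι φ ≫ M.arrow)
  let u : (K : A) ⟶ kernel φ := (Subobject.underlyingIso (kernel.ι φ ≫ M.arrow)).hom
  have hu : (u ≫ kernel.ι φ) ≫ M.arrow = K.arrow := by
    rw [Category.assoc]
    exact Subobject.underlyingIso_hom_comp_eq_mk _
  have hK : K ≤ M := Subobject.le_of_comm (u ≫ kernel.ι φ) hu
  have hofLE : Subobject.ofLE K M hK = u ≫ kernel.ι φ := by
    rw [← cancel_mono M.arrow, Subobject.ofLE_arrow, hu]
  let q : subquot hK ⟶ N := cokernel.desc _ φ (by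
    rw [hofLE, Category.assoc, kernel.condition, comp_zero])
  have hq : subquotπ hK ≫ q = φ := cokernel.π_desc _ _ _
  have : Epi q := by
    have : Epi (subquotπ hK ≫ q) := by rwa [hq]
    exact epi_of_epi (subquotπ hK) q
  have : Mono q := by
    rw [Preadditive.mono_iff_cancel_zero]
    intro T x hx
    obtain ⟨T', π, hπ, m, hm⟩ := surjective_up_to_refinements_of_epi (subquotπ hK) x
    have h0 : m ≫ φ = 0 := by
      rw [← hq, ← Category.assoc, ← hm, Category.assoc, hx, comp_zero]
    have hl : m = (kernel.lift φ m h0 ≫ inv u) ≫ Subobject.ofLE K M hK := by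
      rw [hofLE, Category.assoc, IsIso.inv_hom_id_assoc, kernel.lift_ι]
    rw [← cancel_epi π, hm, hl, Category.assoc, ofLE_subquotπ, comp_zero, comp_zero]
  have : IsIso q := isIso_of_mono_of_epi q
  exact ⟨K, hK, asIso q, hq⟩

namespace AlgebraicGeometry.Scheme.Modules

variable {X : Scheme.{u}} {V N : X.Modules} {L M L' M' : Subobject V}

lemma IsLocalBasis.res {n : ℕ} {U W : X.Opens} {s : Fin n → Γ(N, U)} (hs : IsLocalBasis s)
    (h : W ≤ U) : IsLocalBasis fun i ↦ (N.presheaf.map (homOfLE h).op (s i) : Γ(N, W)) := by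
  intro x hx
  simp only [germ_res]
  exact hs x (h hx)

/-- The projection `M_x ⟶ (M / L)_x` on the stalks. -/
noncomputable def stalkπ (h : L ≤ M) (x : X) :
    stalkSub M x →ₗ[X.presheaf.stalk x] (subquot h).Stalk x :=
  stalkMap (subquotπ h) x ∘ₗ (stalkSubEquiv M x).symm.toLinearMap

lemma stalkπ_surjective (h : L ≤ M) (x : X) : Function.Surjective (stalkπ h x) :=
  (stalkMap_surjective_of_epi (subquotπ h) x).comp (stalkSubEquiv M x).symm.surjective

lemma stalkπ_stalkSubEquiv (h : L ≤ M) (x : X) (t : (M : X.Modules).Stalk x) :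
    stalkπ h x (stalkSubEquiv M x t) = stalkMap (subquotπ h) x t :=
  congrArg (stalkMap (subquotπ h) x) ((stalkSubEquiv M x).symm_apply_apply t)

lemma stalkπ_eq_zero_iff (h : L ≤ M) (x : X) (v : stalkSub M x) :
    stalkπ h x v = 0 ↔ (v : V.Stalk x) ∈ stalkSub L x := by
  obtain ⟨t, rfl⟩ := (stalkSubEquiv M x).surjective v
  rw [stalkπ_stalkSubEquiv]
  have e := SetLike.ext_iff.1 (ker_stalkMap_cokernel_π (Subobject.ofLE L M h) x) t
  refine (LinearMap.mem_ker.symm.trans e).trans ?_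
  change _ ↔ stalkMap M.arrow x t ∈ _
  constructor
  · rintro ⟨l, rfl⟩
    exact ⟨l, by rw [← stalkMap_comp_apply, Subobject.ofLE_arrow]⟩
  · rintro ⟨l, hl⟩
    refine ⟨l, stalkMap_injective_of_mono M.arrow x ?_⟩
    rw [← hl, ← stalkMap_comp_apply, Subobject.ofLE_arrow]

lemma stalkSubEquiv_ofLE (h : L ≤ M) (x : X) (t : (L : X.Modules).Stalk x) :
    stalkSubEquiv M x (stalkMap (Subobject.ofLE L M h) x t) =
      Submodule.inclusion (le_iff_stalkSub_le.1 h x) (stalkSubEquiv L x t) := by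
  refine Subtype.ext ?_
  change stalkMap M.arrow x _ = stalkMap L.arrow x t
  rw [← stalkMap_comp_apply, Subobject.ofLE_arrow]

lemma stalkMap_subquotMap (h : L ≤ M) (h' : L' ≤ M') (hL : L ≤ L') (hM : M ≤ M') (x : X)
    (v : stalkSub M x) : stalkMap (subquotMap h h' hL hM) x (stalkπ h x v) =
      stalkπ h' x (Submodule.inclusion (le_iff_stalkSub_le.1 hM x) v) := by
  obtain ⟨t, rfl⟩ := (stalkSubEquiv M x).surjective v
  rw [stalkπ_stalkSubEquiv, ← stalkMap_comp_apply, subquotπ_map, stalkMap_comp_apply,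
    ← stalkSubEquiv_ofLE, stalkπ_stalkSubEquiv]

/-- If `N` has discrete support, surjections of the stalks of `M` onto the stalks of `N` define an
isomorphism of `N` with a quotient of `M`. -/
lemma exists_subquot_iso_of_stalks (hN : N.HasDiscreteSupport)
    (s : ∀ x, stalkSub M x →ₗ[X.presheaf.stalk x] N.Stalk x)
    (hs : ∀ x, Function.Surjective (s x)) :
    ∃ (K : Subobject V) (hK : K ≤ M) (e : subquot hK ≅ N),
      (∀ x v, stalkMap e.hom x (stalkπ hK x v) = s x v) ∧
      ∀ x (v : stalkSub M x), (v : V.Stalk x) ∈ stalkSub K x ↔ s x v = 0 := by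
  obtain ⟨φ, hφ⟩ := hN.exists_hom (M := (M : X.Modules)) fun x ↦
    s x ∘ₗ (stalkSubEquiv M x).toLinearMap
  have : Epi φ := epi_of_stalkMap_surjective fun x ↦ by
    rw [hφ]
    exact (hs x).comp (stalkSubEquiv M x).surjective
  obtain ⟨K, hK, e, he⟩ := exists_subquot_iso_of_epi φ
  have key (x : X) (v : stalkSub M x) : stalkMap e.hom x (stalkπ hK x v) = s x v := by
    obtain ⟨t, rfl⟩ := (stalkSubEquiv M x).surjective v
    rw [stalkπ_stalkSubEquiv, ← stalkMap_comp_apply, he, hφ]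
    rfl
  refine ⟨K, hK, e, key, fun x v ↦ ?_⟩
  rw [← stalkπ_eq_zero_iff hK, ← key]
  exact (map_eq_zero_iff _ (stalkEquiv e x).injective).symm

/-- Morphisms from a subquotient are determined by the stalks. -/
lemma subquot_hom_ext (h : L ≤ M) {φ ψ : subquot h ⟶ N}
    (e : ∀ x v, stalkMap φ x (stalkπ h x v) = stalkMap ψ x (stalkπ h x v)) : φ = ψ :=
  hom_ext_stalk fun x ↦ LinearMap.ext fun t ↦ by
    obtain ⟨v, rfl⟩ := stalkπ_surjective h x t
    exact e x v

end AlgebraicGeometry.Scheme.Modules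

namespace FiniteLengthModules

open AlgebraicGeometry Scheme.Modules TopologicalSpace IsRegularCurve

variable {X : Scheme.{u}} [IsRegularCurve X] {d : ℕ} {N : X.Modules}
  {L M K : Subobject (ratSpace X d)}

lemma IsLattice.isFullLattice (hL : IsLattice X L) (x : X) : IsFullLattice (stalkSub L x) :=
  hL.isLatticeFamily.isFullLattice x

lemma IsLattice.nonempty_linearEquiv (hL : IsLattice X L) (x : X) :
    Nonempty ((Fin d → X.presheaf.stalk x) ≃ₗ[X.presheaf.stalk x] stalkSub L x) :=
  (isFullLattice_stdLattice x).nonempty_linearEquiv (stdStalkEquiv X d x) (hL.isFullLattice x)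

lemma IsLattice.finite_ne (hL : IsLattice X L) (hM : IsLattice X M) :
    {x | stalkSub L x ≠ stalkSub M x}.Finite := by
  refine (hL.isLatticeFamily.finite.union hM.isLatticeFamily.finite).subset fun x hx ↦ ?_
  by_contra h
  rw [Set.mem_union, not_or, Set.mem_ofPred, not_not, Set.mem_ofPred, not_not] at h
  exact hx (h.1.trans h.2.symm)

/-- A family of full lattices that almost everywhere agrees with a lattice is a lattice. -/
lemma IsLattice.exists_of_finite (hL : IsLattice X L)
    (P : ∀ x : X, Submodule (X.presheaf.stalk x) ((ratSpace X d).Stalk x))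
    (hP : ∀ x, IsFullLattice (P x)) (hfin : {x | P x ≠ stalkSub L x}.Finite) :
    ∃ K : Subobject (ratSpace X d), IsLattice X K ∧ ∀ x, stalkSub K x = P x := by
  refine IsLatticeFamily.exists_isLattice ⟨hP, (hfin.union hL.isLatticeFamily.finite).subset ?_⟩
  intro x hx
  by_contra h
  rw [Set.mem_union, not_or, Set.mem_ofPred, not_not, Set.mem_ofPred, not_not] at h
  exact hx (h.1.trans h.2)

lemma isLattice_of_finite (hL : IsLattice X L) (hK : ∀ x, IsFullLattice (stalkSub K x))
    (hfin : {x | stalkSub K x ≠ stalkSub L x}.Finite) : IsLattice X K := by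
  obtain ⟨K', hK', h⟩ := hL.exists_of_finite _ hK hfin
  rwa [← subobject_ext h]

lemma isLattice_stdLattice : IsLattice X (stdLattice X d) :=
  isLattice_iff.2 ⟨isFullLattice_stdLattice, by simp⟩

lemma IsLattice.of_le_of_le (hL : IsLattice X L) (hM : IsLattice X M) (h : L ≤ K) (h' : K ≤ M) :
    IsLattice X K := by
  refine isLattice_of_finite hL (fun x ↦ (hM.isFullLattice x).of_le (le_iff_stalkSub_le.1 h' x)
    fun v ↦ ?_) ((hL.finite_ne hM).subset fun x hx e ↦ hx ?_)
  · obtain ⟨c, hc, hv⟩ := (hL.isFullLattice x).exists_smul_mem v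
    exact ⟨c, hc, le_iff_stalkSub_le.1 h x hv⟩
  · exact le_antisymm (e ▸ le_iff_stalkSub_le.1 h' x) (le_iff_stalkSub_le.1 h x)

/-- The intersections of the stalks form a lattice contained in `L` and `M`. -/
lemma IsLattice.exists_inf (hL : IsLattice X L) (hM : IsLattice X M) :
    ∃ K, IsLattice X K ∧ K ≤ L ∧ K ≤ M := by
  obtain ⟨K, hK, h⟩ := hL.exists_of_finite (fun x ↦ stalkSub L x ⊓ stalkSub M x)
    (fun x ↦ (hL.isFullLattice x).inf (hM.isFullLattice x))
    ((hL.finite_ne hM).subset fun x hx e ↦ hx (by rw [e, inf_idem]))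
  exact ⟨K, hK, le_iff_stalkSub_le.2 fun x ↦ (h x).trans_le inf_le_left,
    le_iff_stalkSub_le.2 fun x ↦ (h x).trans_le inf_le_right⟩

/-- The sums of the stalks form a lattice containing `L` and `M`. -/
lemma IsLattice.exists_sup (hL : IsLattice X L) (hM : IsLattice X M) :
    ∃ K, IsLattice X K ∧ L ≤ K ∧ M ≤ K := by
  obtain ⟨K, hK, h⟩ := hL.exists_of_finite (fun x ↦ stalkSub L x ⊔ stalkSub M x)
    (fun x ↦ (hL.isFullLattice x).sup (hM.isFullLattice x))
    ((hL.finite_ne hM).subset fun x hx e ↦ hx (by rw [e, sup_idem]))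
  exact ⟨K, hK, le_iff_stalkSub_le.2 fun x ↦ le_sup_left.trans_eq (h x).symm,
    le_iff_stalkSub_le.2 fun x ↦ le_sup_right.trans_eq (h x).symm⟩

lemma IsLattice.inf (hL : IsLattice X L) (hM : IsLattice X M) : IsLattice X (L ⊓ M) := by
  obtain ⟨K, hK, h, h'⟩ := hL.exists_inf hM
  exact hK.of_le_of_le hL (le_inf h h') inf_le_left

lemma IsLattice.sup (hL : IsLattice X L) (hM : IsLattice X M) : IsLattice X (L ⊔ M) := by
  obtain ⟨K, hK, h, h'⟩ := hL.exists_sup hM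
  exact hL.of_le_of_le hK le_sup_left (sup_le h h')

lemma IsLattice.isTorsionModule (hL : IsLattice X L) (hM : IsLattice X M) (h : L ≤ M) :
    IsTorsionModule d (subquot h) where
  exists_surjective x := by
    obtain ⟨e⟩ := hM.nonempty_linearEquiv x
    exact ⟨stalkπ h x ∘ₗ e.toLinearMap, (stalkπ_surjective h x).comp e.surjective⟩
  exists_smul_eq_zero x := by
    obtain ⟨c, hc, hcM⟩ := (hM.isFullLattice x).exists_smul_le (hL.isFullLattice x)
    refine ⟨c, hc, fun t ↦ ?_⟩
    obtain ⟨v, rfl⟩ := stalkπ_surjective h x t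
    rw [← LinearMap.map_smul, stalkπ_eq_zero_iff]
    exact hcM v v.2
  finite := by
    refine (hL.finite_ne hM).subset fun x hx e ↦ hx (subsingleton_of_forall_eq 0 fun t ↦ ?_)
    obtain ⟨v, rfl⟩ := stalkπ_surjective h x t
    rw [stalkπ_eq_zero_iff, e]
    exact v.2

lemma IsLattice.isObject_subquot (hL : IsLattice X L) (hM : IsLattice X M) (h : L ≤ M) :
    isObject X d ⟨subquot h⟩ := by
  have hT := hL.isTorsionModule hM h
  refine ⟨isCoherent_of_isFinitePresentation (Iso.refl _) (isFinitePresentation_cokernel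
    (Subobject.ofLE L M h) fun x ↦ ?_), hT.hasFiniteLength, hT.exists_epi⟩
  obtain ⟨U, hU, s, hs⟩ := hL.isLatticeFamily.exists_isLocalBasis x
  obtain ⟨W, hW, t, ht⟩ := hM.isLatticeFamily.exists_isLocalBasis x
  exact ⟨U ⊓ W, ⟨hU, hW⟩, d, d, _, _, hs.res inf_le_left, ht.res inf_le_right⟩

/-- An epimorphism from an object of `C^d` to `M / L` is isomorphic to the projection from `M / K`
for some lattice `K ⊆ L`. -/
lemma IsLattice.exists_fibration (hM : IsLattice X M) (h : L ≤ M)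
    (hN : isObject X d ⟨N⟩) (q : N ⟶ subquot h) [Epi q] :
    ∃ (K : Subobject (ratSpace X d)) (hK : K ≤ L) (e : subquot (hK.trans h) ≅ N),
      IsLattice X K ∧ e.hom ≫ q = subquotMap (hK.trans h) h hK le_rfl := by
  have hT := hN.isTorsionModule
  -- locally, `M` is free and projects to `N` over `M / L`
  have hloc (x : X) : ∃ s : stalkSub M x →ₗ[X.presheaf.stalk x] N.Stalk x,
      Function.Surjective s ∧ ∀ v, stalkMap q x (s v) = stalkπ h x v := by
    obtain ⟨e⟩ := hM.nonempty_linearEquiv x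
    obtain ⟨π, hπ⟩ := hT.exists_surjective x
    exact (hM.isFullLattice x).exists_lift e (hM.isFullLattice x) _ (stalkπ_surjective h x) π hπ _
      (stalkMap_surjective_of_epi q x)
  choose s hs hsq using hloc
  obtain ⟨K, hKM, e, he, hK⟩ := exists_subquot_iso_of_stalks hT.hasDiscreteSupport s hs
  have hKL : K ≤ L := le_iff_stalkSub_le.2 fun x v hv ↦ by
    have h0 := (hK x ⟨v, le_iff_stalkSub_le.1 hKM x hv⟩).1 hv
    exact (stalkπ_eq_zero_iff h x _).1 ((hsq x _).symm.trans ((congrArg _ h0).trans (map_zero _)))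
  refine ⟨K, hKL, e, isLattice_of_finite hM (fun x ↦ ?_) (hT.finite.subset fun x hx hsub ↦ hx ?_),
    subquot_hom_ext _ fun x v ↦ ?_⟩
  · refine (hM.isFullLattice x).of_le (le_iff_stalkSub_le.1 hKM x) fun v ↦ ?_
    obtain ⟨c, hc, hv⟩ := (hM.isFullLattice x).exists_smul_mem v
    obtain ⟨c', hc', hcN⟩ := hT.exists_smul_eq_zero x
    refine ⟨c' * c, mul_ne_zero hc' hc, ?_⟩
    rw [mul_smul]
    refine (hK x ⟨c' • c • v, Submodule.smul_mem _ _ hv⟩).2 ?_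
    exact ((s x).map_smul c' ⟨c • v, hv⟩).trans (hcN _)
  · exact le_antisymm (le_iff_stalkSub_le.1 hKM x) fun v hv ↦
      (hK x ⟨v, hv⟩).2 (Subsingleton.elim _ _)
  · rw [stalkMap_comp_apply, he, hsq, stalkMap_subquotMap]
    rfl

/-- A monomorphism from `M / L` to an object of `C^d` is isomorphic to the inclusion in `K / L` for
some lattice `K ⊇ M`. -/
lemma IsLattice.exists_cofibration (hL : IsLattice X L) (hM : IsLattice X M) (h : L ≤ M)
    (hN : isObject X d ⟨N⟩) (i : subquot h ⟶ N) [Mono i] :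
    ∃ (K : Subobject (ratSpace X d)) (hK : M ≤ K) (e : subquot (h.trans hK) ≅ N),
      IsLattice X K ∧ subquotMap h (h.trans hK) le_rfl hK ≫ e.hom = i := by
  have hT := hN.isTorsionModule
  -- locally, `N` is a quotient of a lattice `P` containing `M`
  have hloc (x : X) : ∃ (P : Submodule (X.presheaf.stalk x) ((ratSpace X d).Stalk x))
      (hP : stalkSub M x ≤ P) (τ : P →ₗ[X.presheaf.stalk x] N.Stalk x),
      P.FG ∧ Function.Surjective τ ∧ (∀ v, τ v = 0 → (v : (ratSpace X d).Stalk x) ∈ stalkSub M x) ∧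
        ∀ v, τ (Submodule.inclusion hP v) = stalkMap i x (stalkπ h x v) := by
    obtain ⟨e⟩ := hM.nonempty_linearEquiv x
    obtain ⟨π, hπ⟩ := hT.exists_surjective x
    obtain ⟨c, hc, hcN⟩ := hT.exists_smul_eq_zero x
    exact (hM.isFullLattice x).exists_extension e (hM.isFullLattice x) _ (stalkπ_surjective h x)
      π hπ (stalkMap i x) (stalkMap_injective_of_mono i x) hc hcN
  choose P hP τ hfg hτ hker hτi using hloc
  have hfull (x : X) : IsFullLattice (P x) := ⟨hfg x, fun v ↦ by
    obtain ⟨c, hc, hv⟩ := (hM.isFullLattice x).exists_smul_mem v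
    exact ⟨c, hc, hP x hv⟩⟩
  obtain ⟨K, hKlat, hK⟩ := hM.exists_of_finite P hfull (hT.finite.subset fun x hx hsub ↦
    hx (le_antisymm (fun v hv ↦ hker x ⟨v, hv⟩ (Subsingleton.elim _ _)) (hP x)))
  obtain rfl : P = stalkSub K := (funext hK).symm
  have hMK : M ≤ K := le_iff_stalkSub_le.2 hP
  -- the kernel of the projection of `K` to `N` is `L`, since `M / L` is contained in `N`
  obtain ⟨L', hL'K, e, he, hL'⟩ := exists_subquot_iso_of_stalks hT.hasDiscreteSupport τ hτ
  obtain rfl : L' = L := by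
    refine subobject_ext fun x ↦ ?_
    ext v
    constructor
    · intro hv
      have h0 := (hL' x ⟨v, le_iff_stalkSub_le.1 hL'K x hv⟩).1 hv
      have hvM := hker x _ h0
      refine (stalkπ_eq_zero_iff h x ⟨v, hvM⟩).1 (stalkMap_injective_of_mono i x ?_)
      rw [← hτi, map_zero]
      exact h0
    · intro hv
      have hvM := le_iff_stalkSub_le.1 h x hv
      refine (hL' x ⟨v, hP x hvM⟩).2 ((hτi x ⟨v, hvM⟩).trans ?_)
      rw [(stalkπ_eq_zero_iff h x ⟨v, hvM⟩).2 hv, map_zero]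
  refine ⟨K, hMK, e, hKlat, subquot_hom_ext _ fun x v ↦ ?_⟩
  rw [stalkMap_comp_apply, stalkMap_subquotMap, he]
  exact hτi x v

/-- Locally, the smaller lattice is a multiple of the larger one. -/
def IsScaled (L M : Subobject (ratSpace X d)) : Prop :=
  ∀ x : X, ∃ c : X.presheaf.stalk x, c ≠ 0 ∧
    ∀ v, v ∈ stalkSub L x ↔ ∃ w ∈ stalkSub M x, v = c • w

/-- Almost all stalks of `L` and `M` coincide, so that the denominators can be chosen trivial there. -/
lemma IsLattice.exists_smul_mem (hL : IsLattice X L) (hM : IsLattice X M) :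
    ∃ c : ∀ x : X, X.presheaf.stalk x, (∀ x, c x ≠ 0) ∧
      (∀ x, ∀ v ∈ stalkSub M x, c x • v ∈ stalkSub L x) ∧ {x | c x ≠ 1}.Finite := by
  have hloc (x : X) : ∃ c : X.presheaf.stalk x, c ≠ 0 ∧
      (∀ v ∈ stalkSub M x, c • v ∈ stalkSub L x) ∧ (stalkSub L x = stalkSub M x → c = 1) := by
    by_cases e : stalkSub L x = stalkSub M x
    · exact ⟨1, one_ne_zero, fun v hv ↦ by rwa [one_smul, e], fun _ ↦ rfl⟩
    · obtain ⟨c, hc, hcM⟩ := (hM.isFullLattice x).exists_smul_le (hL.isFullLattice x)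
      exact ⟨c, hc, hcM, fun h ↦ absurd h e⟩
  choose c hc hcM hc1 using hloc
  exact ⟨c, hc, hcM, (hL.finite_ne hM).subset fun x hx e ↦ hx (hc1 x e)⟩

/-- Take `K = cM` with denominators `c` such that `cM ⊆ L`. -/
lemma IsLattice.exists_isScaled_le (hL : IsLattice X L) (hM : IsLattice X M) :
    ∃ K, IsLattice X K ∧ K ≤ L ∧ IsScaled K M := by
  obtain ⟨c, hc, hcM, hfin⟩ := hL.exists_smul_mem hM
  let P (x : X) : Submodule (X.presheaf.stalk x) ((ratSpace X d).Stalk x) :=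
    (stalkSub M x).map (IsFullLattice.smulEquiv (c x) (hc x)).toLinearMap
  have hP (x : X) (v : (ratSpace X d).Stalk x) : v ∈ P x ↔ ∃ w ∈ stalkSub M x, v = c x • w :=
    ⟨fun ⟨w, hw, e⟩ ↦ ⟨w, hw, e.symm⟩, fun ⟨w, hw, e⟩ ↦ ⟨w, hw, e.symm⟩⟩
  have hPM (x : X) (h : c x = 1) : P x = stalkSub M x := by
    ext v
    simp [hP, h]
  obtain ⟨K, hK, hKx⟩ := hM.exists_of_finite P (fun x ↦ (hM.isFullLattice x).map _ _)
    (hfin.subset fun x hx e ↦ hx (hPM x e))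
  refine ⟨K, hK, le_iff_stalkSub_le.2 fun x v hv ↦ ?_, fun x ↦ ⟨c x, hc x, fun v ↦ ?_⟩⟩
  · obtain ⟨w, hw, rfl⟩ := (hP x v).1 (hKx x ▸ hv)
    exact hcM x w hw
  · rw [hKx, hP]

/-- Take `K = c⁻¹L` with denominators `c` such that `cM ⊆ L`. -/
lemma IsLattice.exists_isScaled_ge (hL : IsLattice X L) (hM : IsLattice X M) :
    ∃ K, IsLattice X K ∧ M ≤ K ∧ IsScaled L K := by
  obtain ⟨c, hc, hcM, hfin⟩ := hL.exists_smul_mem hM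
  let P (x : X) : Submodule (X.presheaf.stalk x) ((ratSpace X d).Stalk x) :=
    (stalkSub L x).comap (IsFullLattice.smulEquiv (c x) (hc x)).toLinearMap
  have hP (x : X) (v : (ratSpace X d).Stalk x) : v ∈ P x ↔ c x • v ∈ stalkSub L x := Iff.rfl
  have hPL (x : X) (h : c x = 1) : P x = stalkSub L x := by
    ext v
    simp [hP, h]
  obtain ⟨K, hK, hKx⟩ := hL.exists_of_finite P (fun x ↦ (hL.isFullLattice x).comap _ _)
    (hfin.subset fun x hx e ↦ hx (hPL x e))
  refine ⟨K, hK, le_iff_stalkSub_le.2 fun x v hv ↦ ?_, fun x ↦ ⟨c x, hc x, fun v ↦ ?_⟩⟩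
  · rw [hKx, hP]
    exact hcM x v hv
  · simp only [hKx, hP]
    constructor
    · intro hv
      obtain ⟨w, rfl⟩ := (IsUniquelyDivisible.smul_bijective (V := (ratSpace X d).Stalk x)
        (c x) (hc x)).2 v
      exact ⟨w, hv, rfl⟩
    · rintro ⟨w, hw, rfl⟩
      exact hw

/-- If `M / L` is of the form `M / cM`, then any isomorphic quotient `M' / L'` is `M' / cM'`, as
follows from the uniqueness of projective covers over local rings. -/
lemma IsScaled.mem_iff (hM : IsLattice X M) (h : L ≤ M) {x : X} {c : X.presheaf.stalk x}
    (hc : ∀ v, v ∈ stalkSub L x ↔ ∃ w ∈ stalkSub M x, v = c • w)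
    {L' M' : Subobject (ratSpace X d)} (hM' : IsLattice X M') (h' : L' ≤ M')
    (e : subquot h ≅ subquot h') (v : (ratSpace X d).Stalk x) :
    v ∈ stalkSub L' x ↔ ∃ w ∈ stalkSub M' x, v = c • w := by
  obtain ⟨g⟩ := hM.nonempty_linearEquiv x
  obtain ⟨g'⟩ := hM'.nonempty_linearEquiv x
  have key := IsLocalRing.ker_eq_smul_top g g' ((stalkEquiv e x).toLinearMap ∘ₗ stalkπ h x)
    (stalkπ h' x) ((stalkEquiv e x).surjective.comp (stalkπ_surjective h x))
    (stalkπ_surjective h' x) (c := c) fun m ↦ by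
      refine (map_eq_zero_iff _ (stalkEquiv e x).injective).trans ?_
      rw [stalkπ_eq_zero_iff, hc]
      exact ⟨fun ⟨w, hw, e⟩ ↦ ⟨⟨w, hw⟩, Subtype.ext e⟩, fun ⟨w, e⟩ ↦ ⟨w, w.2, congrArg _ e⟩⟩
  constructor
  · intro hv
    obtain ⟨w, hw⟩ := (key ⟨v, le_iff_stalkSub_le.1 h' x hv⟩).1
      ((stalkπ_eq_zero_iff h' x _).2 hv)
    exact ⟨w, w.2, congrArg Subtype.val hw⟩
  · rintro ⟨w, hw, rfl⟩
    exact (stalkπ_eq_zero_iff h' x ⟨c • w, Submodule.smul_mem _ c hw⟩).1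
      ((key _).2 ⟨⟨w, hw⟩, rfl⟩)

/-- Both `D₁` and `D₂` are locally `cC`. -/
lemma IsScaled.fst_unique (hLM : IsScaled L M) (hM : IsLattice X M) (h : L ≤ M)
    {D₁ D₂ C : Subobject (ratSpace X d)} (hC : IsLattice X C) (h₁ : D₁ ≤ C) (h₂ : D₂ ≤ C)
    (e₁ : subquot h ≅ subquot h₁) (e₂ : subquot h ≅ subquot h₂) : D₁ = D₂ := by
  refine subobject_ext fun x ↦ ?_
  obtain ⟨c, -, hc⟩ := hLM x
  ext v
  rw [IsScaled.mem_iff hM h hc hC h₁ e₁, IsScaled.mem_iff hM h hc hC h₂ e₂]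

/-- Both `cD₁` and `cD₂` are locally `C`. -/
lemma IsScaled.snd_unique (hLM : IsScaled L M) (hM : IsLattice X M) (h : L ≤ M)
    {C D₁ D₂ : Subobject (ratSpace X d)} (hD₁ : IsLattice X D₁) (hD₂ : IsLattice X D₂)
    (h₁ : C ≤ D₁) (h₂ : C ≤ D₂)
    (e₁ : subquot h ≅ subquot h₁) (e₂ : subquot h ≅ subquot h₂) : D₁ = D₂ := by
  refine subobject_ext fun x ↦ ?_
  obtain ⟨c, hc0, hc⟩ := hLM x
  have hinj := (IsUniquelyDivisible.smul_bijective (V := (ratSpace X d).Stalk x) c hc0).1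
  have key (D : Subobject (ratSpace X d)) (hD : IsLattice X D) (h' : C ≤ D)
      (e : subquot h ≅ subquot h') (v : (ratSpace X d).Stalk x) :
      v ∈ stalkSub D x ↔ c • v ∈ stalkSub C x := by
    rw [IsScaled.mem_iff hM h hc hD h' e]
    exact ⟨fun hv ↦ ⟨v, hv, rfl⟩, fun ⟨w, hw, e⟩ ↦ hinj e ▸ hw⟩
  ext v
  rw [key D₁ hD₁ h₁ e₁, key D₂ hD₂ h₂ e₂]

end FiniteLengthModules

/-! ### Morphisms in the category of subquotients -/

namespace QCat

variable {A : Type u} [Category.{v} A] [Abelian A]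

/-- Uniqueness of the image factorization. -/
lemma exists_iso_of_comp_eq {K N M M' : A} {q : K ⟶ M} {q' : K ⟶ M'} {i : M ⟶ N} {i' : M' ⟶ N}
    [Epi q] [Epi q'] [Mono i] [Mono i'] (h : q ≫ i = q' ≫ i') :
    ∃ e : M ≅ M', q ≫ e.hom = q' ∧ e.hom ≫ i' = i := by
  have h₀ : i ≫ cokernel.π i' = 0 := by
    rw [← cancel_epi q, comp_zero, ← Category.assoc, h, Category.assoc, cokernel.condition,
      comp_zero]
  let l : M ⟶ M' := Abelian.monoLift i' i h₀
  have h₂ : l ≫ i' = i := Abelian.monoLift_comp _ _ _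
  have h₁ : q ≫ l = q' := by rw [← cancel_mono i', Category.assoc, h₂, h]
  have : Epi (q ≫ l) := by rwa [h₁]
  have : Epi l := epi_of_epi q _
  have : Mono (l ≫ i') := by rwa [h₂]
  have : Mono l := mono_of_mono _ i'
  have : IsIso l := isIso_of_mono_of_epi _
  exact ⟨asIso l, h₁, h₂⟩

lemma exists_homMk_eq {N N' : A} (f : QCat.mk N ⟶ QCat.mk N') :
    ∃ D : Diagram N N', homMk D = f := Quotient.exists_rep f

lemma homMk_eq_iff {N N' : A} {D E : Diagram N N'} : homMk D = homMk E ↔ D.Equiv E :=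
  Quotient.eq

/-- The cofibration defined by a monomorphism. -/
def ofMono {M N : A} (i : M ⟶ N) [Mono i] : QCat.mk N ⟶ QCat.mk M :=
  homMk ⟨M, i, 𝟙 M, inferInstance, inferInstance⟩

/-- The fibration defined by an epimorphism. -/
def ofEpi {M N : A} (p : M ⟶ N) [Epi p] : QCat.mk M ⟶ QCat.mk N :=
  homMk ⟨M, 𝟙 M, p, inferInstance, inferInstance⟩

/-- The composition can be computed with any fibre product. -/
lemma homMk_comp_homMk {N N' N'' K : A} (D : Diagram N N') (E : Diagram N' N'') {a : K ⟶ D.mid}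
    {b : K ⟶ E.mid} (h : IsPullback a b D.p E.i) [hi : Mono (a ≫ D.i)] [hp : Epi (b ≫ E.p)] :
    homMk D ≫ homMk E = homMk ⟨K, a ≫ D.i, b ≫ E.p, hi, hp⟩ := by
  refine (homMk_eq_iff (D := D.comp E)).2 ⟨h.isoPullback.symm, ?_, ?_⟩
  · exact (Category.assoc _ _ _).symm.trans (congrArg (· ≫ D.i) h.isoPullback_inv_fst)
  · exact (Category.assoc _ _ _).symm.trans (congrArg (· ≫ E.p) h.isoPullback_inv_snd)

lemma homMk_congr {N N' : A} {D E : Diagram N N'} (e : D.mid ≅ E.mid) (hi : e.hom ≫ E.i = D.i)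
    (hp : e.hom ≫ E.p = D.p) : homMk D = homMk E := homMk_eq_iff.2 ⟨e, hi, hp⟩

lemma homMk_comp_ofEpi {N N' N'' : A} (D : Diagram N N') (q : N' ⟶ N'') [Epi q]
    [hp : Epi (D.p ≫ q)] : homMk D ≫ ofEpi q = homMk ⟨D.mid, D.i, D.p ≫ q, D.mono, hp⟩ := by
  have : Mono D.i := D.mono
  have : Mono (𝟙 D.mid ≫ D.i) := by rwa [Category.id_comp]
  refine (homMk_comp_homMk D _ (IsPullback.of_horiz_isIso ⟨by simp⟩ :
    IsPullback (𝟙 D.mid) D.p D.p (𝟙 N'))).trans ?_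
  exact homMk_congr (Iso.refl _) (by simp) (by simp)

lemma ofMono_comp_homMk {M N N' : A} (j : M ⟶ N) [Mono j] (D : Diagram M N')
    [hi : Mono (D.i ≫ j)] : ofMono j ≫ homMk D = homMk ⟨D.mid, D.i ≫ j, D.p, hi, D.epi⟩ := by
  have : Epi D.p := D.epi
  have : Epi (𝟙 D.mid ≫ D.p) := by rwa [Category.id_comp]
  refine (homMk_comp_homMk ⟨M, j, 𝟙 M, inferInstance, inferInstance⟩ D
    (IsPullback.of_vert_isIso ⟨by simp⟩ : IsPullback D.i (𝟙 D.mid) (𝟙 M) D.i)).trans ?_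
  exact homMk_congr (Iso.refl _) (by simp) (by simp)

/-- Every morphism is the composite of a cofibration and a fibration. -/
lemma homMk_eq_comp {N N' : A} (D : Diagram N N') :
    homMk D = @ofMono A _ _ _ _ D.i D.mono ≫ @ofEpi A _ _ _ _ D.p D.epi := by
  have := D.mono
  have := D.epi
  have : Epi (𝟙 D.mid ≫ D.p) := by rwa [Category.id_comp]
  refine Eq.trans ?_ (homMk_comp_ofEpi ⟨D.mid, D.i, 𝟙 _, D.mono, inferInstance⟩ D.p).symm
  exact homMk_congr (Iso.refl _) (by simp) (by simp)

/-- An isomorphism of objects of `A` as an isomorphism of `QCat A`. -/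
def isoMk {N N' : A} (e : N ≅ N') : QCat.mk N ≅ QCat.mk N' where
  hom := ofEpi e.hom
  inv := ofEpi e.inv
  hom_inv_id := (homMk_comp_ofEpi _ _).trans (homMk_congr (Iso.refl _) (by simp [Diagram.id])
    (by simp [Diagram.id]))
  inv_hom_id := (homMk_comp_ofEpi _ _).trans (homMk_congr (Iso.refl _) (by simp [Diagram.id])
    (by simp [Diagram.id]))

lemma isoMk_hom_comp_homMk {N N' N'' : A} (e : N ≅ N') (D : Diagram N' N'')
    [hi : Mono (D.i ≫ e.inv)] :
    (isoMk e).hom ≫ homMk D = homMk ⟨D.mid, D.i ≫ e.inv, D.p, hi, D.epi⟩ := by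
  have := D.mono
  have := D.epi
  have : Epi (𝟙 D.mid ≫ D.p) := by rwa [Category.id_comp]
  have : Mono ((D.i ≫ e.inv) ≫ 𝟙 N) := by rwa [Category.comp_id]
  refine (homMk_comp_homMk ⟨N, 𝟙 N, e.hom, inferInstance, inferInstance⟩ D
    (IsPullback.of_vert_isIso ⟨by simp⟩ : IsPullback (D.i ≫ e.inv) (𝟙 D.mid) e.hom D.i)).trans ?_
  exact homMk_congr (Iso.refl _) (by simp) (by simp)

instance {M N : A} (i : M ⟶ N) [Mono i] : Epi (ofMono i) where
  left_cancellation {K} g h e := by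
    obtain ⟨D, rfl⟩ := exists_homMk_eq g
    obtain ⟨E, rfl⟩ := exists_homMk_eq h
    have := D.mono
    have := E.mono
    rw [ofMono_comp_homMk, ofMono_comp_homMk, homMk_eq_iff] at e
    obtain ⟨φ, h₁, h₂⟩ := e
    exact homMk_congr φ ((cancel_mono i).1 ((Category.assoc _ _ _).trans h₁)) h₂

instance {M N : A} (p : M ⟶ N) [Epi p] : Epi (ofEpi p) where
  left_cancellation {K} g h e := by
    obtain ⟨D, rfl⟩ := exists_homMk_eq g
    obtain ⟨E, rfl⟩ := exists_homMk_eq h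
    have := D.mono
    have := E.mono
    obtain ⟨φ, h₁, h₂⟩ : ∃ φ : pullback p D.i ≅ pullback p E.i,
        φ.hom ≫ pullback.fst p E.i ≫ 𝟙 M = pullback.fst p D.i ≫ 𝟙 M ∧
          φ.hom ≫ pullback.snd p E.i ≫ E.p = pullback.snd p D.i ≫ D.p := homMk_eq_iff.1 e
    rw [Category.comp_id, Category.comp_id] at h₁
    -- both `D.i` and `E.i` are the image of the same morphism
    have h₃ : (φ.hom ≫ pullback.snd p E.i) ≫ E.i = pullback.snd p D.i ≫ D.i := by
      rw [Category.assoc, ← pullback.condition, ← pullback.condition, ← Category.assoc, h₁]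
    obtain ⟨ψ, hψ₁, hψ₂⟩ := exists_iso_of_comp_eq h₃.symm
    refine homMk_congr ψ hψ₂ ((cancel_epi (pullback.snd p D.i)).1 ?_)
    rw [← h₂, ← Category.assoc, hψ₁, Category.assoc]

/-- Cofibrations and fibrations are epimorphisms, hence all morphisms are. -/
lemma epi {N N' : QCat A} (f : N ⟶ N') : Epi f := by
  obtain ⟨D, rfl⟩ := exists_homMk_eq f
  rw [homMk_eq_comp]
  have := D.mono
  have := D.epi
  exact epi_comp _ _

lemma fibrations_homMk_iff {N N' : A} (D : Diagram N N') :
    fibrations A (homMk D) ↔ IsIso D.i := by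
  refine ⟨fun ⟨E, hE, h⟩ ↦ ?_, fun h ↦ ⟨D, h, rfl⟩⟩
  obtain ⟨e, h₁, -⟩ := homMk_eq_iff.1 h
  rw [← h₁]
  infer_instance

lemma cofibrations_homMk_iff {N N' : A} (D : Diagram N N') :
    cofibrations A (homMk D) ↔ IsIso D.p := by
  refine ⟨fun ⟨E, hE, h⟩ ↦ ?_, fun h ↦ ⟨D, h, rfl⟩⟩
  obtain ⟨e, -, h₁⟩ := homMk_eq_iff.1 h
  rw [← h₁]
  infer_instance

lemma fibrations_comp_iff {N N' N'' : QCat A} (f : N ⟶ N') (g : N' ⟶ N'') :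
    fibrations A (f ≫ g) ↔ fibrations A f ∧ fibrations A g := by
  obtain ⟨D, rfl⟩ := exists_homMk_eq f
  obtain ⟨E, rfl⟩ := exists_homMk_eq g
  have := D.mono
  have := D.epi
  have := E.mono
  have := E.epi
  rw [fibrations_homMk_iff, fibrations_homMk_iff]
  refine (fibrations_homMk_iff (D.comp E)).trans ?_
  change IsIso (pullback.fst D.p E.i ≫ D.i) ↔ _
  constructor
  · intro h
    have : Epi D.i := epi_of_epi (pullback.fst D.p E.i) _
    have hD : IsIso D.i := isIso_of_mono_of_epi _
    have : IsIso (pullback.fst D.p E.i) := IsIso.of_isIso_comp_right _ D.i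
    have : Epi (pullback.snd D.p E.i ≫ E.i) := by
      rw [← pullback.condition]
      infer_instance
    have : Epi E.i := epi_of_epi (pullback.snd D.p E.i) _
    exact ⟨hD, isIso_of_mono_of_epi _⟩
  · rintro ⟨h₁, h₂⟩
    infer_instance

lemma cofibrations_comp_iff {N N' N'' : QCat A} (f : N ⟶ N') (g : N' ⟶ N'') :
    cofibrations A (f ≫ g) ↔ cofibrations A f ∧ cofibrations A g := by
  obtain ⟨D, rfl⟩ := exists_homMk_eq f
  obtain ⟨E, rfl⟩ := exists_homMk_eq g
  have := D.mono
  have := D.epi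
  have := E.mono
  have := E.epi
  rw [cofibrations_homMk_iff, cofibrations_homMk_iff]
  refine (cofibrations_homMk_iff (D.comp E)).trans ?_
  change IsIso (pullback.snd D.p E.i ≫ E.p) ↔ _
  constructor
  · intro h
    have : Mono (pullback.snd D.p E.i) := mono_of_mono _ E.p
    have : IsIso (pullback.snd D.p E.i) := isIso_of_mono_of_epi _
    have hE : IsIso E.p := IsIso.of_isIso_comp_left (pullback.snd D.p E.i) _
    have : Mono D.p := by
      rw [Preadditive.mono_iff_cancel_zero]
      intro T x hx
      let l := pullback.lift (f := D.p) (g := E.i) x 0 (by rw [hx, zero_comp])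
      have hl : l = 0 := by
        rw [← cancel_mono (pullback.snd D.p E.i), pullback.lift_snd, zero_comp]
      rw [← pullback.lift_fst (f := D.p) (g := E.i) x 0 (by rw [hx, zero_comp])]
      change l ≫ _ = 0
      rw [hl, zero_comp]
    exact ⟨isIso_of_mono_of_epi _, hE⟩
  · rintro ⟨h₁, h₂⟩
    infer_instance

/-- A morphism is determined by a subobject of the source and a morphism of `A`. -/
instance [∀ N : A, Small.{w} (Subobject N)] [LocallySmall.{w} A] : LocallySmall.{w} (QCat A) where
  hom_small N N' := by
    let S := Σ L : Subobject N.obj, {p : (L : A) ⟶ N'.obj // Epi p}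
    let f (s : S) : N ⟶ N' := homMk ⟨s.1, s.1.arrow, s.2.1, inferInstance, s.2.2⟩
    have hf : Function.Surjective f := by
      intro g
      obtain ⟨D, rfl⟩ := exists_homMk_eq g
      have := D.mono
      have := D.epi
      let e := Subobject.underlyingIso D.i
      refine ⟨⟨Subobject.mk D.i, e.hom ≫ D.p, inferInstance⟩, homMk_congr e ?_ ?_⟩
      · exact Subobject.underlyingIso_hom_comp_eq_mk _
      · rfl
    have (L : Subobject N.obj) : Small.{w} {p : (L : A) ⟶ N'.obj // Epi p} :=
      small_of_injective Subtype.val_injective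
    exact small_of_surjective hf

end QCat

/-! ### Pairs of lattices -/

section Subquotient

variable {A : Type u} [Category.{v} A] [Abelian A] {V : A}

/-- An inequality of subobjects can be checked after an epimorphism. -/
lemma le_of_epi_comp {L L' : Subobject V} {T : A} (π : T ⟶ (L : A)) [Epi π] (y : T ⟶ (L' : A))
    (h : π ≫ L.arrow = y ≫ L'.arrow) : L ≤ L' := by
  have h₀ : L.arrow ≫ cokernel.π L'.arrow = 0 := by
    rw [← cancel_epi π, comp_zero, ← Category.assoc, h, Category.assoc, cokernel.condition,
      comp_zero]
  exact Subobject.le_of_comm (Abelian.monoLift L'.arrow L.arrow h₀) (Abelian.monoLift_comp _ _ _)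

/-- A morphism of quotients of `M` under `M` gives an inequality of the kernels. -/
lemma le_of_subquotπ_comp {K K' M : Subobject V} (h : K ≤ M) (h' : K' ≤ M)
    (φ : subquot h ⟶ subquot h') (e : subquotπ h ≫ φ = subquotπ h') : K ≤ K' := by
  obtain ⟨l, hl⟩ := subquot_lift h' (Subobject.ofLE K M h) (by
    rw [← e, ← Category.assoc, ofLE_subquotπ, zero_comp])
  refine Subobject.le_of_comm l ?_
  rw [← Subobject.ofLE_arrow h', ← Category.assoc, hl, Subobject.ofLE_arrow]

/-- A morphism of subobjects of `M / L` over `M / L` gives an inequality of subobjects of `M`. -/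
lemma le_of_comp_subquotMap {L M M₁ M₂ : Subobject V} (h : L ≤ M) (h₁ : L ≤ M₁) (h₂ : L ≤ M₂)
    (hM₁ : M₁ ≤ M) (hM₂ : M₂ ≤ M) (φ : subquot h₁ ⟶ subquot h₂)
    (e : φ ≫ subquotMap h₂ h le_rfl hM₂ = subquotMap h₁ h le_rfl hM₁) : M₁ ≤ M₂ := by
  obtain ⟨T, π, hπ, y, hy⟩ := surjective_up_to_refinements_of_epi (subquotπ h₂) (subquotπ h₁ ≫ φ)
  obtain ⟨l, hl⟩ := subquot_lift h (y ≫ Subobject.ofLE M₂ M hM₂ - π ≫ Subobject.ofLE M₁ M hM₁) (by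
    have h₃ := congrArg (· ≫ subquotMap h₂ h le_rfl hM₂) hy
    simp only [Category.assoc, e, subquotπ_map] at h₃
    rw [Preadditive.sub_comp, Category.assoc, Category.assoc, ← h₃, sub_self])
  refine le_of_epi_comp π (y - l ≫ Subobject.ofLE L M₂ h₂) ?_
  have h₃ := congrArg (· ≫ M.arrow) hl
  simp only [Category.assoc, Subobject.ofLE_arrow, Preadditive.sub_comp] at h₃ ⊢
  rw [h₃]
  abel

lemma subquotMap_comp_eq_π {L L' M : Subobject V} (h : L ≤ M) (h' : L' ≤ M) (hL : L ≤ L') :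
    subquotπ h ≫ subquotMap h h' hL le_rfl = subquotπ h' := by
  rw [subquotπ_map, Subobject.ofLE_refl, Category.id_comp]

instance {L M M' : Subobject V} (h : L ≤ M) (h' : L ≤ M') (hM : M ≤ M') :
    Mono (subquotMap h h' le_rfl hM) := subquotMap_mono h h' hM

end Subquotient

open QCat in
/-- The morphism of `QCat A` defined by an inequality of pairs of subobjects. -/
noncomputable def pairMap {A : Type u} [Category.{v} A] [Abelian A] {V : A}
    {P : Subobject V → Prop} {a b : SubobjectPair P} (h : b ≤ a) :
    QCat.mk (subquot a.le) ⟶ QCat.mk (subquot b.le) :=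
  homMk (subquotDiagram h)

/-- The properties of the lattices in a module `V`, and of their quotients, on which the results
on the category of subquotients rest. The relation `Rigid L M` expresses that the quotient `M / L`
has so many generators that it determines `L` if `M` is given, and `M` if `L` is given. -/
structure IsLatticeSystem {A : Type u} [Category.{v} A] [Abelian A] {V : A}
    (Lat : Subobject V → Prop) (S : Subobject V) (Obj : ObjectProperty (QCat A))
    (Rigid : Subobject V → Subobject V → Prop) : Prop where
  std : Lat S
  inf {L M : Subobject V} : Lat L → Lat M → Lat (L ⊓ M)
  sup {L M : Subobject V} : Lat L → Lat M → Lat (L ⊔ M)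
  of_le_of_le {L K M : Subobject V} : Lat L → Lat M → L ≤ K → K ≤ M → Lat K
  obj {L M : Subobject V} (h : L ≤ M) : Lat L → Lat M → Obj ⟨subquot h⟩
  exists_fibration {L M : Subobject V} (h : L ≤ M) {N : A} (q : N ⟶ subquot h) : Lat L → Lat M →
    Obj ⟨N⟩ → Epi q → ∃ (K : Subobject V) (hK : K ≤ L) (e : subquot (hK.trans h) ≅ N),
      Lat K ∧ e.hom ≫ q = subquotMap (hK.trans h) h hK le_rfl
  exists_cofibration {L M : Subobject V} (h : L ≤ M) {N : A} (i : subquot h ⟶ N) : Lat L → Lat M →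
    Obj ⟨N⟩ → Mono i → ∃ (K : Subobject V) (hK : M ≤ K) (e : subquot (h.trans hK) ≅ N),
      Lat K ∧ subquotMap h (h.trans hK) le_rfl hK ≫ e.hom = i
  exists_rigid_le {L M : Subobject V} : Lat L → Lat M → ∃ K, Lat K ∧ K ≤ L ∧ Rigid K M
  exists_rigid_ge {L M : Subobject V} : Lat L → Lat M → ∃ K, Lat K ∧ M ≤ K ∧ Rigid L K
  fst_unique {L M C D₁ D₂ : Subobject V} (h : L ≤ M) (h₁ : D₁ ≤ C) (h₂ : D₂ ≤ C) : Rigid L M →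
    Lat M → Lat C → Nonempty (subquot h ≅ subquot h₁) → Nonempty (subquot h ≅ subquot h₂) → D₁ = D₂
  snd_unique {L M C D₁ D₂ : Subobject V} (h : L ≤ M) (h₁ : C ≤ D₁) (h₂ : C ≤ D₂) : Rigid L M →
    Lat M → Lat D₁ → Lat D₂ → Nonempty (subquot h ≅ subquot h₁) →
      Nonempty (subquot h ≅ subquot h₂) → D₁ = D₂

section Pairs

variable {A : Type u} [Category.{v} A] [Abelian A] {V : A} {P : Subobject V → Prop}

open QCat

lemma pairMap_comp {a b c : SubobjectPair P} (h : c ≤ b) (k : b ≤ a) :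
    pairMap k ≫ pairMap h = pairMap (h.trans k) :=
  (Quotient.sound (subquotDiagram_comp h k)).symm

/-- A quotient of `M / L` by an isomorphic subquotient is determined as a pair of subobjects. -/
lemma pair_unique {a b c : SubobjectPair P} (hb : b ≤ a) (hc : c ≤ a)
    (e : subquot b.le ≅ subquot c.le) (h : pairMap hb ≫ (isoMk e).hom = pairMap hc) : b = c := by
  have h' : homMk ⟨(subquotDiagram hb).mid, (subquotDiagram hb).i, (subquotDiagram hb).p ≫ e.hom,
      (subquotDiagram hb).mono, @epi_comp _ _ _ _ _ _ (subquotDiagram hb).epi _ _⟩ =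
        homMk (subquotDiagram hc) := by
    have := (subquotDiagram hb).epi
    exact (homMk_comp_ofEpi _ _).symm.trans h
  obtain ⟨φ, h₁, h₂⟩ : ∃ φ : subquot (hb.1.trans b.le) ≅ subquot (hc.1.trans c.le),
      φ.hom ≫ subquotMap (hc.1.trans c.le) a.le le_rfl hc.2 =
        subquotMap (hb.1.trans b.le) a.le le_rfl hb.2 ∧
      φ.hom ≫ subquotMap (hc.1.trans c.le) c.le hc.1 le_rfl =
        subquotMap (hb.1.trans b.le) b.le hb.1 le_rfl ≫ e.hom := homMk_eq_iff.1 h'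
  obtain ⟨b₁, b₂, hb₁, hb₂, hb'⟩ := b
  obtain ⟨c₁, c₂, hc₁, hc₂, hc'⟩ := c
  -- the middle objects are the same subobject of the quotient of `a`
  have h₃ : b₂ = c₂ := le_antisymm
    (le_of_comp_subquotMap a.le _ _ hb.2 hc.2 φ.hom h₁)
    (le_of_comp_subquotMap a.le _ _ hc.2 hb.2 φ.inv (by rw [← h₁, Iso.inv_hom_id_assoc]))
  subst h₃
  have h₄ : φ.hom = 𝟙 _ := by
    rw [← cancel_mono (subquotMap (hc.1.trans hc') a.le le_rfl hc.2), h₁, Category.id_comp]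
  have h₅ : subquotπ hb' ≫ e.hom = subquotπ hc' := by
    rw [← subquotMap_comp_eq_π (hb.1.trans hb') hb' hb.1,
      ← subquotMap_comp_eq_π (hc.1.trans hc') hc' hc.1, Category.assoc, ← h₂, h₄]
    exact congrArg _ (Category.id_comp _)
  have h₆ : b₁ = c₁ := le_antisymm
    (le_of_subquotπ_comp hb' hc' e.hom h₅)
    (le_of_subquotπ_comp hc' hb' e.inv (by rw [← h₅, Category.assoc, e.hom_inv_id,
      Category.comp_id]))
  subst h₆
  rfl

end Pairs

/-! ### Morphisms between quotients of pairs -/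

section Subquotient

variable {A : Type u} [Category.{v} A] [Abelian A] {V : A}

lemma isIso_subquotMap_iff_fst {L L' M : Subobject V} (h : L ≤ M) (h' : L' ≤ M) (hL : L ≤ L') :
    IsIso (subquotMap h h' hL le_rfl) ↔ L = L' := by
  refine ⟨fun _ ↦ le_antisymm hL ?_, ?_⟩
  · refine le_of_subquotπ_comp h' h (inv (subquotMap h h' hL le_rfl)) ?_
    rw [← subquotMap_comp_eq_π h h' hL, Category.assoc, IsIso.hom_inv_id, Category.comp_id]
  · rintro rfl
    rw [subquotMap_self]
    infer_instance

lemma isIso_subquotMap_iff_snd {L M M' : Subobject V} (h : L ≤ M) (h' : L ≤ M') (hM : M ≤ M') :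
    IsIso (subquotMap h h' le_rfl hM) ↔ M = M' := by
  refine ⟨fun _ ↦ le_antisymm hM ?_, ?_⟩
  · refine le_of_comp_subquotMap h' h' h le_rfl hM (inv (subquotMap h h' le_rfl hM)) ?_
    rw [IsIso.inv_hom_id, subquotMap_self]
  · rintro rfl
    rw [subquotMap_self]
    infer_instance

end Subquotient

section Pairs

variable {A : Type u} [Category.{v} A] [Abelian A] {V : A} {P : Subobject V → Prop}

open QCat

/-- A morphism from `M / L` to `N` in `QCat A` identifies `N` with the quotient of a pair of
subobjects between `L` and `M`. -/
lemma exists_pairMap_comp_eq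
    (hP : ∀ {L K M : Subobject V}, P L → P M → L ≤ K → K ≤ M → P K) (a : SubobjectPair P) {N : A}
    (f : QCat.mk (subquot a.le) ⟶ QCat.mk N) :
    ∃ (b : SubobjectPair P) (h : b ≤ a) (e : subquot b.le ≅ N),
      pairMap h ≫ (isoMk e).hom = f := by
  obtain ⟨D, rfl⟩ := exists_homMk_eq f
  have := D.mono
  have := D.epi
  -- `B` is the preimage in `a.snd` of the subobject `D.mid` of the quotient
  let j : pullback (subquotπ a.le) D.i ⟶ V := pullback.fst _ _ ≫ a.snd.arrow
  let B : Subobject V := Subobject.mk j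
  let ε : (B : A) ≅ pullback (subquotπ a.le) D.i := Subobject.underlyingIso j
  have hε : ε.hom ≫ pullback.fst _ _ ≫ a.snd.arrow = B.arrow :=
    Subobject.underlyingIso_hom_comp_eq_mk j
  have hB : B ≤ a.snd := Subobject.mk_le_of_comm (pullback.fst _ _) rfl
  have hε₁ : ε.hom ≫ pullback.fst _ _ = Subobject.ofLE B a.snd hB := by
    rw [← cancel_mono a.snd.arrow, Category.assoc, hε, Subobject.ofLE_arrow]
  let l : (a.fst : A) ⟶ pullback (subquotπ a.le) D.i :=
    pullback.lift (Subobject.ofLE _ _ a.le) 0 (by rw [ofLE_subquotπ, zero_comp])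
  have hl : (l ≫ ε.inv) ≫ B.arrow = a.fst.arrow := by
    rw [Category.assoc, ← hε, Iso.inv_hom_id_assoc, ← Category.assoc, pullback.lift_fst,
      Subobject.ofLE_arrow]
  have haB : a.fst ≤ B := Subobject.le_of_comm _ hl
  have hl' : Subobject.ofLE _ _ haB ≫ ε.hom = l := by
    rw [← Iso.eq_comp_inv, ← cancel_mono B.arrow, hl, Subobject.ofLE_arrow]
  obtain ⟨K, hK, e, he⟩ := exists_subquot_iso_of_epi (ε.hom ≫ pullback.snd _ _ ≫ D.p)
  -- `K` is the kernel of the projection of `B` to `N`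
  have haK : a.fst ≤ K := by
    obtain ⟨m, hm⟩ := subquot_lift hK (Subobject.ofLE _ _ haB) (by
      rw [← cancel_mono e.hom, Category.assoc, he, ← Category.assoc, hl', ← Category.assoc,
        pullback.lift_snd, zero_comp, zero_comp])
    refine Subobject.le_of_comm m ?_
    rw [← Subobject.ofLE_arrow hK, ← Category.assoc, hm, Subobject.ofLE_arrow]
  let b : SubobjectPair P :=
    ⟨K, B, hP a.fst_prop a.snd_prop haK (hK.trans hB),
      hP a.fst_prop a.snd_prop haB hB, hK⟩
  have hb : b ≤ a := ⟨haK, hB⟩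
  refine ⟨b, hb, e, ?_⟩
  have hp : Epi ((subquotDiagram hb).p ≫ e.hom) :=
    @epi_comp _ _ _ _ _ _ (subquotDiagram hb).epi _ _
  refine (homMk_comp_ofEpi (subquotDiagram hb) e.hom).trans ?_
  obtain ⟨ψ, h₁, h₂⟩ := exists_iso_of_comp_eq (q := subquotπ haB)
    (i := subquotMap haB a.le le_rfl hB) (q' := ε.hom ≫ pullback.snd _ _) (i' := D.i) (by
      rw [subquotπ_map, ← hε₁, Category.assoc, Category.assoc, pullback.condition])
  refine homMk_congr ψ h₂ ((cancel_epi (subquotπ haB)).1 ?_)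
  change subquotπ haB ≫ ψ.hom ≫ D.p = subquotπ haB ≫ subquotMap haB hK haK le_rfl ≫ e.hom
  rw [← Category.assoc, h₁, Category.assoc, ← he, ← subquotMap_comp_eq_π haB hK haK,
    Category.assoc]

lemma fibrations_pairMap_iff {a b : SubobjectPair P} (h : b ≤ a) :
    fibrations A (pairMap h) ↔ b.snd = a.snd :=
  (fibrations_homMk_iff _).trans (isIso_subquotMap_iff_snd (h.1.trans b.le) a.le h.2)

lemma cofibrations_pairMap_iff {a b : SubobjectPair P} (h : b ≤ a) :
    cofibrations A (pairMap h) ↔ a.fst = b.fst :=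
  (cofibrations_homMk_iff _).trans (isIso_subquotMap_iff_fst (h.1.trans b.le) b.le h.1)

end Pairs

namespace IsLatticeSystem

open QCat

variable {A : Type u} [Category.{v} A] [Abelian A] {V : A} {Lat : Subobject V → Prop}
  {S : Subobject V} {Obj : ObjectProperty (QCat A)} {Rigid : Subobject V → Subobject V → Prop}

section

variable (H : IsLatticeSystem Lat S Obj Rigid)
include H

/-- Every object is a quotient of the standard lattice. -/
lemma exists_le_std {N : A} (hN : Obj ⟨N⟩) :
    ∃ (a : SubobjectPair Lat), a.snd = S ∧ Nonempty (subquot a.le ≅ N) := by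
  have : IsZero (subquot (le_refl S)) := by
    rw [IsZero.iff_id_eq_zero, ← cancel_epi (subquotπ le_rfl), Category.comp_id, comp_zero,
      ← ofLE_subquotπ (le_refl S), Subobject.ofLE_refl, Category.id_comp]
  have hq : Epi (0 : N ⟶ subquot (le_refl S)) := ⟨fun _ _ _ ↦ this.eq_of_src _ _⟩
  obtain ⟨K, hK, e, hK', -⟩ := H.exists_fibration le_rfl _ H.std H.std hN hq
  exact ⟨⟨K, S, hK', H.std, hK⟩, rfl, ⟨e⟩⟩

/-- Every object is the quotient by the standard lattice of a larger one. -/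
lemma exists_std_le {N : A} (hN : Obj ⟨N⟩) :
    ∃ (a : SubobjectPair Lat), a.fst = S ∧ Nonempty (subquot a.le ≅ N) := by
  have : IsZero (subquot (le_refl S)) := by
    rw [IsZero.iff_id_eq_zero, ← cancel_epi (subquotπ le_rfl), Category.comp_id, comp_zero,
      ← ofLE_subquotπ (le_refl S), Subobject.ofLE_refl, Category.id_comp]
  have hi : Mono (0 : subquot (le_refl S) ⟶ N) := ⟨fun _ _ _ ↦ this.eq_of_tgt _ _⟩
  obtain ⟨K, hK, e, hK', -⟩ := H.exists_cofibration le_rfl _ H.std H.std hN hi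
  exact ⟨⟨S, K, H.std, hK', hK⟩, rfl, ⟨e⟩⟩

/-- A morphism from `N` to the quotient of a pair identifies `N` with the quotient of a larger
pair. -/
lemma exists_pairMap_eq (b : SubobjectPair Lat) {N : A} (hN : Obj ⟨N⟩)
    (f : QCat.mk N ⟶ QCat.mk (subquot b.le)) :
    ∃ (a : SubobjectPair Lat) (h : b ≤ a) (e : subquot a.le ≅ N),
      pairMap h = (isoMk e).hom ≫ f := by
  obtain ⟨D, rfl⟩ := exists_homMk_eq f
  have := D.mono
  have := D.epi
  -- the middle object `D.mid` of the diagram is the quotient of a pair `c`, as it is a subobject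
  -- of `N`
  obtain ⟨a₀, -, ⟨e⟩⟩ := H.exists_le_std hN
  obtain ⟨c, -, e₀, -⟩ := exists_pairMap_comp_eq H.of_le_of_le a₀ ((isoMk e).hom ≫ ofMono D.i)
  obtain ⟨K₁, hK₁, e₁, hK₁', h₁⟩ := H.exists_fibration b.le (e₀.hom ≫ D.p) b.fst_prop b.snd_prop
    (H.obj c.le c.fst_prop c.snd_prop) (epi_comp _ _)
  obtain ⟨K₂, hK₂, e₂, hK₂', h₂⟩ := H.exists_cofibration (hK₁.trans b.le)
    (e₁.hom ≫ e₀.hom ≫ D.i) hK₁' b.snd_prop hN inferInstance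
  refine ⟨⟨K₁, K₂, hK₁', hK₂', (hK₁.trans b.le).trans hK₂⟩, ⟨hK₁, hK₂⟩, e₂, ?_⟩
  refine Eq.trans ?_ (isoMk_hom_comp_homMk e₂ D).symm
  refine homMk_congr (e₁ ≪≫ e₀) ?_ ?_
  · change (e₁.hom ≫ e₀.hom) ≫ D.i ≫ e₂.inv = subquotMap (hK₁.trans b.le) _ le_rfl hK₂
    rw [← Category.assoc, Iso.comp_inv_eq, Category.assoc]
    exact h₂.symm
  · exact (Category.assoc _ _ _).trans h₁

/-- A morphism between quotients of pairs below a common pair comes from an inequality. -/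
lemma le_of_pairMap_comp_eq {a b c : SubobjectPair Lat} (hb : b ≤ a) (hc : c ≤ a)
    (α : QCat.mk (subquot b.le) ⟶ QCat.mk (subquot c.le)) (h : pairMap hb ≫ α = pairMap hc) :
    c ≤ b := by
  obtain ⟨c', hc', e, rfl⟩ := exists_pairMap_comp_eq H.of_le_of_le b α
  have := pair_unique (hc'.trans hb) hc e (by rw [← pairMap_comp hc' hb, Category.assoc, h])
  exact this ▸ hc'

/-- Two morphisms to the quotient of a pair `z` over the quotient of a smaller pair `b` differ by
an automorphism if `z` is rigid: both are given by pairs of lattices, and these are equal since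
their quotients are isomorphic. -/
lemma exists_aut_of_comp_eq {b z : SubobjectPair Lat} (h : b ≤ z) (hz : Rigid z.fst z.snd)
    (hb : z.fst = b.fst ∨ Rigid z.fst b.snd) {W : A} (hW : Obj ⟨W⟩)
    (α β : QCat.mk W ⟶ QCat.mk (subquot z.le)) (e : α ≫ pairMap h = β ≫ pairMap h) :
    ∃ τ : QCat.mk (subquot z.le) ≅ QCat.mk (subquot z.le),
      τ.hom ≫ pairMap h = pairMap h ∧ α ≫ τ.hom = β := by
  obtain ⟨w, hw, ε, hα⟩ := H.exists_pairMap_eq z hW α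
  obtain ⟨z', hz', t, hβ⟩ := exists_pairMap_comp_eq H.of_le_of_le w ((isoMk ε).hom ≫ β)
  obtain ⟨b', hb', s, hs⟩ := exists_pairMap_comp_eq H.of_le_of_le z' ((isoMk t).hom ≫ pairMap h)
  have h₁ : pairMap hz' ≫ (isoMk t).hom ≫ pairMap h = pairMap (h.trans hw) := by
    rw [← Category.assoc, hβ, Category.assoc, ← e, ← Category.assoc, ← hα, pairMap_comp]
  obtain rfl : b' = b := pair_unique (hb'.trans hz') (h.trans hw) s (by
    rw [← pairMap_comp hb' hz', Category.assoc, hs, h₁])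
  have h₂ : (isoMk t).hom ≫ pairMap h = pairMap hb' := by
    have := QCat.epi (pairMap hz')
    rw [← cancel_epi (pairMap hz'), h₁, pairMap_comp]
  have h₃ := h₂
  have := (subquotDiagram h).mono
  have hi : Mono ((subquotDiagram h).i ≫ t.inv) := mono_comp _ _
  rw [pairMap, isoMk_hom_comp_homMk] at h₃
  obtain ⟨ψ, -, hψ⟩ : ∃ ψ : subquot (h.1.trans b'.le) ≅ subquot (hb'.1.trans b'.le),
      ψ.hom ≫ subquotMap (hb'.1.trans b'.le) z'.le le_rfl hb'.2 =
        subquotMap (h.1.trans b'.le) z.le le_rfl h.2 ≫ t.inv ∧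
      ψ.hom ≫ subquotMap (hb'.1.trans b'.le) b'.le hb'.1 le_rfl =
        subquotMap (h.1.trans b'.le) b'.le h.1 le_rfl := homMk_eq_iff.1 h₃
  -- the quotients of `b.snd` by the smaller lattices of `z` and of the second pair are isomorphic over
  -- the quotient of `b`
  have hfst : z.fst = z'.fst := by
    rcases hb with hb | hb
    · have := (isIso_subquotMap_iff_fst (h.1.trans b'.le) b'.le h.1).2 hb
      rw [← hψ] at this
      have := IsIso.of_isIso_comp_left ψ.hom (subquotMap (hb'.1.trans b'.le) b'.le hb'.1 le_rfl)
      exact hb.trans ((isIso_subquotMap_iff_fst (hb'.1.trans b'.le) b'.le hb'.1).1 this).symm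
    · exact H.fst_unique _ _ _ hb b'.snd_prop b'.snd_prop ⟨Iso.refl _⟩ ⟨ψ⟩
  obtain ⟨z₁, z₂, hz₁, hz₂, hz₃⟩ := z
  obtain ⟨z₁', z₂', hz₁', hz₂', hz₃'⟩ := z'
  subst hfst
  obtain rfl : z₂ = z₂' := H.snd_unique hz₃ hz₃ hz₃' hz hz₂ hz₂ hz₂' ⟨Iso.refl _⟩ ⟨t.symm⟩
  refine ⟨isoMk t, h₂, ?_⟩
  have := IsIso.epi_of_iso (isoMk ε).hom
  rw [← cancel_epi (isoMk ε).hom, ← hβ, ← Category.assoc, ← hα]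

end

end IsLatticeSystem

/-! ### Sites and grids modelled by a poset -/

namespace YSite

section

variable {C : Type u} [Category.{v} C]

lemma coveringMorphisms_topology {T : MorphismProperty C} (h : IsSemiLocalizing T)
    (hT : ∀ {X Y Z : C} (f : X ⟶ Y) (g : Y ⟶ Z), T (f ≫ g) → T g) :
    coveringMorphisms h.topology = T := by
  ext Y X f
  constructor
  · rintro ⟨Z, _, hg, W, k, l, hl, rfl⟩
    obtain ⟨⟩ := hl
    exact hT _ _ hg
  · exact fun hf ↦ ⟨Y, f, hf, Sieve.le_generate _ _ _ (Presieve.singleton_self f)⟩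

/-- If all morphisms are epimorphisms, an automorphism is determined by its composition with
one morphism, so that only transitivity has to be checked. -/
lemma isGaloisCovering_of_exists (hC : ∀ {X Y : C} (f : X ⟶ Y), Epi f) {Y X : C} (f : Y ⟶ X)
    (h : ∀ (Z : C) (α β : Z ⟶ Y), α ≫ f = β ≫ f →
      ∃ τ : Y ≅ Y, τ.hom ≫ f = f ∧ α ≫ τ.hom = β) : IsGaloisCovering f := by
  intro Z α β e
  obtain ⟨τ, h₁, h₂⟩ := h Z α β e
  refine ⟨Over.isoMk τ h₁, h₂, fun σ hσ ↦ ?_⟩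
  ext
  have := hC α
  rw [← cancel_epi α, hσ]
  exact h₂.symm

end

variable {D : Type u} [Category.{v} D] {Q : Type u₁} [PartialOrder Q]

/-- The morphism of `D` attached to an inequality in the poset `Q`. -/
abbrev mapLE (F : Qᵒᵖ ⥤ D) {a b : Q} (h : b ≤ a) : F.obj (.op a) ⟶ F.obj (.op b) :=
  F.map (homOfLE h).op

lemma mapLE_comp (F : Qᵒᵖ ⥤ D) {a b c : Q} (h : c ≤ b) (k : b ≤ a) :
    mapLE F k ≫ mapLE F h = mapLE F (h.trans k) := (F.map_comp _ _).symm

/-- The category `D`, all of whose morphisms are epimorphisms, is modelled by the poset `Q`: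
morphisms to and from the object attached to an element of `Q` come from elements above it and
below it, respectively. -/
structure IsPosetModel (F : Qᵒᵖ ⥤ D) : Prop where
  epi {X Y : D} (f : X ⟶ Y) : Epi f
  exists_mapLE_eq (b : Q) {W : D} (f : W ⟶ F.obj (.op b)) :
    ∃ (a : Q) (h : b ≤ a) (e : F.obj (.op a) ≅ W), mapLE F h = e.hom ≫ f
  exists_mapLE_comp_eq (a : Q) {N : D} (f : F.obj (.op a) ⟶ N) :
    ∃ (b : Q) (h : b ≤ a) (e : F.obj (.op b) ≅ N), mapLE F h ≫ e.hom = f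
  le_of_mapLE_comp_eq {a b c : Q} (hb : b ≤ a) (hc : c ≤ a)
    (α : F.obj (.op b) ⟶ F.obj (.op c)) : mapLE F hb ≫ α = mapLE F hc → c ≤ b

/-- A class `T` of morphisms of `D` and a part `R` of the poset `Q` which form a site and a grid
of it. -/
structure IsGridModel (F : Qᵒᵖ ⥤ D) (T : MorphismProperty D) (R : Q → Prop) : Prop where
  comp_iff {X Y Z : D} (f : X ⟶ Y) (g : Y ⟶ Z) : T (f ≫ g) ↔ T f ∧ T g
  of_iso {X Y : D} (e : X ≅ Y) : T e.hom
  /-- Squares exist already in `Q`. -/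
  exists_square {a b c : Q} (ha : b ≤ a) (hc : b ≤ c) : T (mapLE F hc) →
    ∃ (j : Q) (hja : a ≤ j) (_ : c ≤ j), T (mapLE F hja)
  exists_galois {a b : Q} (h : b ≤ a) : T (mapLE F h) → ∃ (z : Q) (hz : a ≤ z), T (mapLE F hz) ∧
    ∀ (W : D) (α β : W ⟶ F.obj (.op z)), α ≫ mapLE F (h.trans hz) = β ≫ mapLE F (h.trans hz) →
      ∃ τ : F.obj (.op z) ≅ F.obj (.op z),
        τ.hom ≫ mapLE F (h.trans hz) = mapLE F (h.trans hz) ∧ α ≫ τ.hom = β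
  exists_edge (N : D) : ∃ E : Q, R E ∧ (∀ {a : Q} (h : E ≤ a), R a → T (mapLE F h)) ∧
    Nonempty (F.obj (.op E) ≅ N)
  of_le {a b : Q} : b ≤ a → R a → R b
  of_mapLE {a b : Q} (h : b ≤ a) : R b → T (mapLE F h) → R a
  exists_ge {a b : Q} : R a → R b → ∃ j, R j ∧ a ≤ j ∧ b ≤ j

namespace IsGridModel

variable {F : Qᵒᵖ ⥤ D} {T : MorphismProperty D} {R : Q → Prop}

lemma isSemiLocalizing (hF : IsPosetModel F) (hT : IsGridModel F T R) : IsSemiLocalizing T where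
  id_mem X := hT.of_iso (Iso.refl X)
  comp_mem f g hf hg := (hT.comp_iff f g).2 ⟨hf, hg⟩
  square {Y₁ Y₂ X} f₁ f₂ h := by
    obtain ⟨E, -, -, ⟨e⟩⟩ := hT.exists_edge X
    obtain ⟨a, ha, ε₁, h₁⟩ := hF.exists_mapLE_eq E (f₁ ≫ e.inv)
    obtain ⟨c, hc, ε₂, h₂⟩ := hF.exists_mapLE_eq E (f₂ ≫ e.inv)
    have h₃ : T (mapLE F hc) := by
      rw [h₂, hT.comp_iff, hT.comp_iff]
      exact ⟨hT.of_iso _, h, hT.of_iso e.symm⟩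
    obtain ⟨j, hja, hjc, h₄⟩ := hT.exists_square ha hc h₃
    refine ⟨F.obj (.op j), mapLE F hja ≫ ε₁.hom, mapLE F hjc ≫ ε₂.hom,
      (hT.comp_iff _ _).2 ⟨h₄, hT.of_iso _⟩, ?_⟩
    rw [← cancel_mono e.inv, Category.assoc, Category.assoc, Category.assoc, Category.assoc, ← h₁,
      ← h₂, mapLE_comp, mapLE_comp]

lemma coveringMorphisms_eq (hT : IsGridModel F T R) (h : IsSemiLocalizing T) :
    coveringMorphisms h.topology = T :=
  coveringMorphisms_topology h fun f g hfg ↦ ((hT.comp_iff f g).1 hfg).2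

lemma hasEnoughGaloisCoverings (hF : IsPosetModel F) (hT : IsGridModel F T R) :
    HasEnoughGaloisCoverings T := by
  intro Y X f hf
  obtain ⟨b, -, -, ⟨e⟩⟩ := hT.exists_edge X
  obtain ⟨a, ha, ε, h₁⟩ := hF.exists_mapLE_eq b (f ≫ e.inv)
  have h₂ : T (mapLE F ha) := by
    rw [h₁, hT.comp_iff, hT.comp_iff]
    exact ⟨hT.of_iso _, hf, hT.of_iso e.symm⟩
  obtain ⟨z, hz, h₃, h₄⟩ := hT.exists_galois ha h₂
  have h₅ : (mapLE F hz ≫ ε.hom) ≫ f = mapLE F (ha.trans hz) ≫ e.hom := by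
    rw [← cancel_mono e.inv, Category.assoc, Category.assoc, Category.assoc, ← h₁, mapLE_comp,
      e.hom_inv_id, Category.comp_id]
  refine ⟨F.obj (.op z), mapLE F hz ≫ ε.hom, (hT.comp_iff _ _).2 ⟨h₃, hT.of_iso _⟩, ?_⟩
  rw [h₅]
  refine isGaloisCovering_of_exists hF.epi _ fun W α β h ↦ ?_
  obtain ⟨τ, h₆, h₇⟩ := h₄ W α β (by
    rwa [← Category.assoc, ← Category.assoc, cancel_mono] at h)
  exact ⟨τ, by rw [← Category.assoc, h₆], h₇⟩

lemma isYSite [Small.{w} Q] [LocallySmall.{w} D] (hF : IsPosetModel F) (hT : IsGridModel F T R)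
    (h : IsSemiLocalizing T) : IsYSite.{w} h.topology where
  isBSite :=
    { isATopology := ⟨T, h, rfl⟩
      epi := hF.epi
      comp_iff := by
        intro Z Y X g f
        rw [hT.coveringMorphisms_eq h]
        exact hT.comp_iff g f }
  essentiallySmall := by
    refine (essentiallySmall_iff D).2 ⟨?_, inferInstance⟩
    refine small_of_surjective (f := fun a : Q ↦ toSkeleton (F.obj (.op a))) fun N ↦ ?_
    obtain ⟨E, -, -, ⟨e⟩⟩ := hT.exists_edge ((fromSkeleton D).obj N)
    exact ⟨E, (congr_toSkeleton_of_iso e).trans (toSkeleton_fromSkeleton_obj N)⟩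
  isLambdaConnected := by
    rw [hT.coveringMorphisms_eq h]
    intro X Y
    obtain ⟨E, hE, hE', ⟨e⟩⟩ := hT.exists_edge X
    obtain ⟨E₁, hE₁, hE₁', ⟨e₁⟩⟩ := hT.exists_edge Y
    obtain ⟨j, hj, h₁, h₂⟩ := hT.exists_ge hE hE₁
    exact ⟨F.obj (.op j), mapLE F h₁ ≫ e.hom, mapLE F h₂ ≫ e₁.hom,
      (hT.comp_iff _ _).2 ⟨hE' h₁ hj, hT.of_iso _⟩,
      (hT.comp_iff _ _).2 ⟨hE₁' h₂ hj, hT.of_iso _⟩⟩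
  enoughGalois := by
    rw [hT.coveringMorphisms_eq h]
    exact hT.hasEnoughGaloisCoverings hF

/-- The part `R` of the poset is given as a category `C₀` with a fully faithful functor to `Qᵒᵖ`
which is injective on objects. -/
lemma isGrid [Small.{w} Q] {C₀ : Type*} [Category C₀] (κ : C₀ ⥤ Qᵒᵖ) (hκ : κ.FullyFaithful)
    (hinj : Function.Injective κ.obj) (hR : ∀ a : Q, R a ↔ ∃ x, κ.obj x = .op a)
    (hF : IsPosetModel F) (hT : IsGridModel F T R) (h : IsSemiLocalizing T) :
    IsGrid.{w} h.topology (κ ⋙ F) := by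
  have hR' (x : C₀) : R (κ.obj x).unop := (hR _).2 ⟨x, rfl⟩
  have hthin : Quiver.IsThin C₀ := fun x y ↦ ⟨fun f g ↦ hκ.map_injective (Subsingleton.elim _ _)⟩
  have hpre {x : C₀} {a b : Q} (ha : κ.obj x = .op a) : ∀ {y : C₀} (hb : κ.obj y = .op b)
      (hab : b ≤ a), Nonempty (x ⟶ y) := by
    intro y hb hab
    exact ⟨hκ.preimage (eqToHom ha ≫ (homOfLE hab).op ≫ eqToHom hb.symm)⟩
  refine
    { small := ?_
      thin := hthin
      skeletal := ?_
      isLambdaConnected := ?_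
      essSurj_edge := ?_
      essSurj_over := ?_
      isEquivalence_under := ?_ }
  · exact small_of_injective (Opposite.unop_injective.comp hinj)
  · rintro x y ⟨e⟩
    refine hinj (Opposite.unop_injective (le_antisymm ?_ ?_))
    · exact leOfHom (κ.map e.inv).unop
    · exact leOfHom (κ.map e.hom).unop
  · intro x y
    obtain ⟨j, hj, h₁, h₂⟩ := hT.exists_ge (hR' x) (hR' y)
    obtain ⟨z, hz⟩ := (hR j).1 hj
    obtain ⟨f⟩ := hpre hz (rfl : κ.obj x = .op (κ.obj x).unop) h₁
    obtain ⟨g⟩ := hpre hz (rfl : κ.obj y = .op (κ.obj y).unop) h₂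
    exact ⟨z, f, g, trivial, trivial⟩
  · intro X
    obtain ⟨E, hE, hE', hX⟩ := hT.exists_edge X
    obtain ⟨x, hx⟩ := (hR E).1 hE
    obtain rfl : (κ.obj x).unop = E := by rw [hx]
    refine ⟨x, fun y f ↦ ?_, hX⟩
    rw [hT.coveringMorphisms_eq h]
    exact hE' (leOfHom (κ.map f).unop) (hR' y)
  · intro X Y' f' hf'
    rw [hT.coveringMorphisms_eq h] at hf' ⊢
    obtain ⟨a, ha, e, h₁⟩ := hF.exists_mapLE_eq (κ.obj X).unop f'
    have h₂ : T (mapLE F ha) := by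
      rw [h₁]
      exact (hT.comp_iff _ _).2 ⟨hT.of_iso e, hf'⟩
    obtain ⟨y, hy⟩ := (hR a).1 (hT.of_mapLE ha (hR' X) h₂)
    obtain rfl : (κ.obj y).unop = a := by rw [hy]
    exact ⟨y, hκ.preimage (homOfLE ha).op, e, by simpa using h₂, by simpa using h₁⟩
  · intro X
    refine ⟨⟨fun {A B} f g _ ↦ ?_⟩, ⟨fun {A B} f ↦ ?_⟩, ⟨fun N ↦ ?_⟩⟩
    · ext
      exact Subsingleton.elim _ _
    · let α : F.obj (κ.obj A.right) ⟶ F.obj (κ.obj B.right) := f.right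
      have hα : F.map (κ.map A.hom) ≫ α = F.map (κ.map B.hom) := Under.w f
      have h₁ := hF.le_of_mapLE_comp_eq (leOfHom (κ.map A.hom).unop) (leOfHom (κ.map B.hom).unop)
        α hα
      have := hF.epi (F.map (κ.map A.hom))
      refine ⟨Under.homMk (hκ.preimage (homOfLE h₁).op) (Subsingleton.elim _ _), ?_⟩
      ext
      change F.map (κ.map (hκ.preimage (homOfLE h₁).op)) = α
      rw [hκ.map_preimage, ← cancel_epi (F.map (κ.map A.hom)), hα]
      exact mapLE_comp F h₁ (leOfHom (κ.map A.hom).unop)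
    · obtain ⟨b, hb, e, h₁⟩ := hF.exists_mapLE_comp_eq (κ.obj X).unop N.hom
      obtain ⟨y, hy⟩ := (hR b).1 (hT.of_le hb (hR' X))
      obtain rfl : (κ.obj y).unop = b := by rw [hy]
      refine ⟨Under.mk (hκ.preimage (homOfLE hb).op), ⟨Under.isoMk e ?_⟩⟩
      change F.map (κ.map (hκ.preimage (homOfLE hb).op)) ≫ e.hom = N.hom
      rw [hκ.map_preimage]
      exact h₁

end IsGridModel

end YSite

/-! ### The sites and grids defined by pairs of lattices -/

lemma QCat.fibrations_id {A : Type u} [Category.{v} A] [Abelian A] (N : QCat A) :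
    QCat.fibrations A (𝟙 N) := ⟨Diagram.id N.obj, inferInstanceAs (IsIso (𝟙 N.obj)), rfl⟩

lemma QCat.cofibrations_id {A : Type u} [Category.{v} A] [Abelian A] (N : QCat A) :
    QCat.cofibrations A (𝟙 N) := ⟨Diagram.id N.obj, inferInstanceAs (IsIso (𝟙 N.obj)), rfl⟩

namespace IsLatticeSystem

open QCat YSite

variable {A : Type u} [Category.{v} A] [Abelian A] {V : A} {Lat : Subobject V → Prop}
  {S : Subobject V} {Obj : ObjectProperty (QCat A)} {Rigid : Subobject V → Subobject V → Prop}

section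

variable (H : IsLatticeSystem Lat S Obj Rigid)
include H

/-- The supremum of two pairs of lattices. -/
lemma exists_ge (a b : SubobjectPair Lat) : ∃ j : SubobjectPair Lat, a ≤ j ∧ b ≤ j ∧
    j.fst = a.fst ⊓ b.fst ∧ j.snd = a.snd ⊔ b.snd :=
  ⟨⟨_, _, H.inf a.fst_prop b.fst_prop, H.sup a.snd_prop b.snd_prop,
    inf_le_left.trans (a.le.trans le_sup_left)⟩, ⟨inf_le_left, le_sup_left⟩,
    ⟨inf_le_right, le_sup_right⟩, rfl, rfl⟩

variable (hι : ∀ a, Obj ((subquotFunctor Lat).obj a))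

lemma isPosetModel : IsPosetModel (Obj.lift (subquotFunctor Lat) hι) where
  epi f := ⟨fun g h e ↦ by
    ext
    have := QCat.epi f.hom
    exact (cancel_epi f.hom).1 (congrArg (·.hom) e)⟩
  exists_mapLE_eq b W f := by
    obtain ⟨a, h, e, he⟩ := H.exists_pairMap_eq b W.property f.hom
    exact ⟨a, h, Obj.isoMk (QCat.isoMk e), ObjectProperty.hom_ext _ he⟩
  exists_mapLE_comp_eq a N f := by
    obtain ⟨b, h, e, he⟩ := exists_pairMap_comp_eq H.of_le_of_le a f.hom
    exact ⟨b, h, Obj.isoMk (QCat.isoMk e), ObjectProperty.hom_ext _ he⟩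
  le_of_mapLE_comp_eq hb hc α e := H.le_of_pairMap_comp_eq hb hc α.hom (congrArg (·.hom) e)

lemma exists_galois {b z : SubobjectPair Lat} (h : b ≤ z) (hz : Rigid z.fst z.snd)
    (hb : z.fst = b.fst ∨ Rigid z.fst b.snd) (W : Obj.FullSubcategory)
    (α β : W ⟶ (Obj.lift (subquotFunctor Lat) hι).obj (.op z))
    (e : α ≫ mapLE (Obj.lift (subquotFunctor Lat) hι) h =
      β ≫ mapLE (Obj.lift (subquotFunctor Lat) hι) h) :
    ∃ τ : (Obj.lift (subquotFunctor Lat) hι).obj (.op z) ≅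
        (Obj.lift (subquotFunctor Lat) hι).obj (.op z),
      τ.hom ≫ mapLE (Obj.lift (subquotFunctor Lat) hι) h =
        mapLE (Obj.lift (subquotFunctor Lat) hι) h ∧ α ≫ τ.hom = β := by
  obtain ⟨τ, h₁, h₂⟩ := H.exists_aut_of_comp_eq h hz hb W.property α.hom β.hom
    (congrArg (·.hom) e)
  exact ⟨Obj.isoMk τ, ObjectProperty.hom_ext _ h₁, ObjectProperty.hom_ext _ h₂⟩

lemma isGridModel_top :
    IsGridModel (Obj.lift (subquotFunctor Lat) hι) ⊤ (fun _ ↦ True) where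
  comp_iff _ _ := ⟨fun _ ↦ ⟨trivial, trivial⟩, fun _ ↦ trivial⟩
  of_iso _ := trivial
  exists_square {a _ c} _ _ _ := by
    obtain ⟨j, h₁, h₂, -⟩ := H.exists_ge a c
    exact ⟨j, h₁, h₂, trivial⟩
  exists_galois {a b} h _ := by
    -- first the smaller lattice is made rigid with respect to `b`, then the larger one with respect
    -- to the new smaller one
    obtain ⟨K, hK, hKa, hKb⟩ := H.exists_rigid_le a.fst_prop b.snd_prop
    obtain ⟨K', hK', hK'a, hK'K⟩ := H.exists_rigid_ge hK a.snd_prop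
    exact ⟨⟨K, K', hK, hK', (hKa.trans a.le).trans hK'a⟩, ⟨hKa, hK'a⟩, trivial,
      H.exists_galois hι _ hK'K (Or.inr hKb)⟩
  exists_edge N := by
    obtain ⟨E, -, ⟨e⟩⟩ := H.exists_le_std N.property
    exact ⟨E, trivial, fun _ _ ↦ trivial, ⟨Obj.isoMk (QCat.isoMk e)⟩⟩
  of_le _ _ := trivial
  of_mapLE _ _ _ := trivial
  exists_ge {a b} _ _ := by
    obtain ⟨j, h₁, h₂, -⟩ := H.exists_ge a b
    exact ⟨j, trivial, h₁, h₂⟩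

lemma isGridModel_fibrations :
    IsGridModel (Obj.lift (subquotFunctor Lat) hι) ((QCat.fibrations A).inverseImage Obj.ι)
      (fun a ↦ a.snd ≤ S) where
  comp_iff f g := fibrations_comp_iff f.hom g.hom
  of_iso e := ((fibrations_comp_iff e.hom.hom e.inv.hom).1 (by
    rw [ObjectProperty.isoHom_inv_id_hom]
    exact fibrations_id _)).1
  exists_square {a b c} ha hc h := by
    obtain ⟨j, h₁, h₂, -, h₃⟩ := H.exists_ge a c
    refine ⟨j, h₁, h₂, (fibrations_pairMap_iff h₁).2 ?_⟩
    rw [h₃, left_eq_sup, ← (fibrations_pairMap_iff hc).1 h]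
    exact ha.2
  exists_galois {a b} h hab := by
    obtain ⟨K, hK, hKa, hK'⟩ := H.exists_rigid_le a.fst_prop a.snd_prop
    exact ⟨⟨K, a.snd, hK, a.snd_prop, hKa.trans a.le⟩, ⟨hKa, le_rfl⟩,
      (fibrations_pairMap_iff _).2 rfl,
      H.exists_galois hι _ hK' (Or.inr (((fibrations_pairMap_iff h).1 hab).symm ▸ hK'))⟩
  exists_edge N := by
    obtain ⟨E, hE, ⟨e⟩⟩ := H.exists_le_std N.property
    exact ⟨E, hE.le, fun h ha ↦ (fibrations_pairMap_iff h).2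
      (le_antisymm h.2 (ha.trans_eq hE.symm)), ⟨Obj.isoMk (QCat.isoMk e)⟩⟩
  of_le h ha := h.2.trans ha
  of_mapLE h hb hab := ((fibrations_pairMap_iff h).1 hab).ge.trans hb
  exists_ge {a b} ha hb := by
    obtain ⟨j, h₁, h₂, -, h₃⟩ := H.exists_ge a b
    exact ⟨j, h₃.trans_le (sup_le ha hb), h₁, h₂⟩

lemma isGridModel_cofibrations :
    IsGridModel (Obj.lift (subquotFunctor Lat) hι) ((QCat.cofibrations A).inverseImage Obj.ι)
      (fun a ↦ S ≤ a.fst) where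
  comp_iff f g := cofibrations_comp_iff f.hom g.hom
  of_iso e := ((cofibrations_comp_iff e.hom.hom e.inv.hom).1 (by
    rw [ObjectProperty.isoHom_inv_id_hom]
    exact cofibrations_id _)).1
  exists_square {a b c} ha hc h := by
    obtain ⟨j, h₁, h₂, h₃, -⟩ := H.exists_ge a c
    refine ⟨j, h₁, h₂, (cofibrations_pairMap_iff h₁).2 ?_⟩
    rw [h₃, inf_eq_left, (cofibrations_pairMap_iff hc).1 h]
    exact ha.1
  exists_galois {a b} h hab := by
    obtain ⟨K, hK, hKa, hK'⟩ := H.exists_rigid_ge a.fst_prop a.snd_prop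
    exact ⟨⟨a.fst, K, a.fst_prop, hK, a.le.trans hKa⟩, ⟨le_rfl, hKa⟩,
      (cofibrations_pairMap_iff _).2 rfl,
      H.exists_galois hι _ hK' (Or.inl ((cofibrations_pairMap_iff h).1 hab))⟩
  exists_edge N := by
    obtain ⟨E, hE, ⟨e⟩⟩ := H.exists_std_le N.property
    exact ⟨E, hE.ge, fun h ha ↦ (cofibrations_pairMap_iff h).2
      (le_antisymm h.1 (hE.trans_le ha)), ⟨Obj.isoMk (QCat.isoMk e)⟩⟩
  of_le h ha := ha.trans h.1
  of_mapLE h hb hab := hb.trans_eq ((cofibrations_pairMap_iff h).1 hab).symm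
  exists_ge {a b} ha hb := by
    obtain ⟨j, h₁, h₂, h₃, -⟩ := H.exists_ge a b
    exact ⟨j, (le_inf ha hb).trans_eq h₃.symm, h₁, h₂⟩

end

end IsLatticeSystem

instance {A : Type u} [Category.{v} A] {V : A} (P : Subobject V → Prop) [Small.{w} (Subobject V)] :
    Small.{w} (SubobjectPair P) :=
  small_of_injective (f := fun a ↦ (a.fst, a.snd)) fun _ _ h ↦
    SubobjectPair.ext (congrArg Prod.fst h) (congrArg Prod.snd h)

namespace FiniteLengthModules

open AlgebraicGeometry

lemma isLatticeSystem (X : Scheme.{u}) [IsRegularCurve X] (d : ℕ) :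
    IsLatticeSystem (IsLattice X (d := d)) (stdLattice X d) (isObject X d) IsScaled where
  std := isLattice_stdLattice
  inf := IsLattice.inf
  sup := IsLattice.sup
  of_le_of_le := IsLattice.of_le_of_le
  obj h hL hM := hL.isObject_subquot hM h
  exists_fibration h _ q _ hM hN _ := by
    obtain ⟨K, hK, e, h₁, h₂⟩ := hM.exists_fibration h hN q
    exact ⟨K, hK, e, h₁, h₂⟩
  exists_cofibration h _ i hL hM hN _ := by
    obtain ⟨K, hK, e, h₁, h₂⟩ := hL.exists_cofibration hM h hN i
    exact ⟨K, hK, e, h₁, h₂⟩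
  exists_rigid_le hL hM := hL.exists_isScaled_le hM
  exists_rigid_ge hL hM := hL.exists_isScaled_ge hM
  fst_unique h h₁ h₂ hLM hM hC := fun ⟨e₁⟩ ⟨e₂⟩ ↦ hLM.fst_unique hM h hC h₁ h₂ e₁ e₂
  snd_unique h h₁ h₂ hLM hM hD₁ hD₂ := fun ⟨e₁⟩ ⟨e₂⟩ ↦ hLM.snd_unique hM h hD₁ hD₂ h₁ h₂ e₁ e₂

end FiniteLengthModules

theorem mainTheorem3 (X : AlgebraicGeometry.Scheme.{u}) [AlgebraicGeometry.IsNoetherian X]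
    (hreg : ∀ x : X, IsRegularLocalRing (X.presheaf.stalk x))
    (hdim : ∀ Z ∈ irreducibleComponents X, topologicalKrullDim Z = 1)
    (d : ℕ) (hd : 1 ≤ d) :
    ∃ hι : ∀ p : FiniteLengthModules.PairCat X d,
        FiniteLengthModules.isObject X d ((FiniteLengthModules.quotFunctor X d).obj p),
      (∃ h : YSite.IsSemiLocalizing (FiniteLengthModules.allMorphisms X d),
        YSite.IsYSite.{u} h.topology ∧
        YSite.IsGrid.{u} h.topology
          ((FiniteLengthModules.isObject X d).lift (FiniteLengthModules.quotFunctor X d) hι)) ∧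
      (∃ h : YSite.IsSemiLocalizing (FiniteLengthModules.fibrations X d),
        YSite.IsYSite.{u} h.topology ∧
        YSite.IsGrid.{u} h.topology
          ((FiniteLengthModules.isPairM X d).ι ⋙
            (FiniteLengthModules.isObject X d).lift (FiniteLengthModules.quotFunctor X d) hι)) ∧
      (∃ h : YSite.IsSemiLocalizing (FiniteLengthModules.cofibrations X d),
        YSite.IsYSite.{u} h.topology ∧
        YSite.IsGrid.{u} h.topology
          ((FiniteLengthModules.isPairR X d).ι ⋙
            (FiniteLengthModules.isObject X d).lift (FiniteLengthModules.quotFunctor X d) hι)) := by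
  have : AlgebraicGeometry.IsRegularCurve X := ⟨hreg, hdim⟩
  have H := FiniteLengthModules.isLatticeSystem X d
  have hι (p : FiniteLengthModules.PairCat X d) : FiniteLengthModules.isObject X d
      ((FiniteLengthModules.quotFunctor X d).obj p) := H.obj p.unop.le p.unop.fst_prop p.unop.snd_prop
  have hF := H.isPosetModel hι
  refine ⟨hι, ⟨(H.isGridModel_top hι).isSemiLocalizing hF, ?_, ?_⟩,
    ⟨(H.isGridModel_fibrations hι).isSemiLocalizing hF, ?_, ?_⟩,
    ⟨(H.isGridModel_cofibrations hι).isSemiLocalizing hF, ?_, ?_⟩⟩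
  · exact (H.isGridModel_top hι).isYSite hF _
  · exact (H.isGridModel_top hι).isGrid (𝟭 _) (.id _) (fun _ _ h ↦ h)
      (fun a ↦ ⟨fun _ ↦ ⟨.op a, rfl⟩, fun _ ↦ trivial⟩) hF _
  · exact (H.isGridModel_fibrations hι).isYSite hF _
  · exact (H.isGridModel_fibrations hι).isGrid _ (ObjectProperty.fullyFaithfulι _)
      (fun _ _ h ↦ ObjectProperty.FullSubcategory.ext h)
      (fun a ↦ ⟨fun h ↦ ⟨⟨.op a, h⟩, rfl⟩, fun ⟨x, h⟩ ↦
        Eq.subst (motive := FiniteLengthModules.isPairM X d) h x.property⟩)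
      hF _
  · exact (H.isGridModel_cofibrations hι).isYSite hF _
  · exact (H.isGridModel_cofibrations hι).isGrid _ (ObjectProperty.fullyFaithfulι _)
      (fun _ _ h ↦ ObjectProperty.FullSubcategory.ext h)
      (fun a ↦ ⟨fun h ↦ ⟨⟨.op a, h⟩, rfl⟩, fun ⟨x, h⟩ ↦
        Eq.subst (motive := FiniteLengthModules.isPairR X d) h x.property⟩)
      hF _
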